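/- **Conventions.** For $j\ge 1$ let $\mathfrak{so}(2,j)$ be the real Lie algebra of the quadratic form $x_1^2+x_2^2-y_1^2-\dots-y_j^2$, let $\mathfrak{k}=\mathfrak{so}(2)\oplus\mathfrak{so}(j)$ be its standard maximal compact subalgebra, $Z_0=\begin{pmatrix}0&-1\\1&0\end{pmatrix}$ the generator of the $\mathfrak{so}(2)$-factor, and $\mathfrak{p}^+$ the $(+i)$-eigenspace of $\operatorname{ad}(Z_0)$ in $\mathfrak{so}(2,j)_{\mathbb{C}}$. For $\lambda\in\mathbb{R}$, a unitary highest weight representation $d\pi_\lambda^{\mathfrak{so}(2,j)}$ of $\mathfrak{so}(2,j)$ of scalar type with parameter $\lambda$ is a nonzero irreducible $\mathfrak{k}$-finite complex $\mathfrak{so}(2,j)$-module with an inner product for which $\mathfrak{so}(2,j)$ acts by skew-Hermitian operators, such that the space of vectors annihilated by $\mathfrak{p}^+$ is one-dimensional and on it $Z_0$ acts by the scalar $-i\lambda$ and $\mathfrak{so}(j)$ acts by zero. (This is the underlying $(\mathfrak{g},\widetilde K)$-module of a unitary representation of the universal covering group; for $j\geq 3$ the Wallach set of admissible parameters is $\{0,\tfrac{j-2}{2}\}\cup(\tfrac{j-2}{2},\infty)$.)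 Let $\mathcal{H}^k(\mathbb{R}^l)$ be the space of complex harmonic homogeneous polynomials of degree $k$ on $\mathbb{R}^l$, with the natural action of $\mathfrak{so}(l)$, and with any $\mathfrak{so}(l)$-invariant inner product. **Theorem.** Let $n\ge 3$, $1\le m\le n$, and $\lambda=\frac{n-2}{2}$, the minimal nonzero discrete Wallach point for $\mathfrak{so}(2,n)$. The representations $d\pi_\lambda^{\mathfrak{so}(2,n)}$ and $d\pi_{\lambda+k}^{\mathfrak{so}(2,m)}$, $k\geq 0$, exist, and for all realizations of them there is an isomorphism of modules over the block diagonal subalgebra $\mathfrak{so}(2,m)\oplus\mathfrak{so}(n-m)\subseteq\mathfrak{so}(2,n)$ $$ d\pi_\lambda^{\mathfrak{so}(2,n)}\big|_{\mathfrak{so}(2,m)\oplus\mathfrak{so}(n-m)}\;\cong\;\bigoplus_{k=0}^\infty d\pi_{\lambda+k}^{\mathfrak{so}(2,m)}\boxtimes\mathcal{H}^k(\mathbb{R}^{n-m}), $$ under which the direct sum is orthogonal and which is isometric on each summand. -/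

import Mathlib

open scoped TensorProduct DirectSum

attribute [local instance 100] LieRing.ofAssociativeRing

noncomputable section

namespace Branching

/-- The real Lie algebra `𝔰𝔬(2, j)`. -/
abbrev so2 (j : ℕ) : LieSubalgebra ℝ (Matrix (Fin 2 ⊕ Fin j) (Fin 2 ⊕ Fin j) ℝ) :=
  LieAlgebra.Orthogonal.so' (Fin 2) (Fin j) ℝ

/-- The compact real Lie algebra `𝔰𝔬(l)`. -/
abbrev so (l : ℕ) : LieSubalgebra ℝ (Matrix (Fin l) (Fin l) ℝ) :=
  LieAlgebra.Orthogonal.so (Fin l) ℝ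

theorem mem_so2 {j : ℕ} (A : Matrix (Fin 2 ⊕ Fin j) (Fin 2 ⊕ Fin j) ℝ) :
    A ∈ so2 j ↔ A.transpose * LieAlgebra.Orthogonal.indefiniteDiagonal (Fin 2) (Fin j) ℝ
      = LieAlgebra.Orthogonal.indefiniteDiagonal (Fin 2) (Fin j) ℝ * (-A) := by
  unfold so2 LieAlgebra.Orthogonal.so'
  rw [mem_skewAdjointMatricesLieSubalgebra, mem_skewAdjointMatricesSubmodule]
  rfl

theorem indefiniteDiagonal_eq (j : ℕ) :
    LieAlgebra.Orthogonal.indefiniteDiagonal (Fin 2) (Fin j) ℝ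
      = Matrix.fromBlocks 1 0 0 (-1) := by
  ext (a | a) (b | b) <;>
    simp [LieAlgebra.Orthogonal.indefiniteDiagonal, Matrix.diagonal_apply, Matrix.one_apply]
  split_ifs <;> simp

/-! ### Structure of `𝔰𝔬(2, j)` -/

/-- The maximal compact subalgebra `𝔨 = 𝔰𝔬(2) ⊕ 𝔰𝔬(j)` of `𝔰𝔬(2, j)`: the fixed points of the
Cartan involution `X ↦ -Xᵀ`. -/
def IsCompactPart {j : ℕ} (X : so2 j) : Prop :=
  (X : Matrix (Fin 2 ⊕ Fin j) (Fin 2 ⊕ Fin j) ℝ).transpose = -X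

/-- The generator `Z₀` of the factor `𝔰𝔬(2)` of `𝔨`; it is central in `𝔨`, and `ad Z₀` has
eigenvalues `± i` on the complexification of the complement `𝔭` of `𝔨`. -/
def Z0 (j : ℕ) : so2 j :=
  ⟨Matrix.fromBlocks !![0, -1; 1, 0] 0 0 0, by
    rw [mem_so2, indefiniteDiagonal_eq]
    simp only [Matrix.fromBlocks_transpose, Matrix.fromBlocks_neg, Matrix.fromBlocks_multiply]
    congr 1
    · ext a b; fin_cases a <;> fin_cases b <;> simp
    all_goals simp⟩

/-- The coordinate `a` of the `𝔰𝔬(2)`-component `a Z₀` of an element of `𝔨`. -/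
def so2Coord {j : ℕ} (X : so2 j) : ℝ :=
  (X : Matrix (Fin 2 ⊕ Fin j) (Fin 2 ⊕ Fin j) ℝ) (Sum.inl 1) (Sum.inl 0)

/-! ### Representations -/

/-- The complex subspace `W` is stable under the elements of `S`. -/
def IsStable {𝔤 M : Type*} [LieRing 𝔤] [LieAlgebra ℝ 𝔤] [AddCommGroup M] [Module ℂ M]
    (π : 𝔤 →ₗ⁅ℝ⁆ Module.End ℂ M) (S : Set 𝔤) (W : Submodule ℂ M) : Prop :=
  ∀ X ∈ S, ∀ w ∈ W, π X w ∈ W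

/-- An inner product (conjugate linear in the first variable) for which the Lie algebra acts by
skew-Hermitian operators. -/
def IsInvariantInner {𝔤 M : Type*} [LieRing 𝔤] [LieAlgebra ℝ 𝔤] [AddCommGroup M] [Module ℂ M]
    (π : 𝔤 →ₗ⁅ℝ⁆ Module.End ℂ M) (B : InnerProductSpace.Core ℂ M) : Prop :=
  ∀ (X : 𝔤) (u v : M), B.inner (π X u) v = -B.inner u (π X v)

/-- The space of vectors annihilated by `𝔭⁺`, the `(+i)`-eigenspace of `ad Z₀` in the
complexification of `𝔰𝔬(2, j)`. An element of the complexification is written as `X + i Y`;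
it lies in `𝔭⁺` iff `[Z₀, X] = -Y` and `[Z₀, Y] = X`. -/
def highestWeightSpace {j : ℕ} {M : Type*} [AddCommGroup M] [Module ℂ M]
    (π : so2 j →ₗ⁅ℝ⁆ Module.End ℂ M) : Submodule ℂ M where
  carrier := {v | ∀ X Y : so2 j, ⁅Z0 j, X⁆ = -Y → ⁅Z0 j, Y⁆ = X →
    π X v + Complex.I • π Y v = 0}
  add_mem' := by
    intro u v hu hv X Y h1 h2
    have e : π X (u + v) + Complex.I • π Y (u + v)
        = (π X u + Complex.I • π Y u) + (π X v + Complex.I • π Y v) := by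
      simp only [map_add, smul_add]; abel
    rw [e, hu X Y h1 h2, hv X Y h1 h2, add_zero]
  zero_mem' := by
    intro X Y _ _
    simp
  smul_mem' := by
    intro c v hv X Y h1 h2
    have e : π X (c • v) + Complex.I • π Y (c • v) = c • (π X v + Complex.I • π Y v) := by
      rw [map_smul, map_smul, smul_add, smul_comm Complex.I c]
    rw [e, hv X Y h1 h2, smul_zero]

/-- `π`, with the inner product `B`, is (the underlying `(𝔤, K̃)`-module of) the unitary highest
weight representation of `𝔤 = 𝔰𝔬(2, j)` of scalar type with parameter `lam`. -/
structure IsScalarHighestWeight (j : ℕ) (lam : ℝ) {M : Type*} [AddCommGroup M] [Module ℂ M]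
    (π : so2 j →ₗ⁅ℝ⁆ Module.End ℂ M) (B : InnerProductSpace.Core ℂ M) : Prop where
  /-- The module is irreducible. -/
  nontrivial : Nontrivial M
  irreducible : ∀ W : Submodule ℂ M, IsStable π Set.univ W → W = ⊥ ∨ W = ⊤
  /-- Every vector is `𝔨`-finite. -/
  locally_finite : ∀ v : M, ∃ W : Submodule ℂ M,
    v ∈ W ∧ FiniteDimensional ℂ W ∧ IsStable π {X | IsCompactPart X} W
  /-- The module is infinitesimally unitary. -/
  unitary : IsInvariantInner π B
  /-- Scalar type: the highest weight space is a line. -/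
  scalar : Module.finrank ℂ (highestWeightSpace π) = 1
  /-- On this line `Z₀` acts by `-i lam` and the factor `𝔰𝔬(j)` of `𝔨` acts trivially. -/
  weight : ∀ v ∈ highestWeightSpace π, ∀ X : so2 j, IsCompactPart X →
    π X v = (-(Complex.I * (lam : ℂ) * (so2Coord X : ℂ))) • v

/-- The external tensor product `σ ⊠ τ`, a representation of `𝔞 ⊕ 𝔟`. -/
def boxTensor {𝔞 𝔟 N H : Type*} [LieRing 𝔞] [LieAlgebra ℝ 𝔞] [LieRing 𝔟] [LieAlgebra ℝ 𝔟]
    [AddCommGroup N] [Module ℂ N] [AddCommGroup H] [Module ℂ H]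
    (σ : 𝔞 →ₗ⁅ℝ⁆ Module.End ℂ N) (τ : 𝔟 →ₗ⁅ℝ⁆ Module.End ℂ H) :
    𝔞 × 𝔟 →ₗ⁅ℝ⁆ Module.End ℂ (N ⊗[ℂ] H) where
  toFun Z := TensorProduct.map (σ Z.1) LinearMap.id + TensorProduct.map LinearMap.id (τ Z.2)
  map_add' Z Z' := by
    ext x y
    simp [TensorProduct.add_tmul, TensorProduct.tmul_add]
    abel
  map_smul' c Z := by
    ext x y
    have h1 : σ (c • Z.1) x = (c : ℂ) • σ Z.1 x := by rw [map_smul]; rfl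
    have h2 : τ (c • Z.2) y = (c : ℂ) • τ Z.2 y := by rw [map_smul]; rfl
    change σ (c • Z.1) x ⊗ₜ[ℂ] y + x ⊗ₜ[ℂ] τ (c • Z.2) y
      = (c : ℂ) • (σ Z.1 x ⊗ₜ[ℂ] y + x ⊗ₜ[ℂ] τ Z.2 y)
    rw [h1, h2, smul_add, TensorProduct.smul_tmul', TensorProduct.tmul_smul]
  map_lie' := by
    intro Z Z'
    ext x y
    simp [Ring.lie_def, TensorProduct.sub_tmul, TensorProduct.tmul_sub]
    abel

/-- The direct sum of representations. -/
def directSumRep {𝔤 : Type*} [LieRing 𝔤] [LieAlgebra ℝ 𝔤] {M : ℕ → Type*}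
    [∀ k, AddCommGroup (M k)] [∀ k, Module ℂ (M k)]
    (σ : ∀ k, 𝔤 →ₗ⁅ℝ⁆ Module.End ℂ (M k)) : 𝔤 →ₗ⁅ℝ⁆ Module.End ℂ (⨁ k, M k) where
  toFun X := DirectSum.lmap fun k => σ k X
  map_add' X Y := by
    ext k x : 2
    simp [DirectSum.lmap_lof]
  map_smul' c X := by
    ext k x : 2
    simp [DirectSum.lmap_lof]
  map_lie' := by
    intro X Y
    ext k x : 2
    simp [DirectSum.lmap_lof, Ring.lie_def]

/-! ### The subalgebra `𝔰𝔬(2, m) ⊕ 𝔰𝔬(l)` of `𝔰𝔬(2, m + l)` -/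

/-- The first `m` of the `m + l` negative coordinates go with the two positive ones. -/
def coordEquiv (m l : ℕ) : (Fin 2 ⊕ Fin m) ⊕ Fin l ≃ Fin 2 ⊕ Fin (m + l) :=
  (Equiv.sumAssoc (Fin 2) (Fin m) (Fin l)).trans (Equiv.sumCongr (Equiv.refl _) finSumFinEquiv)

/-- The block diagonal matrix with blocks `A`, `B`, in the coordinates `Fin 2 ⊕ Fin (m + l)`. -/
def blockMatrix (m l : ℕ) (A : Matrix (Fin 2 ⊕ Fin m) (Fin 2 ⊕ Fin m) ℝ)
    (B : Matrix (Fin l) (Fin l) ℝ) : Matrix (Fin 2 ⊕ Fin (m + l)) (Fin 2 ⊕ Fin (m + l)) ℝ :=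
  Matrix.reindex (coordEquiv m l) (coordEquiv m l) (Matrix.fromBlocks A 0 0 B)

theorem blockMatrix_lie (m l : ℕ) (A A' : Matrix (Fin 2 ⊕ Fin m) (Fin 2 ⊕ Fin m) ℝ)
    (B B' : Matrix (Fin l) (Fin l) ℝ) :
    blockMatrix m l ⁅A, A'⁆ ⁅B, B'⁆ = ⁅blockMatrix m l A B, blockMatrix m l A' B'⁆ := by
  have hmul : ∀ A A' B B', blockMatrix m l A B * blockMatrix m l A' B'
      = blockMatrix m l (A * A') (B * B') := by
    intro A A' B B'
    rw [blockMatrix, blockMatrix, blockMatrix, Matrix.reindex_apply, Matrix.reindex_apply,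
      Matrix.submatrix_mul_equiv, Matrix.fromBlocks_multiply]
    simp
  rw [Ring.lie_def, Ring.lie_def, Ring.lie_def, hmul, hmul]
  ext a b
  obtain ⟨a, rfl⟩ := (coordEquiv m l).surjective a
  obtain ⟨b, rfl⟩ := (coordEquiv m l).surjective b
  rcases a with a | a <;> rcases b with b | b <;> simp [blockMatrix]

theorem blockMatrix_add (m l : ℕ) (A A' : Matrix (Fin 2 ⊕ Fin m) (Fin 2 ⊕ Fin m) ℝ)
    (B B' : Matrix (Fin l) (Fin l) ℝ) :
    blockMatrix m l (A + A') (B + B') = blockMatrix m l A B + blockMatrix m l A' B' := by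
  ext a b
  obtain ⟨a, rfl⟩ := (coordEquiv m l).surjective a
  obtain ⟨b, rfl⟩ := (coordEquiv m l).surjective b
  rcases a with a | a <;> rcases b with b | b <;> simp [blockMatrix]

theorem blockMatrix_smul (m l : ℕ) (c : ℝ) (A : Matrix (Fin 2 ⊕ Fin m) (Fin 2 ⊕ Fin m) ℝ)
    (B : Matrix (Fin l) (Fin l) ℝ) :
    blockMatrix m l (c • A) (c • B) = c • blockMatrix m l A B := by
  ext a b
  obtain ⟨a, rfl⟩ := (coordEquiv m l).surjective a
  obtain ⟨b, rfl⟩ := (coordEquiv m l).surjective b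
  rcases a with a | a <;> rcases b with b | b <;> simp [blockMatrix]

/-- The inclusion `𝔰𝔬(2, m) ⊕ 𝔰𝔬(l) → 𝔰𝔬(2, m + l)` as block diagonal matrices. -/
def blockIncl (m l : ℕ) : so2 m × so l →ₗ⁅ℝ⁆ so2 (m + l) where
  toFun Z := ⟨blockMatrix m l Z.1 Z.2, by
    have hD : LieAlgebra.Orthogonal.indefiniteDiagonal (Fin 2) (Fin (m + l)) ℝ
        = Matrix.reindex (coordEquiv m l) (coordEquiv m l)
          (Matrix.fromBlocks (LieAlgebra.Orthogonal.indefiniteDiagonal (Fin 2) (Fin m) ℝ) 0 0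
            (-1)) := by
      ext a b
      obtain ⟨a, rfl⟩ := (coordEquiv m l).surjective a
      obtain ⟨b, rfl⟩ := (coordEquiv m l).surjective b
      rcases a with (a | a) | a <;> rcases b with (b | b) | b <;>
        simp [LieAlgebra.Orthogonal.indefiniteDiagonal, Matrix.diagonal_apply, Matrix.one_apply,
          coordEquiv]
      all_goals first
        | (split_ifs <;> simp_all)
        | (intro h; have := congrArg Fin.val h; simp at this; omega)
    have hneg : ∀ (A : Matrix ((Fin 2 ⊕ Fin m) ⊕ Fin l) ((Fin 2 ⊕ Fin m) ⊕ Fin l) ℝ)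
        (e : Fin 2 ⊕ Fin (m + l) → (Fin 2 ⊕ Fin m) ⊕ Fin l),
        -A.submatrix e e = (-A).submatrix e e := fun _ _ => rfl
    have h1 := (mem_so2 _).1 Z.1.2
    have h2 := (LieAlgebra.Orthogonal.mem_so _ _ _).1 Z.2.2
    rw [mem_so2, hD, blockMatrix, Matrix.reindex_apply, Matrix.reindex_apply, Matrix.transpose_submatrix,
      Matrix.submatrix_mul_equiv, hneg,
      Matrix.submatrix_mul_equiv, Matrix.fromBlocks_transpose, Matrix.fromBlocks_neg,
      Matrix.fromBlocks_multiply, Matrix.fromBlocks_multiply, h1, h2]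
    simp⟩
  map_add' Z Z' := Subtype.ext (blockMatrix_add m l _ _ _ _)
  map_smul' c Z := Subtype.ext (blockMatrix_smul m l c _ _)
  map_lie' := by
    intro Z Z'
    exact Subtype.ext (blockMatrix_lie m l _ _ _ _)

/-! ### Spherical harmonics -/

/-- The Laplacian on polynomials in `l` variables. -/
def laplacian (l : ℕ) : MvPolynomial (Fin l) ℂ →ₗ[ℂ] MvPolynomial (Fin l) ℂ :=
  ∑ i, ((MvPolynomial.pderiv i : Derivation ℂ _ (MvPolynomial (Fin l) ℂ)) :
      MvPolynomial (Fin l) ℂ →ₗ[ℂ] MvPolynomial (Fin l) ℂ) ∘ₗ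
    ((MvPolynomial.pderiv i : Derivation ℂ _ (MvPolynomial (Fin l) ℂ)) :
      MvPolynomial (Fin l) ℂ →ₗ[ℂ] MvPolynomial (Fin l) ℂ)

/-- The harmonic homogeneous polynomials of degree `k` on `ℝˡ`, with complex coefficients. -/
def harmonicSubmodule (l k : ℕ) : Submodule ℂ (MvPolynomial (Fin l) ℂ) :=
  MvPolynomial.homogeneousSubmodule (Fin l) ℂ k ⊓ LinearMap.ker (laplacian l)

/-- The space `ℋᵏ(ℝˡ)` of spherical harmonics of degree `k` on `ℝˡ`. -/
def SphHarm (l k : ℕ) : Type := harmonicSubmodule l k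

instance (l k : ℕ) : AddCommGroup (SphHarm l k) :=
  inferInstanceAs (AddCommGroup (harmonicSubmodule l k))

instance (l k : ℕ) : Module ℂ (SphHarm l k) :=
  inferInstanceAs (Module ℂ (harmonicSubmodule l k))

/-- The differential of the action `(g p)(x) = p(g⁻¹ x)` on polynomials: the derivation
`p ↦ -∂_{Y x} p = -∑ i j, Y i j * x j * ∂ᵢ p`. -/
def rotation {l : ℕ} (Y : Matrix (Fin l) (Fin l) ℝ) :
    Derivation ℂ (MvPolynomial (Fin l) ℂ) (MvPolynomial (Fin l) ℂ) :=
  -∑ i, (∑ j, MvPolynomial.C ((Y i j : ℝ) : ℂ) * MvPolynomial.X j) • MvPolynomial.pderiv i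

theorem pderiv_comm {l : ℕ} (i j : Fin l) (p : MvPolynomial (Fin l) ℂ) :
    MvPolynomial.pderiv i (MvPolynomial.pderiv j p) =
      MvPolynomial.pderiv j (MvPolynomial.pderiv i p) := by
  have h : ⁅(MvPolynomial.pderiv i : Derivation ℂ (MvPolynomial (Fin l) ℂ) _),
      (MvPolynomial.pderiv j : Derivation ℂ (MvPolynomial (Fin l) ℂ) _)⁆ = 0 := by
    apply MvPolynomial.derivation_ext
    intro k
    rw [Derivation.commutator_apply, MvPolynomial.pderiv_X, MvPolynomial.pderiv_X]
    simp only [Pi.single_apply]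
    split_ifs <;> simp
  rw [← sub_eq_zero, ← Derivation.commutator_apply, h, Derivation.zero_apply]

theorem rotation_apply {l : ℕ} (Y : Matrix (Fin l) (Fin l) ℝ) (p : MvPolynomial (Fin l) ℂ) :
    rotation Y p = -∑ i, (∑ j, MvPolynomial.C ((Y i j : ℝ) : ℂ) * MvPolynomial.X j) *
      MvPolynomial.pderiv i p := by
  rw [rotation, Derivation.neg_apply, ← Derivation.coeFnAddMonoidHom_apply, map_sum]
  simp

theorem rotation_X {l : ℕ} (Y : Matrix (Fin l) (Fin l) ℝ) (i : Fin l) :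
    rotation Y (MvPolynomial.X i) =
      -∑ j, MvPolynomial.C ((Y i j : ℝ) : ℂ) * MvPolynomial.X j := by
  rw [rotation_apply]
  simp [MvPolynomial.pderiv_X, Pi.single_apply]

theorem pderiv_rotation {l : ℕ} (Y : Matrix (Fin l) (Fin l) ℝ) (k : Fin l)
    (p : MvPolynomial (Fin l) ℂ) :
    MvPolynomial.pderiv k (rotation Y p) = rotation Y (MvPolynomial.pderiv k p) -
      ∑ i, MvPolynomial.C ((Y i k : ℝ) : ℂ) * MvPolynomial.pderiv i p := by
  rw [rotation_apply, rotation_apply, map_neg, map_sum, ← sub_eq_zero]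
  have h : ∀ i, MvPolynomial.pderiv k
      ((∑ j, MvPolynomial.C ((Y i j : ℝ) : ℂ) * MvPolynomial.X j) * MvPolynomial.pderiv i p) =
      (∑ j, MvPolynomial.C ((Y i j : ℝ) : ℂ) * MvPolynomial.X j) *
        MvPolynomial.pderiv i (MvPolynomial.pderiv k p) +
      MvPolynomial.C ((Y i k : ℝ) : ℂ) * MvPolynomial.pderiv i p := by
    intro i
    rw [MvPolynomial.pderiv_mul, map_sum, pderiv_comm k i, add_comm]
    congr 2
    simp [MvPolynomial.pderiv_X, Pi.single_apply]
  rw [Finset.sum_congr rfl fun i _ => h i, Finset.sum_add_distrib]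
  ring

theorem laplacian_apply {l : ℕ} (p : MvPolynomial (Fin l) ℂ) :
    laplacian l p = ∑ i, MvPolynomial.pderiv i (MvPolynomial.pderiv i p) := by
  simp [laplacian]

theorem laplacian_rotation {l : ℕ} (Y : so l) (p : MvPolynomial (Fin l) ℂ) :
    laplacian l (rotation (Y : Matrix (Fin l) (Fin l) ℝ) p) =
      rotation (Y : Matrix (Fin l) (Fin l) ℝ) (laplacian l p) := by
  have hY : ∀ i j, (Y : Matrix (Fin l) (Fin l) ℝ) j i = -(Y : Matrix (Fin l) (Fin l) ℝ) i j := by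
    intro i j
    have h := (LieAlgebra.Orthogonal.mem_so _ _ _).1 Y.2
    exact congrFun (congrFun h i) j
  have h0 : ∑ k, ∑ i, MvPolynomial.C (((Y : Matrix (Fin l) (Fin l) ℝ) i k : ℝ) : ℂ) *
      MvPolynomial.pderiv i (MvPolynomial.pderiv k p) = 0 := by
    have h1 : ∑ k, ∑ i, MvPolynomial.C (((Y : Matrix (Fin l) (Fin l) ℝ) i k : ℝ) : ℂ) *
        MvPolynomial.pderiv i (MvPolynomial.pderiv k p) =
        -∑ k, ∑ i, MvPolynomial.C (((Y : Matrix (Fin l) (Fin l) ℝ) i k : ℝ) : ℂ) *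
        MvPolynomial.pderiv i (MvPolynomial.pderiv k p) := by
      conv_lhs => rw [Finset.sum_comm]
      rw [← Finset.sum_neg_distrib]
      refine Finset.sum_congr rfl fun i _ => ?_
      rw [← Finset.sum_neg_distrib]
      refine Finset.sum_congr rfl fun j _ => ?_
      rw [hY, Complex.ofReal_neg, map_neg, neg_mul, pderiv_comm]
    exact self_eq_neg.1 h1
  rw [laplacian_apply, laplacian_apply, map_sum]
  have : ∀ k, MvPolynomial.pderiv k (MvPolynomial.pderiv k
      (rotation (Y : Matrix (Fin l) (Fin l) ℝ) p)) =
      rotation (Y : Matrix (Fin l) (Fin l) ℝ) (MvPolynomial.pderiv k (MvPolynomial.pderiv k p)) -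
      ∑ i, MvPolynomial.C (((Y : Matrix (Fin l) (Fin l) ℝ) i k : ℝ) : ℂ) *
        MvPolynomial.pderiv i (MvPolynomial.pderiv k p) -
      ∑ i, MvPolynomial.C (((Y : Matrix (Fin l) (Fin l) ℝ) i k : ℝ) : ℂ) *
        MvPolynomial.pderiv i (MvPolynomial.pderiv k p) := by
    intro k
    rw [pderiv_rotation, map_sub, pderiv_rotation, map_sum]
    congr 1
    refine Finset.sum_congr rfl fun i _ => ?_
    rw [MvPolynomial.pderiv_C_mul, pderiv_comm]
  rw [Finset.sum_congr rfl fun k _ => this k, Finset.sum_sub_distrib, Finset.sum_sub_distrib, h0]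
  simp

theorem rotation_mem {l k : ℕ} (Y : so l) {p : MvPolynomial (Fin l) ℂ}
    (hp : p ∈ harmonicSubmodule l k) :
    rotation (Y : Matrix (Fin l) (Fin l) ℝ) p ∈ harmonicSubmodule l k := by
  obtain ⟨h1, h2⟩ := hp
  refine ⟨?_, ?_⟩
  · have h1' : p.IsHomogeneous k := h1
    change (rotation (Y : Matrix (Fin l) (Fin l) ℝ) p).IsHomogeneous k
    rw [rotation_apply]
    refine (MvPolynomial.IsHomogeneous.sum _ _ _ fun i _ => ?_).neg
    rcases Nat.eq_zero_or_pos k with rfl | hk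
    · obtain ⟨c, rfl⟩ : ∃ c, p = MvPolynomial.C c :=
        ⟨_, MvPolynomial.totalDegree_eq_zero_iff_eq_C.1
          ((MvPolynomial.totalDegree_zero_iff_isHomogeneous _).2 h1')⟩
      simpa using MvPolynomial.isHomogeneous_zero _ _ _
    · have e : k = 1 + (k - 1) := by omega
      rw [e]
      refine MvPolynomial.IsHomogeneous.mul
        (MvPolynomial.IsHomogeneous.sum _ _ _ fun j _ => ?_) ?_
      · exact (MvPolynomial.isHomogeneous_X ℂ j).C_mul _
      · have := h1'.pderiv (i := i)
        simpa using this
  · have h2' : laplacian l p = 0 := h2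
    change laplacian l _ = 0
    rw [laplacian_rotation, h2', map_zero]

theorem rotation_lie {l : ℕ} (Y Y' : Matrix (Fin l) (Fin l) ℝ) :
    rotation ⁅Y, Y'⁆ = ⁅rotation Y, rotation Y'⁆ := by
  apply MvPolynomial.derivation_ext
  intro i
  have h : ∀ A B : Matrix (Fin l) (Fin l) ℝ, rotation A (rotation B (MvPolynomial.X i)) =
      ∑ k, MvPolynomial.C (((B * A) i k : ℝ) : ℂ) * MvPolynomial.X k := by
    intro A B
    rw [rotation_X, map_neg, map_sum]
    have h1 : ∀ j, rotation A (MvPolynomial.C ((B i j : ℝ) : ℂ) * MvPolynomial.X j) =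
        -∑ k, MvPolynomial.C ((B i j : ℝ) : ℂ) * (MvPolynomial.C ((A j k : ℝ) : ℂ) *
          MvPolynomial.X k) := by
      intro j
      rw [← MvPolynomial.smul_eq_C_mul, Derivation.map_smul, rotation_X, smul_neg,
        MvPolynomial.smul_eq_C_mul, Finset.mul_sum]
    rw [Finset.sum_congr rfl fun j _ => h1 j, Finset.sum_neg_distrib, neg_neg, Finset.sum_comm]
    refine Finset.sum_congr rfl fun k _ => ?_
    rw [Matrix.mul_apply, Complex.ofReal_sum, map_sum, Finset.sum_mul]
    refine Finset.sum_congr rfl fun j _ => ?_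
    rw [Complex.ofReal_mul, map_mul, mul_assoc]
  rw [Derivation.commutator_apply, h, h, rotation_X, ← Finset.sum_sub_distrib,
    ← Finset.sum_neg_distrib]
  refine Finset.sum_congr rfl fun k _ => ?_
  rw [Ring.lie_def, Matrix.sub_apply, Complex.ofReal_sub, map_sub]
  ring

/-- The natural representation of `𝔰𝔬(l)` on the spherical harmonics of degree `k`. -/
def sphHarmRep (l k : ℕ) : so l →ₗ⁅ℝ⁆ Module.End ℂ (SphHarm l k) where
  toFun Y := ((rotation (Y : Matrix (Fin l) (Fin l) ℝ) :
      Derivation ℂ (MvPolynomial (Fin l) ℂ) (MvPolynomial (Fin l) ℂ)) :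
      MvPolynomial (Fin l) ℂ →ₗ[ℂ] MvPolynomial (Fin l) ℂ).restrict
      (p := harmonicSubmodule l k) (q := harmonicSubmodule l k) fun _ hp => rotation_mem Y hp
  map_add' Y Y' := by
    refine LinearMap.ext fun p => Subtype.ext ?_
    change rotation _ p.1 = rotation _ p.1 + rotation _ p.1
    rw [rotation_apply, rotation_apply, rotation_apply, ← neg_add, ← Finset.sum_add_distrib]
    congr 1
    refine Finset.sum_congr rfl fun i _ => ?_
    rw [← add_mul, ← Finset.sum_add_distrib]
    congr 1
    refine Finset.sum_congr rfl fun j _ => ?_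
    rw [← add_mul, ← map_add]
    simp
  map_smul' c Y := by
    refine LinearMap.ext fun p => Subtype.ext ?_
    change rotation _ p.1 = (c : ℂ) • rotation _ p.1
    rw [rotation_apply, rotation_apply, smul_neg, Finset.smul_sum]
    congr 1
    refine Finset.sum_congr rfl fun i _ => ?_
    rw [← smul_mul_assoc, Finset.smul_sum]
    congr 1
    refine Finset.sum_congr rfl fun j _ => ?_
    simp [MvPolynomial.smul_eq_C_mul, mul_assoc]
  map_lie' := by
    intro Y Y'
    refine LinearMap.ext fun p => Subtype.ext ?_
    change rotation ⁅(Y : Matrix (Fin l) (Fin l) ℝ), (Y' : Matrix (Fin l) (Fin l) ℝ)⁆ p.1 = _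
    rw [rotation_lie, Derivation.commutator_apply]
    rfl

end Branching

end

/-! The minimal representation has a polynomial model in which the branching law can be read off.
Put n = m + l and λ = (n-2)/2. The algebra 𝔰𝔬(2,n) acts on polynomials in n variables by conformal
vector fields on densities of weight λ: 𝔭⁺ acts by the ∂ᵢ, 𝔭⁻ by Kᵢ = |x|²∂ᵢ - 2xᵢ(E + λ) with E the
Euler operator, Z₀ by -i(E + λ), and 𝔰𝔬(n) by rotations. At this value of λ the Kᵢ preserve harmonic
polynomials (`laplacian_inversionOp`), and a degreewise rescaling of the Fischer form makes the
action on harmonic polynomials unitary (`harmRep_invariant`).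

The highest weight vectors for 𝔰𝔬(2,m) are the harmonic polynomials killed by ∂₁, …, ∂ₘ, that is,
the harmonic polynomials in the last l variables. Those of degree k form ℋᵏ(ℝˡ), and E + λ acts on
them by λ + k (`sphIncl_isHighestWeightVector`). They generate everything: if a harmonic p is
orthogonal to the generated submodule up to its degree, then ‖∂ᵢp‖² = -⟨p, Kᵢ∂ᵢp⟩ = 0 for i ≤ m by
induction on the degree, so p is itself a highest weight vector (`harmonic_completeness`).

Arbitrary realizations are handled by general facts on highest weight vectors. An invariant pairing
of two modules generated by such vectors vanishes as soon as it vanishes on the generators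
(`invariantForm_eq_zero`), which gives isometry up to scale and orthogonality of summands.
Intertwiners out of an irreducible unitary module come from a graph argument (`exists_intertwiner`).
Since ℋᵏ(ℝˡ) may be reducible (l = 2), its invariant inner product is not unique up to scale; two of
them are matched by an equivariant positive square root (`exists_equivariant_isometry`).

For existence, the constants in the minimal representation of 𝔰𝔬(2, m + l + 2k) generate an
𝔰𝔬(2,m)-module with parameter (m + l + 2k - 2)/2 = λ + k (`exists_isScalarHighestWeight`). -/

noncomputable section

namespace Branching

/-! ### Inner products as sesquilinear forms -/

section Form

variable {M : Type*} [AddCommGroup M] [Module ℂ M]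

/-- The sesquilinear form underlying an inner product. -/
def coreForm (B : InnerProductSpace.Core ℂ M) : M →ₗ⋆[ℂ] M →ₗ[ℂ] ℂ :=
  LinearMap.mk₂'ₛₗ (starRingEnd ℂ) (RingHom.id ℂ) B.inner
    B.add_left (fun c x y => B.smul_left x y c)
    (fun x y z => by
      rw [← B.conj_inner_symm, B.add_left, map_add, B.conj_inner_symm, B.conj_inner_symm])
    (fun c x y => by
      rw [← B.conj_inner_symm, B.smul_left, map_mul, Complex.conj_conj, B.conj_inner_symm]; rfl)

theorem coreForm_apply (B : InnerProductSpace.Core ℂ M) (x y : M) :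
    coreForm B x y = B.inner x y := rfl

theorem coreForm_conj (B : InnerProductSpace.Core ℂ M) (x y : M) :
    starRingEnd ℂ (coreForm B y x) = coreForm B x y := B.conj_inner_symm x y

theorem coreForm_definite (B : InnerProductSpace.Core ℂ M) {x : M} (h : coreForm B x x = 0) :
    x = 0 := B.definite x h

theorem coreForm_self_re (B : InnerProductSpace.Core ℂ M) (x : M) :
    (((coreForm B x x).re : ℝ) : ℂ) = coreForm B x x :=
  Complex.conj_eq_iff_re.1 (coreForm_conj B x x)

theorem coreForm_self_pos (B : InnerProductSpace.Core ℂ M) {x : M} (h : x ≠ 0) :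
    0 < (coreForm B x x).re := by
  refine lt_of_le_of_ne (B.re_inner_nonneg x) fun h0 => h (coreForm_definite B ?_)
  rw [← coreForm_self_re, ← h0, Complex.ofReal_zero]

end Form

/-! ### Highest weight vectors -/

section Abstract

variable {𝔤 : Type*} [LieRing 𝔤] [LieAlgebra ℝ 𝔤]
variable {M : Type*} [AddCommGroup M] [Module ℂ M]
variable {N : Type*} [AddCommGroup N] [Module ℂ N]

/-- The operator `π(X) - i π([Z, X])`; for `X` in the `(-1)`-eigenspace of `(ad Z)²` it comes from
the `(+i)`-eigenspace of `ad Z`. -/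
def raise (Z : 𝔤) (π : 𝔤 →ₗ⁅ℝ⁆ Module.End ℂ M) (X : 𝔤) : Module.End ℂ M :=
  π X - Complex.I • π ⁅Z, X⁆

/-- The operator `π(X) + i π([Z, X])`; for `X` in the `(-1)`-eigenspace of `(ad Z)²` it comes from
the `(-i)`-eigenspace of `ad Z`. -/
def lower (Z : 𝔤) (π : 𝔤 →ₗ⁅ℝ⁆ Module.End ℂ M) (X : 𝔤) : Module.End ℂ M :=
  π X + Complex.I • π ⁅Z, X⁆

/-- `v` is a highest weight vector on which the centralizer of `Z` acts through `χ`. -/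
structure IsHighestWeightVector (Z : 𝔤) (χ : 𝔤 → ℂ) (π : 𝔤 →ₗ⁅ℝ⁆ Module.End ℂ M) (v : M) :
    Prop where
  raise_eq : ∀ X, ⁅Z, ⁅Z, X⁆⁆ = -X → raise Z π X v = 0
  weight_eq : ∀ X, ⁅Z, X⁆ = 0 → π X v = χ X • v

/-- The span of the images of the lowering operators. -/
def lowerRange (Z : 𝔤) (π : 𝔤 →ₗ⁅ℝ⁆ Module.End ℂ M) : Submodule ℂ M :=
  Submodule.span ℂ {w | ∃ X u, ⁅Z, ⁅Z, X⁆⁆ = -X ∧ lower Z π X u = w}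

/-- The submodule generated by a vector. -/
def cyclic (π : 𝔤 →ₗ⁅ℝ⁆ Module.End ℂ M) (v : M) : Submodule ℂ M :=
  sInf {W | v ∈ W ∧ IsStable π Set.univ W}

theorem mem_cyclic_self (π : 𝔤 →ₗ⁅ℝ⁆ Module.End ℂ M) (v : M) : v ∈ cyclic π v :=
  Submodule.mem_sInf.2 fun _ hW => hW.1

theorem cyclic_stable (π : 𝔤 →ₗ⁅ℝ⁆ Module.End ℂ M) (v : M) :
    IsStable π Set.univ (cyclic π v) := fun X _ w hw =>
  Submodule.mem_sInf.2 fun W hW => hW.2 X trivial w (Submodule.mem_sInf.1 hw W hW)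

theorem cyclic_le {π : 𝔤 →ₗ⁅ℝ⁆ Module.End ℂ M} {v : M} {W : Submodule ℂ M} (hv : v ∈ W)
    (hW : IsStable π Set.univ W) : cyclic π v ≤ W := sInf_le ⟨hv, hW⟩

theorem map_lie_apply (π : 𝔤 →ₗ⁅ℝ⁆ Module.End ℂ M) (X Y : 𝔤) (v : M) :
    π ⁅X, Y⁆ v = π X (π Y v) - π Y (π X v) := by
  rw [LieHom.map_lie, Ring.lie_def]; rfl

theorem lower_mem {Z : 𝔤} {π : 𝔤 →ₗ⁅ℝ⁆ Module.End ℂ M} {W : Submodule ℂ M}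
    (hW : IsStable π Set.univ W) (X : 𝔤) {w : M} (hw : w ∈ W) : lower Z π X w ∈ W :=
  W.add_mem (hW _ trivial _ hw) (W.smul_mem _ (hW _ trivial _ hw))

theorem raise_mem {Z : 𝔤} {π : 𝔤 →ₗ⁅ℝ⁆ Module.End ℂ M} {W : Submodule ℂ M}
    (hW : IsStable π Set.univ W) (X : 𝔤) {w : M} (hw : w ∈ W) : raise Z π X w ∈ W :=
  W.sub_mem (hW _ trivial _ hw) (W.smul_mem _ (hW _ trivial _ hw))

/-- This is [𝔭⁺, 𝔭⁻] ⊆ 𝔨_ℂ, with the commutator split into real and imaginary parts. Both parts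
centralize Z once X and Y lie in the (-1)-eigenspace of (ad Z)²; the identity itself needs no such
assumption. -/
theorem raise_lower_apply (Z : 𝔤) (π : 𝔤 →ₗ⁅ℝ⁆ Module.End ℂ M) (X Y : 𝔤) (v : M) :
    raise Z π X (lower Z π Y v) = lower Z π Y (raise Z π X v) +
      (π (⁅X, Y⁆ + ⁅⁅Z, X⁆, ⁅Z, Y⁆⁆) v +
        Complex.I • π (⁅X, ⁅Z, Y⁆⁆ - ⁅⁅Z, X⁆, Y⁆) v) := by
  simp only [raise, lower, map_add, map_sub, LinearMap.add_apply, LinearMap.sub_apply,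
    LinearMap.smul_apply, map_smul, map_lie_apply π X, map_lie_apply π ⁅Z, X⁆, smul_add, smul_sub,
    smul_smul, Complex.I_mul_I]
  module

theorem lower_commute_apply {Z : 𝔤} (π : 𝔤 →ₗ⁅ℝ⁆ Module.End ℂ M) {K : 𝔤} (hK : ⁅Z, K⁆ = 0)
    (Y : 𝔤) (v : M) :
    π K (lower Z π Y v) = lower Z π Y (π K v) + lower Z π ⁅K, Y⁆ v := by
  have h : ⁅Z, ⁅K, Y⁆⁆ = ⁅K, ⁅Z, Y⁆⁆ := by rw [leibniz_lie, hK, zero_lie, zero_add]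
  simp only [lower, map_add, LinearMap.add_apply, LinearMap.smul_apply, map_smul, h,
    map_lie_apply π K]
  module

/-- The submodule generated by a highest weight vector `v` is spanned by `v` and images of lowering
operators. -/
theorem cyclic_le_sup {Z : 𝔤} (hZ : ∀ X : 𝔤, ⁅Z, ⁅Z, ⁅Z, X⁆⁆⁆ = -⁅Z, X⁆) {χ : 𝔤 → ℂ}
    {π : 𝔤 →ₗ⁅ℝ⁆ Module.End ℂ M} {v : M} (hv : IsHighestWeightVector Z χ π v) :
    cyclic π v ≤ Submodule.span ℂ {v} ⊔ lowerRange Z π := by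
  let V : Submodule ℂ M := sInf {W | v ∈ W ∧ ∀ X, ⁅Z, ⁅Z, X⁆⁆ = -X → ∀ w ∈ W, lower Z π X w ∈ W}
  have hvV : v ∈ V := Submodule.mem_sInf.2 fun _ hW => hW.1
  have hlow : ∀ X, ⁅Z, ⁅Z, X⁆⁆ = -X → ∀ w ∈ V, lower Z π X w ∈ V := fun X hX w hw =>
    Submodule.mem_sInf.2 fun W hW => hW.2 X hX w (Submodule.mem_sInf.1 hw W hW)
  have hle : ∀ W : Submodule ℂ M, v ∈ W →
      (∀ X, ⁅Z, ⁅Z, X⁆⁆ = -X → ∀ w ∈ W, lower Z π X w ∈ W) → V ≤ W :=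
    fun W h1 h2 => sInf_le ⟨h1, h2⟩
  -- Instead of a Poincaré–Birkhoff–Witt argument: `V` is the least subspace containing v and closed
  -- under lowering, and `U` collects the vectors of `V` that the centralizer of Z and the raising
  -- operators send into `V`. The commutation relations make `U` closed under lowering, so `U` is
  -- all of `V`.
  let U : Submodule ℂ M :=
    { carrier := {w | w ∈ V ∧ (∀ K, ⁅Z, K⁆ = 0 → π K w ∈ V) ∧
        ∀ X, ⁅Z, ⁅Z, X⁆⁆ = -X → raise Z π X w ∈ V}
      zero_mem' := by simp
      add_mem' := fun ha hb => ⟨V.add_mem ha.1 hb.1,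
        fun K hK => by rw [map_add]; exact V.add_mem (ha.2.1 K hK) (hb.2.1 K hK),
        fun K hK => by rw [map_add]; exact V.add_mem (ha.2.2 K hK) (hb.2.2 K hK)⟩
      smul_mem' := fun c a ha => ⟨V.smul_mem c ha.1,
        fun K hK => by rw [map_smul]; exact V.smul_mem c (ha.2.1 K hK),
        fun K hK => by rw [map_smul]; exact V.smul_mem c (ha.2.2 K hK)⟩ }
  have hVU : V ≤ U := by
    refine hle U ⟨hvV, fun K hK => ?_, fun X hX => ?_⟩ fun Y hY w hw => ⟨hlow Y hY w hw.1,
      fun K hK => ?_, fun X hX => ?_⟩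
    · rw [hv.weight_eq K hK]; exact V.smul_mem _ hvV
    · rw [hv.raise_eq X hX]; exact V.zero_mem
    · rw [lower_commute_apply π hK]
      refine V.add_mem (hlow Y hY _ (hw.2.1 K hK)) (hlow _ ?_ _ hw.1)
      rw [leibniz_lie Z K, hK, zero_lie, zero_add, leibniz_lie Z K, hK, zero_lie, zero_add, hY,
        lie_neg]
    · rw [raise_lower_apply]
      refine V.add_mem (hlow Y hY _ (hw.2.2 X hX)) (V.add_mem (hw.2.1 _ ?_)
        (V.smul_mem _ (hw.2.1 _ ?_)))
      · rw [lie_add, leibniz_lie Z X, leibniz_lie Z ⁅Z, X⁆, hX, hY, neg_lie, lie_neg]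
        abel
      · rw [lie_sub, leibniz_lie Z X, leibniz_lie Z ⁅Z, X⁆, hX, hY, neg_lie, lie_neg]
        abel
  -- As (ad Z)³ = -ad Z, every X is the sum of X + (ad Z)²X, which centralizes Z, and -(ad Z)²X,
  -- which lies in the (-1)-eigenspace of (ad Z)² and acts as half the sum of a raising and a
  -- lowering operator.
  have hstable : IsStable π Set.univ V := by
    intro X _ w hw
    have hP : ⁅Z, ⁅Z, -⁅Z, ⁅Z, X⁆⁆⁆⁆ = - -⁅Z, ⁅Z, X⁆⁆ := by
      rw [lie_neg, lie_neg, hZ]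
    have hK : ⁅Z, X + ⁅Z, ⁅Z, X⁆⁆⁆ = 0 := by rw [lie_add, hZ, add_neg_cancel]
    have hX : X = (X + ⁅Z, ⁅Z, X⁆⁆) + -⁅Z, ⁅Z, X⁆⁆ := by abel
    have h2 : π (-⁅Z, ⁅Z, X⁆⁆) w = (2⁻¹ : ℂ) • (raise Z π (-⁅Z, ⁅Z, X⁆⁆) w +
        lower Z π (-⁅Z, ⁅Z, X⁆⁆) w) := by
      simp only [raise, lower, LinearMap.add_apply, LinearMap.sub_apply]
      module
    rw [hX, map_add, LinearMap.add_apply, h2]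
    exact V.add_mem ((hVU hw).2.1 _ hK)
      (V.smul_mem _ (V.add_mem ((hVU hw).2.2 _ hP) (hlow _ hP w hw)))
  refine (cyclic_le hvV hstable).trans (hle _ ?_ fun X hX w _ => ?_)
  · exact Submodule.mem_sup_left (Submodule.mem_span_singleton_self v)
  · exact Submodule.mem_sup_right (Submodule.subset_span ⟨X, w, hX, rfl⟩)

/-- An invariant sesquilinear pairing between modules generated by highest weight vectors is
determined by its value on these vectors. -/
theorem invariantForm_eq_zero {Z : 𝔤} (hZ : ∀ X : 𝔤, ⁅Z, ⁅Z, ⁅Z, X⁆⁆⁆ = -⁅Z, X⁆) {χ χ' : 𝔤 → ℂ}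
    {π : 𝔤 →ₗ⁅ℝ⁆ Module.End ℂ M} {σ : 𝔤 →ₗ⁅ℝ⁆ Module.End ℂ N}
    {v : M} {v' : N} (hv : IsHighestWeightVector Z χ π v) (hv' : IsHighestWeightVector Z χ' σ v')
    (D : M →ₗ⋆[ℂ] N →ₗ[ℂ] ℂ) (hD : ∀ X x y, D (π X x) y = -D x (σ X y)) (h0 : D v v' = 0)
    {x : M} (hx : x ∈ cyclic π v) {y : N} (hy : y ∈ cyclic σ v') : D x y = 0 := by
  let R : Submodule ℂ M :=
    { carrier := {x | ∀ y ∈ cyclic σ v', D x y = 0}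
      zero_mem' := by simp
      add_mem' := fun ha hb y hy => by
        rw [map_add, LinearMap.add_apply, ha y hy, hb y hy, add_zero]
      smul_mem' := fun c a ha y hy => by
        rw [LinearMap.map_smulₛₗ, LinearMap.smul_apply, ha y hy, smul_zero] }
  -- The left radical `R` is a submodule by invariance, so only v has to be tested, and by
  -- `cyclic_le_sup` only against v' and the images of lowering operators.
  refine cyclic_le (W := R) (fun y hy => ?_) (fun X _ w hw y hy => ?_) hx y hy
  · have hle : cyclic σ v' ≤ LinearMap.ker (D v) := by
      refine (cyclic_le_sup hZ hv').trans (sup_le ?_ (Submodule.span_le.2 ?_))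
      · rw [Submodule.span_singleton_le_iff_mem]; exact h0
      · rintro _ ⟨X, u, hX, rfl⟩
        -- Conjugate linearity in the first variable turns i into -i, so minus the raising operator
        -- is adjoint to the lowering operator.
        have h1 : D v (lower Z σ X u) = -D (raise Z π X v) u := by
          simp only [raise, lower, map_add, map_sub, LinearMap.add_apply, LinearMap.sub_apply,
            LinearMap.smul_apply, hD, map_smul, LinearMap.map_smulₛₗ, Complex.conj_I, smul_eq_mul]
          ring
        rw [SetLike.mem_coe, LinearMap.mem_ker, h1, hv.raise_eq X hX, map_zero,
          LinearMap.zero_apply, neg_zero]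
    exact hle hy
  · rw [hD, hw _ (cyclic_stable σ v' X trivial y hy), neg_zero]

/-- Moving a lowering operator across the inner product gives minus a raising operator, which kills
v. -/
theorem inner_lowerRange {Z : 𝔤} {π : 𝔤 →ₗ⁅ℝ⁆ Module.End ℂ M}
    {B : InnerProductSpace.Core ℂ M} (hB : IsInvariantInner π B) {v : M}
    (hv : ∀ X, ⁅Z, ⁅Z, X⁆⁆ = -X → raise Z π X v = 0) {w : M} (hw : w ∈ lowerRange Z π) :
    coreForm B v w = 0 := by
  have hle : lowerRange Z π ≤ LinearMap.ker (coreForm B v) := by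
    refine Submodule.span_le.2 ?_
    rintro _ ⟨X, u, hX, rfl⟩
    have hD : ∀ X x y, coreForm B (π X x) y = -coreForm B x (π X y) := hB
    have h1 : coreForm B v (lower Z π X u) = -coreForm B (raise Z π X v) u := by
      simp only [raise, lower, map_add, map_sub, LinearMap.add_apply, LinearMap.sub_apply,
        LinearMap.smul_apply, hD, map_smul, LinearMap.map_smulₛₗ, Complex.conj_I, smul_eq_mul]
      ring
    rw [SetLike.mem_coe, LinearMap.mem_ker, h1, hv X hX, map_zero,
      LinearMap.zero_apply, neg_zero]
  exact hle hw

/-- In a unitary module, the highest weight vectors of the submodule generated by a highest weight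
vector `v` are the multiples of `v`. -/
theorem mem_span_of_raise_eq_zero {Z : 𝔤} (hZ : ∀ X : 𝔤, ⁅Z, ⁅Z, ⁅Z, X⁆⁆⁆ = -⁅Z, X⁆) {χ : 𝔤 → ℂ}
    {π : 𝔤 →ₗ⁅ℝ⁆ Module.End ℂ M} {B : InnerProductSpace.Core ℂ M} (hB : IsInvariantInner π B)
    {v : M} (hv : IsHighestWeightVector Z χ π v) {u : M} (hu : u ∈ cyclic π v)
    (hu0 : ∀ X, ⁅Z, ⁅Z, X⁆⁆ = -X → raise Z π X u = 0) : u ∈ Submodule.span ℂ {v} := by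
  -- Write u = cv + r with r in the range of the lowering operators. Then r is also killed by
  -- raising, hence orthogonal to that range, in particular to itself.
  obtain ⟨y, hy, r, hr, rfl⟩ := Submodule.mem_sup.1 (cyclic_le_sup hZ hv hu)
  obtain ⟨c, rfl⟩ := Submodule.mem_span_singleton.1 hy
  have hr0 : ∀ X, ⁅Z, ⁅Z, X⁆⁆ = -X → raise Z π X r = 0 := by
    intro X hX
    have := hu0 X hX
    rwa [map_add, map_smul, hv.raise_eq X hX, smul_zero, zero_add] at this
  rw [coreForm_definite B (inner_lowerRange hB hr0 hr), add_zero]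
  exact hy

/-! ### Intertwiners between highest weight modules -/

/-- The diagonal action on a product. -/
def prodRep (σ : 𝔤 →ₗ⁅ℝ⁆ Module.End ℂ N) (π : 𝔤 →ₗ⁅ℝ⁆ Module.End ℂ M) :
    𝔤 →ₗ⁅ℝ⁆ Module.End ℂ (N × M) where
  toFun X := (σ X).prodMap (π X)
  map_add' X Y := by ext <;> simp
  map_smul' c X := by ext <;> simp
  map_lie' {X Y} := by ext <;> simp [Ring.lie_def]

theorem prodRep_apply (σ : 𝔤 →ₗ⁅ℝ⁆ Module.End ℂ N) (π : 𝔤 →ₗ⁅ℝ⁆ Module.End ℂ M) (X : 𝔤)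
    (w : N × M) : prodRep σ π X w = (σ X w.1, π X w.2) := rfl

/-- Every vector of a module is in the submodule generated by a nonzero vector, if the module is
irreducible. -/
theorem mem_cyclic_of_irreducible {σ : 𝔤 →ₗ⁅ℝ⁆ Module.End ℂ N}
    (hσ : ∀ W : Submodule ℂ N, IsStable σ Set.univ W → W = ⊥ ∨ W = ⊤) {v : N} (hv : v ≠ 0)
    (x : N) : x ∈ cyclic σ v := by
  rcases hσ _ (cyclic_stable σ v) with h | h
  · exact absurd ((Submodule.eq_bot_iff _).1 h v (mem_cyclic_self σ v)) hv
  · rw [h]; trivial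

/-- The equalizer of two intertwiners is a submodule containing v. Linearity in a parameter and
commutation with a second algebra are later deduced from this. -/
theorem intertwiner_unique {σ : 𝔤 →ₗ⁅ℝ⁆ Module.End ℂ N} {π : 𝔤 →ₗ⁅ℝ⁆ Module.End ℂ M}
    (hσ : ∀ W : Submodule ℂ N, IsStable σ Set.univ W → W = ⊥ ∨ W = ⊤) {v : N} (hv : v ≠ 0)
    {T T' : N →ₗ[ℂ] M} (hT : ∀ X x, T (σ X x) = π X (T x)) (hT' : ∀ X x, T' (σ X x) = π X (T' x))
    (h : T v = T' v) : T = T' := by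
  ext x
  have hle : cyclic σ v ≤ LinearMap.eqLocus T T' :=
    cyclic_le h fun X _ w hw => by
      change T (σ X w) = T' (σ X w)
      rw [hT, hT']
      exact congrArg _ hw
  exact hle (mem_cyclic_of_irreducible hσ hv x)

/-- The module generated by a highest weight vector of a unitary module is a homomorphic image of
any irreducible unitary module of the same highest weight. -/
theorem exists_intertwiner {Z : 𝔤} (hZ : ∀ X : 𝔤, ⁅Z, ⁅Z, ⁅Z, X⁆⁆⁆ = -⁅Z, X⁆) {χ : 𝔤 → ℂ}
    {σ : 𝔤 →ₗ⁅ℝ⁆ Module.End ℂ N} {π : 𝔤 →ₗ⁅ℝ⁆ Module.End ℂ M}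
    {C : InnerProductSpace.Core ℂ N} (hC : IsInvariantInner σ C)
    {B : InnerProductSpace.Core ℂ M} (hB : IsInvariantInner π B)
    (hσ : ∀ W : Submodule ℂ N, IsStable σ Set.univ W → W = ⊥ ∨ W = ⊤)
    {v : N} (hv0 : v ≠ 0) (hv : IsHighestWeightVector Z χ σ v)
    {h : M} (hh : IsHighestWeightVector Z χ π h) :
    ∃ T : N →ₗ[ℂ] M, T v = h ∧ ∀ X x, T (σ X x) = π X (T x) := by
  have hraise : ∀ X w, raise Z (prodRep σ π) X w = (raise Z σ X w.1, raise Z π X w.2) :=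
    fun _ _ => rfl
  have hlower : ∀ X w, lower Z (prodRep σ π) X w = (lower Z σ X w.1, lower Z π X w.2) :=
    fun _ _ => rfl
  have hvh : IsHighestWeightVector Z χ (prodRep σ π) (v, h) :=
    ⟨fun X hX => by rw [hraise, hv.raise_eq X hX, hh.raise_eq X hX]; rfl,
      fun X hX => by rw [prodRep_apply, hv.weight_eq X hX, hh.weight_eq X hX]; rfl⟩
  -- The submodule generated by (v, h) turns out to be the graph of the intertwiner: its projection
  -- to N is onto by irreducibility, and injective by `hzero`.
  set W := cyclic (prodRep σ π) (v, h) with hW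
  have hWst : IsStable (prodRep σ π) Set.univ W := cyclic_stable _ _
  have hWh : ∀ w ∈ W, w.2 ∈ cyclic π h := by
    have : W ≤ (cyclic π h).comap (LinearMap.snd ℂ N M) :=
      cyclic_le (mem_cyclic_self π h) fun X _ w hw => cyclic_stable π h X trivial _ hw
    exact fun w hw => this hw
  have hfst : lowerRange Z (prodRep σ π) ≤ (lowerRange Z σ).comap (LinearMap.fst ℂ N M) := by
    refine Submodule.span_le.2 ?_
    rintro _ ⟨X, u, hX, rfl⟩
    exact Submodule.subset_span ⟨X, u.1, hX, rfl⟩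
  have hsnd : lowerRange Z (prodRep σ π) ≤ (lowerRange Z π).comap (LinearMap.snd ℂ N M) := by
    refine Submodule.span_le.2 ?_
    rintro _ ⟨X, u, hX, rfl⟩
    exact Submodule.subset_span ⟨X, u.2, hX, rfl⟩
  have hzero : ∀ z, (0, z) ∈ W → z = 0 := by
    have horth : ∀ z, (0, z) ∈ W → coreForm B h z = 0 := by
      intro z hz
      obtain ⟨y, hy, r, hr, hyr⟩ := Submodule.mem_sup.1 (cyclic_le_sup hZ hvh hz)
      obtain ⟨c, rfl⟩ := Submodule.mem_span_singleton.1 hy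
      have h1 : c • v + r.1 = 0 := congrArg Prod.fst hyr
      have h2 : c • h + r.2 = z := congrArg Prod.snd hyr
      -- The first component of (0, z) = c(v, h) + r, paired with v, forces c = 0. Hence z lies in
      -- the range of the lowering operators, which is orthogonal to h.
      have h3 : coreForm C v r.1 = 0 := inner_lowerRange hC hv.raise_eq (hfst hr)
      have h4 : c = 0 := by
        have h5 := congrArg (coreForm C v) h1
        rw [map_add, h3, map_smul, map_zero, add_zero, smul_eq_mul] at h5
        exact (mul_eq_zero.1 h5).resolve_right fun h6 => hv0 (coreForm_definite C h6)
      rw [← h2, h4, zero_smul, zero_add]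
      exact inner_lowerRange hB hh.raise_eq (hsnd hr)
    intro z hz
    -- The z with (0, z) ∈ W form a submodule, so the vectors orthogonal to all of them do too. The
    -- latter contains h, hence the module generated by h, hence z itself.
    have hle : cyclic π h ≤
        { carrier := {x | ∀ z, (0, z) ∈ W → coreForm B x z = 0}
          zero_mem' := by simp
          add_mem' := fun ha hb y hy => by
            rw [map_add, LinearMap.add_apply, ha y hy, hb y hy, add_zero]
          smul_mem' := fun c a ha y hy => by
            rw [LinearMap.map_smulₛₗ, LinearMap.smul_apply, ha y hy, smul_zero] } := by
      refine cyclic_le horth fun X _ w hw z hz => ?_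
      have h1 : coreForm B (π X w) z = -coreForm B w (π X z) := hB X w z
      rw [h1, hw, neg_zero]
      have h2 := hWst X trivial _ hz
      rwa [prodRep_apply, map_zero] at h2
    exact coreForm_definite B (hle (hWh _ hz) z hz)
  let f : W →ₗ[ℂ] N := (LinearMap.fst ℂ N M).domRestrict W
  have hf : Function.Bijective f := by
    refine ⟨(injective_iff_map_eq_zero f).2 ?_, fun x => ?_⟩
    · rintro ⟨⟨x, z⟩, hxz⟩ h0
      obtain rfl : x = 0 := h0
      have := hzero z hxz
      subst this
      rfl
    · have hle : cyclic σ v ≤ W.map (LinearMap.fst ℂ N M) := by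
        refine cyclic_le ⟨(v, h), mem_cyclic_self _ _, rfl⟩ ?_
        rintro X _ _ ⟨w, hw, rfl⟩
        exact ⟨_, hWst X trivial w hw, rfl⟩
      obtain ⟨w, hw, rfl⟩ := hle (mem_cyclic_of_irreducible hσ hv0 x)
      exact ⟨⟨w, hw⟩, rfl⟩
  let e := LinearEquiv.ofBijective f hf
  have hT : ∀ w : W, ((LinearMap.snd ℂ N M) ∘ₗ W.subtype ∘ₗ e.symm.toLinearMap) w.1.1 = w.1.2 := by
    intro w
    have : e.symm w.1.1 = w := e.symm_apply_apply w
    simp [this]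
  refine ⟨(LinearMap.snd ℂ N M) ∘ₗ W.subtype ∘ₗ e.symm.toLinearMap,
    hT ⟨(v, h), mem_cyclic_self _ _⟩, fun X x => ?_⟩
  obtain ⟨w, rfl⟩ := hf.2 x
  have h1 := hT ⟨_, hWst X trivial w.1 w.2⟩
  have h2 := hT w
  change _ = π X (((LinearMap.snd ℂ N M) ∘ₗ W.subtype ∘ₗ e.symm.toLinearMap) w.1.1)
  rw [h2]
  exact h1

/-- A linear family of highest weight vectors gives a linear family of intertwiners. -/
theorem exists_intertwiner_family {Z : 𝔤} (hZ : ∀ X : 𝔤, ⁅Z, ⁅Z, ⁅Z, X⁆⁆⁆ = -⁅Z, X⁆) {χ : 𝔤 → ℂ}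
    {σ : 𝔤 →ₗ⁅ℝ⁆ Module.End ℂ N} {π : 𝔤 →ₗ⁅ℝ⁆ Module.End ℂ M}
    {C : InnerProductSpace.Core ℂ N} (hC : IsInvariantInner σ C)
    {B : InnerProductSpace.Core ℂ M} (hB : IsInvariantInner π B)
    (hσ : ∀ W : Submodule ℂ N, IsStable σ Set.univ W → W = ⊥ ∨ W = ⊤)
    {v : N} (hv0 : v ≠ 0) (hv : IsHighestWeightVector Z χ σ v)
    {F : Type*} [AddCommGroup F] [Module ℂ F] (ι : F →ₗ[ℂ] M)
    (hι : ∀ y, IsHighestWeightVector Z χ π (ι y)) :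
    ∃ T : F →ₗ[ℂ] N →ₗ[ℂ] M, (∀ y, T y v = ι y) ∧ ∀ y X x, T y (σ X x) = π X (T y x) := by
  choose T hT1 hT2 using fun y => exists_intertwiner hZ hC hB hσ hv0 hv (hι y)
  refine ⟨⟨⟨T, fun y y' => ?_⟩, fun c y => ?_⟩, hT1, hT2⟩
  · refine intertwiner_unique hσ hv0 (hT2 _) (fun X x => ?_) ?_
    · simp [hT2]
    · simp [hT1]
  · refine intertwiner_unique hσ hv0 (hT2 _) (fun X x => ?_) ?_
    · simp [hT2]
    · simp [hT1]

/-- Intertwiners from a module generated by a highest weight vector are isometric up to a factor. -/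
theorem inner_intertwiner {Z : 𝔤} (hZ : ∀ X : 𝔤, ⁅Z, ⁅Z, ⁅Z, X⁆⁆⁆ = -⁅Z, X⁆) {χ : 𝔤 → ℂ}
    {σ : 𝔤 →ₗ⁅ℝ⁆ Module.End ℂ N} {π : 𝔤 →ₗ⁅ℝ⁆ Module.End ℂ M}
    {C : InnerProductSpace.Core ℂ N} (hC : IsInvariantInner σ C)
    {B : InnerProductSpace.Core ℂ M} (hB : IsInvariantInner π B)
    {v : N} (hv : IsHighestWeightVector Z χ σ v) (hcyc : ∀ x, x ∈ cyclic σ v)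
    {T T' : N →ₗ[ℂ] M} (hT : ∀ X x, T (σ X x) = π X (T x)) (hT' : ∀ X x, T' (σ X x) = π X (T' x))
    (x x' : N) :
    coreForm C v v * coreForm B (T x) (T' x') = coreForm B (T v) (T' v) * coreForm C x x' := by
  -- The combination of the two invariant forms is chosen to vanish at (v, v).
  have h := invariantForm_eq_zero hZ hv hv
    (coreForm C v v • ((coreForm B).comp T).compl₂ T' - coreForm B (T v) (T' v) • coreForm C)
    (fun X x y => ?_) ?_ (hcyc x) (hcyc x')
  · exact sub_eq_zero.1 h
  · have h1 : coreForm B (π X (T x)) (T' y) = -coreForm B (T x) (π X (T' y)) := hB _ _ _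
    have h2 : coreForm C (σ X x) y = -coreForm C x (σ X y) := hC _ _ _
    simp [hT, hT', h1, h2]
    ring
  · simp [mul_comm]

/-- Intertwiners from modules generated by highest weight vectors with orthogonal images have
orthogonal ranges. -/
theorem inner_intertwiner_eq_zero {N' : Type*} [AddCommGroup N'] [Module ℂ N']
    {Z : 𝔤} (hZ : ∀ X : 𝔤, ⁅Z, ⁅Z, ⁅Z, X⁆⁆⁆ = -⁅Z, X⁆) {χ χ' : 𝔤 → ℂ}
    {σ : 𝔤 →ₗ⁅ℝ⁆ Module.End ℂ N} {σ' : 𝔤 →ₗ⁅ℝ⁆ Module.End ℂ N'} {π : 𝔤 →ₗ⁅ℝ⁆ Module.End ℂ M}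
    {B : InnerProductSpace.Core ℂ M} (hB : IsInvariantInner π B)
    {v : N} (hv : IsHighestWeightVector Z χ σ v) (hcyc : ∀ x, x ∈ cyclic σ v)
    {v' : N'} (hv' : IsHighestWeightVector Z χ' σ' v') (hcyc' : ∀ x, x ∈ cyclic σ' v')
    {T : N →ₗ[ℂ] M} {T' : N' →ₗ[ℂ] M} (hT : ∀ X x, T (σ X x) = π X (T x))
    (hT' : ∀ X x, T' (σ' X x) = π X (T' x)) (h0 : coreForm B (T v) (T' v') = 0)
    (x : N) (x' : N') : coreForm B (T x) (T' x') = 0 := by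
  refine invariantForm_eq_zero hZ hv hv' (((coreForm B).comp T).compl₂ T')
    (fun X x y => ?_) h0 (hcyc x) (hcyc' x')
  have h1 : coreForm B (π X (T x)) (T' y) = -coreForm B (T x) (π X (T' y)) := hB _ _ _
  simp [hT, hT', h1]

/-- The action on a stable subspace. -/
def subRep (π : 𝔤 →ₗ⁅ℝ⁆ Module.End ℂ M) (W : Submodule ℂ M) (hW : IsStable π Set.univ W) :
    𝔤 →ₗ⁅ℝ⁆ Module.End ℂ W where
  toFun X := (π X).restrict fun w hw => hW X trivial w hw
  map_add' X Y := by ext; simp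
  map_smul' c X := by ext; simp
  map_lie' {X Y} := by ext; simp [Ring.lie_def]

/-- The inner product induced along an injective linear map. -/
@[reducible] def pullbackCore {F : Type*} [AddCommGroup F] [Module ℂ F] (B : InnerProductSpace.Core ℂ M)
    (f : F →ₗ[ℂ] M) (hf : Function.Injective f) : InnerProductSpace.Core ℂ F where
  inner x y := B.inner (f x) (f y)
  conj_inner_symm x y := B.conj_inner_symm _ _
  re_inner_nonneg x := B.re_inner_nonneg _
  add_left x y z := by rw [map_add, B.add_left]
  smul_left x y r := by rw [map_smul, B.smul_left]
  definite x hx := hf (by rw [map_zero]; exact B.definite _ hx)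

/-- The inner product scaled by a positive number. -/
@[reducible] def scaleCore (B : InnerProductSpace.Core ℂ M) (c : ℝ) (hc : 0 < c) :
    InnerProductSpace.Core ℂ M where
  inner x y := (c : ℂ) * B.inner x y
  conj_inner_symm x y := by rw [map_mul, B.conj_inner_symm, Complex.conj_ofReal]
  re_inner_nonneg x := by
    have := B.re_inner_nonneg x
    change 0 ≤ ((c : ℂ) * B.inner x x).re
    rw [Complex.re_ofReal_mul]
    exact mul_nonneg hc.le this
  add_left x y z := by rw [B.add_left, mul_add]
  smul_left x y r := by rw [B.smul_left]; ring
  definite x hx := B.definite _ ((mul_eq_zero.1 hx).resolve_left (by exact_mod_cast hc.ne'))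

end Abstract

/-! ### Coordinates on `𝔰𝔬(2, j)` -/

section Coordinates

variable {j : ℕ}

/-- The noncompact coordinates of an element of `𝔰𝔬(2, j)`, as a complex vector. -/
def boostCoord (X : so2 j) (i : Fin j) : ℂ :=
  ((X.1 (Sum.inl 0) (Sum.inr i) : ℝ) : ℂ) + Complex.I * ((X.1 (Sum.inl 1) (Sum.inr i) : ℝ) : ℂ)

/-- The lower right block of an element of `𝔰𝔬(2, j)`. -/
def rotCoord (X : so2 j) : Matrix (Fin j) (Fin j) ℝ := X.1.toBlocks₂₂

/-- These are the entries of XᵀD = -DX for D = diag(1, 1, -1, …, -1): skew diagonal blocks and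
mutually transposed off-diagonal blocks. -/
theorem so2_entries (X : so2 j) :
    X.1 (Sum.inl 0) (Sum.inl 0) = 0 ∧ X.1 (Sum.inl 1) (Sum.inl 1) = 0 ∧
    X.1 (Sum.inl 0) (Sum.inl 1) = -X.1 (Sum.inl 1) (Sum.inl 0) ∧
    (∀ a i, X.1 (Sum.inr i) (Sum.inl a) = X.1 (Sum.inl a) (Sum.inr i)) ∧
    ∀ i k, X.1 (Sum.inr i) (Sum.inr k) = -X.1 (Sum.inr k) (Sum.inr i) := by
  have h := (mem_so2 X.1).1 X.2
  have h' : ∀ a b, (if Sum.isLeft b then X.1 b a else -X.1 b a) =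
      (if Sum.isLeft a then -X.1 a b else X.1 a b) := by
    intro a b
    have := congrFun (congrFun h a) b
    rw [LieAlgebra.Orthogonal.indefiniteDiagonal, Matrix.mul_diagonal, Matrix.diagonal_mul] at this
    rcases a with a | a <;> rcases b with b | b <;> simpa using this
  refine ⟨?_, ?_, ?_, fun a i => ?_, fun i k => ?_⟩
  · have := h' (Sum.inl 0) (Sum.inl 0); simp at this; linarith
  · have := h' (Sum.inl 1) (Sum.inl 1); simp at this; linarith
  · have := h' (Sum.inl 1) (Sum.inl 0); simpa using this
  · have := h' (Sum.inl a) (Sum.inr i); simp at this; linarith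
  · have := h' (Sum.inr i) (Sum.inr k); simp at this; linarith

theorem boostCoord_re (X : so2 j) (i : Fin j) :
    (boostCoord X i).re = X.1 (Sum.inl 0) (Sum.inr i) := by simp [boostCoord]

theorem boostCoord_im (X : so2 j) (i : Fin j) :
    (boostCoord X i).im = X.1 (Sum.inl 1) (Sum.inr i) := by simp [boostCoord]

/-- The three coordinates realize 𝔰𝔬(2,j) as 𝔰𝔬(2) ⊕ ℂʲ ⊕ 𝔰𝔬(j), with 𝔭 identified with ℂʲ. All
later identities in the algebra are checked on them. -/
theorem so2_ext {X X' : so2 j} (ha : so2Coord X = so2Coord X') (hc : boostCoord X = boostCoord X')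
    (hY : rotCoord X = rotCoord X') : X = X' := by
  obtain ⟨h1, h2, h3, h4, -⟩ := so2_entries X
  obtain ⟨h1', h2', h3', h4', -⟩ := so2_entries X'
  have hb : ∀ a i, X.1 (Sum.inl a) (Sum.inr i) = X'.1 (Sum.inl a) (Sum.inr i) := by
    intro a i
    have := congrFun hc i
    fin_cases a
    · simpa [boostCoord_re] using congrArg Complex.re this
    · simpa [boostCoord_im] using congrArg Complex.im this
  have ha' : X.1 (Sum.inl 1) (Sum.inl 0) = X'.1 (Sum.inl 1) (Sum.inl 0) := ha
  refine Subtype.ext ?_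
  ext (a | i) (b | k)
  · fin_cases a <;> fin_cases b <;> simp [h1, h2, h3, h1', h2', h3', ha']
  · exact hb a k
  · rw [h4, h4', hb]
  · exact congrFun (congrFun hY i) k

theorem rotCoord_mem (X : so2 j) : rotCoord X ∈ so j := by
  rw [LieAlgebra.Orthogonal.mem_so]
  ext i k
  exact (so2_entries X).2.2.2.2 k i

theorem so2Coord_add (X X' : so2 j) : so2Coord (X + X') = so2Coord X + so2Coord X' := rfl
theorem so2Coord_smul (c : ℝ) (X : so2 j) : so2Coord (c • X) = c * so2Coord X := rfl
theorem so2Coord_neg (X : so2 j) : so2Coord (-X) = -so2Coord X := rfl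
theorem rotCoord_add (X X' : so2 j) : rotCoord (X + X') = rotCoord X + rotCoord X' := rfl
theorem rotCoord_smul (c : ℝ) (X : so2 j) : rotCoord (c • X) = c • rotCoord X := rfl
theorem rotCoord_neg (X : so2 j) : rotCoord (-X) = -rotCoord X := rfl

theorem boostCoord_add (X X' : so2 j) : boostCoord (X + X') = boostCoord X + boostCoord X' := by
  ext i
  simp [boostCoord]
  ring

theorem boostCoord_smul (c : ℝ) (X : so2 j) : boostCoord (c • X) = (c : ℂ) • boostCoord X := by
  ext i
  simp [boostCoord]
  ring

theorem boostCoord_neg (X : so2 j) : boostCoord (-X) = -boostCoord X := by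
  ext i
  simp [boostCoord]
  ring

theorem so2Coord_Z0 : so2Coord (Z0 j) = 1 := by simp [so2Coord, Z0]
theorem boostCoord_Z0 : boostCoord (Z0 j) = 0 := by ext i; simp [boostCoord, Z0]
theorem rotCoord_Z0 : rotCoord (Z0 j) = 0 := by ext i k; simp [rotCoord, Z0]

theorem so2_lie_apply (X X' : so2 j) (a b : Fin 2 ⊕ Fin j) :
    (⁅X, X'⁆ : so2 j).1 a b = (∑ t, X.1 a t * X'.1 t b) - ∑ t, X'.1 a t * X.1 t b := by
  rw [LieSubalgebra.coe_bracket, Ring.lie_def, Matrix.sub_apply, Matrix.mul_apply, Matrix.mul_apply]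

theorem so2Coord_lie (X X' : so2 j) :
    ((so2Coord ⁅X, X'⁆ : ℝ) : ℂ) = (Complex.I / 2) *
      ∑ i, (starRingEnd ℂ (boostCoord X i) * boostCoord X' i -
        starRingEnd ℂ (boostCoord X' i) * boostCoord X i) := by
  obtain ⟨h1, h2, h3, h4, -⟩ := so2_entries X
  obtain ⟨h1', h2', h3', h4', -⟩ := so2_entries X'
  have : so2Coord ⁅X, X'⁆ = ∑ i, (X.1 (Sum.inl 1) (Sum.inr i) * X'.1 (Sum.inl 0) (Sum.inr i) -
      X'.1 (Sum.inl 1) (Sum.inr i) * X.1 (Sum.inl 0) (Sum.inr i)) := by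
    rw [so2Coord, so2_lie_apply, Fintype.sum_sum_type, Fintype.sum_sum_type, Fin.sum_univ_two,
      Fin.sum_univ_two, h1, h1', h2, h2', Finset.sum_sub_distrib]
    simp only [h4, h4']
    ring
  rw [this, Complex.ofReal_sum, Finset.mul_sum]
  refine Finset.sum_congr rfl fun i _ => ?_
  simp only [boostCoord, map_add, map_mul, Complex.conj_ofReal, Complex.conj_I]
  push_cast
  linear_combination ((X.1 (Sum.inl 0) (Sum.inr i) : ℂ) * (X'.1 (Sum.inl 1) (Sum.inr i) : ℂ) -
    (X'.1 (Sum.inl 0) (Sum.inr i) : ℂ) * (X.1 (Sum.inl 1) (Sum.inr i) : ℂ)) * (-Complex.I_mul_I)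

theorem boostCoord_lie (X X' : so2 j) (i : Fin j) :
    boostCoord ⁅X, X'⁆ i = Complex.I * so2Coord X * boostCoord X' i -
      Complex.I * so2Coord X' * boostCoord X i +
      ∑ k, (boostCoord X k * (rotCoord X' k i : ℝ) - boostCoord X' k * (rotCoord X k i : ℝ)) := by
  obtain ⟨h1, h2, h3, -⟩ := so2_entries X
  obtain ⟨h1', h2', h3', -⟩ := so2_entries X'
  simp only [boostCoord, so2_lie_apply, Fintype.sum_sum_type, Fin.sum_univ_two, h1, h2, h3, h1',
    h2', h3', so2Coord, rotCoord, Matrix.toBlocks₂₂, Matrix.of_apply, Finset.sum_sub_distrib,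
    add_mul, Finset.sum_add_distrib, mul_assoc, ← Finset.mul_sum]
  push_cast
  linear_combination ((X.1 (Sum.inl 1) (Sum.inl 0) : ℂ) * (X'.1 (Sum.inl 1) (Sum.inr i) : ℂ) -
    (X'.1 (Sum.inl 1) (Sum.inl 0) : ℂ) * (X.1 (Sum.inl 1) (Sum.inr i) : ℂ)) * (-Complex.I_mul_I)

theorem rotCoord_lie (X X' : so2 j) (i k : Fin j) :
    (((rotCoord ⁅X, X'⁆) i k : ℝ) : ℂ) = ((⁅rotCoord X, rotCoord X'⁆ i k : ℝ) : ℂ) +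
      (2⁻¹ : ℂ) * (boostCoord X i * starRingEnd ℂ (boostCoord X' k) +
        starRingEnd ℂ (boostCoord X i) * boostCoord X' k -
        boostCoord X' i * starRingEnd ℂ (boostCoord X k) -
        starRingEnd ℂ (boostCoord X' i) * boostCoord X k) := by
  obtain ⟨-, -, -, h4, -⟩ := so2_entries X
  obtain ⟨-, -, -, h4', -⟩ := so2_entries X'
  have : rotCoord ⁅X, X'⁆ i k = ⁅rotCoord X, rotCoord X'⁆ i k +
      (X.1 (Sum.inl 0) (Sum.inr i) * X'.1 (Sum.inl 0) (Sum.inr k) +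
        X.1 (Sum.inl 1) (Sum.inr i) * X'.1 (Sum.inl 1) (Sum.inr k) -
        X'.1 (Sum.inl 0) (Sum.inr i) * X.1 (Sum.inl 0) (Sum.inr k) -
        X'.1 (Sum.inl 1) (Sum.inr i) * X.1 (Sum.inl 1) (Sum.inr k)) := by
    rw [Ring.lie_def, Matrix.sub_apply, Matrix.mul_apply, Matrix.mul_apply]
    simp only [rotCoord, Matrix.toBlocks₂₂, Matrix.of_apply, so2_lie_apply, Fintype.sum_sum_type,
      Fin.sum_univ_two, h4, h4']
    ring
  rw [this]
  simp only [boostCoord, map_add, map_mul, Complex.conj_ofReal, Complex.conj_I]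
  push_cast
  linear_combination ((X.1 (Sum.inl 1) (Sum.inr i) : ℂ) * (X'.1 (Sum.inl 1) (Sum.inr k) : ℂ) -
    (X'.1 (Sum.inl 1) (Sum.inr i) : ℂ) * (X.1 (Sum.inl 1) (Sum.inr k) : ℂ)) * (Complex.I_mul_I)

/-- This is the reason for packing the two rows of 𝔭 into one complex vector: ad Z₀ becomes
multiplication by i there, and it is zero on the other two coordinates. -/
theorem boostCoord_Z0_lie (X : so2 j) : boostCoord ⁅Z0 j, X⁆ = Complex.I • boostCoord X := by
  ext i
  simp [boostCoord_lie, so2Coord_Z0, boostCoord_Z0, rotCoord_Z0]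

theorem so2Coord_Z0_lie (X : so2 j) : so2Coord ⁅Z0 j, X⁆ = 0 := by
  have := so2Coord_lie (Z0 j) X
  simpa [boostCoord_Z0] using this

theorem rotCoord_Z0_lie (X : so2 j) : rotCoord ⁅Z0 j, X⁆ = 0 := by
  ext i k
  have := rotCoord_lie (Z0 j) X i k
  simpa [boostCoord_Z0, rotCoord_Z0] using this

/-- The only structural fact about 𝔰𝔬(2,j) on which the general highest weight arguments depend. -/
theorem Z0_lie_lie_lie (X : so2 j) : ⁅Z0 j, ⁅Z0 j, ⁅Z0 j, X⁆⁆⁆ = -⁅Z0 j, X⁆ := by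
  refine so2_ext ?_ ?_ ?_
  · rw [so2Coord_neg, so2Coord_Z0_lie, so2Coord_Z0_lie, neg_zero]
  · rw [boostCoord_neg, boostCoord_Z0_lie, boostCoord_Z0_lie, boostCoord_Z0_lie, smul_smul,
      Complex.I_mul_I, neg_one_smul]
  · rw [rotCoord_neg, rotCoord_Z0_lie, rotCoord_Z0_lie, neg_zero]

theorem Z0_lie_eq_zero_iff (X : so2 j) : ⁅Z0 j, X⁆ = 0 ↔ boostCoord X = 0 := by
  constructor
  · intro h
    have h1 := boostCoord_Z0_lie X
    rw [h] at h1
    have h2 : boostCoord (0 : so2 j) = 0 := by ext i; simp [boostCoord]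
    rw [h2, eq_comm, smul_eq_zero] at h1
    exact h1.resolve_left Complex.I_ne_zero
  · intro h
    refine so2_ext ?_ ?_ ?_
    · rw [so2Coord_Z0_lie]; rfl
    · rw [boostCoord_Z0_lie, h]; ext i; simp [boostCoord]
    · rw [rotCoord_Z0_lie]; rfl

/-- Both conditions say that the boost coordinates vanish. This makes 𝔨 the centralizer of Z₀, as in
the general arguments. -/
theorem isCompactPart_iff (X : so2 j) : IsCompactPart X ↔ ⁅Z0 j, X⁆ = 0 := by
  rw [Z0_lie_eq_zero_iff]
  obtain ⟨h1, h2, h3, h4, h5⟩ := so2_entries X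
  constructor
  · intro h
    have hz : ∀ a i, X.1 (Sum.inl a) (Sum.inr i) = 0 := by
      intro a i
      have h6 := congrFun (congrFun h (Sum.inl a)) (Sum.inr i)
      rw [Matrix.transpose_apply, h4] at h6
      have h7 : X.1 (Sum.inl a) (Sum.inr i) = -X.1 (Sum.inl a) (Sum.inr i) := h6
      linarith
    ext i
    simp [boostCoord, hz]
  · intro h
    have hz : ∀ a i, X.1 (Sum.inl a) (Sum.inr i) = 0 := by
      intro a i
      fin_cases a
      · simp [← boostCoord_re, h]
      · simp [← boostCoord_im, h]
    ext (a | i) (b | k)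
    · fin_cases a <;> fin_cases b <;> simp [h1, h2, h3]
    · simp [h4, hz]
    · simp [h4, hz]
    · simpa using h5 k i

theorem Z0_lie_lie_eq_neg {X : so2 j} (h : ⁅Z0 j, ⁅Z0 j, X⁆⁆ = -X) :
    so2Coord X = 0 ∧ rotCoord X = 0 := by
  constructor
  · have := congrArg so2Coord h
    rw [so2Coord_Z0_lie, so2Coord_neg] at this
    linarith
  · have := congrArg rotCoord h
    rw [rotCoord_Z0_lie, rotCoord_neg] at this
    exact neg_eq_zero.1 this.symm

/-- The symmetric element of `𝔰𝔬(2, j)` with noncompact coordinates `c`. -/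
def boost (c : Fin j → ℂ) : so2 j :=
  ⟨Matrix.fromBlocks 0 (Matrix.of fun a i => ![(c i).re, (c i).im] a)
    (Matrix.of fun i a => ![(c i).re, (c i).im] a) 0, by
    rw [mem_so2, indefiniteDiagonal_eq]
    simp only [Matrix.fromBlocks_transpose, Matrix.fromBlocks_neg, Matrix.fromBlocks_multiply]
    congr 1 <;> ext a b <;> simp⟩

theorem boostCoord_boost (c : Fin j → ℂ) : boostCoord (boost c) = c := by
  ext i
  apply Complex.ext <;> simp [boostCoord, boost]

theorem so2Coord_boost (c : Fin j → ℂ) : so2Coord (boost c) = 0 := by simp [so2Coord, boost]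
theorem rotCoord_boost (c : Fin j → ℂ) : rotCoord (boost c) = 0 := by
  ext i k; simp [rotCoord, boost]

theorem Z0_lie_lie_boost (c : Fin j → ℂ) : ⁅Z0 j, ⁅Z0 j, boost c⁆⁆ = -boost c := by
  refine so2_ext ?_ ?_ ?_
  · simp [so2Coord_Z0_lie, so2Coord_neg, so2Coord_boost]
  · simp [boostCoord_Z0_lie, boostCoord_neg, smul_smul]
  · simp [rotCoord_Z0_lie, rotCoord_neg, rotCoord_boost]

end Coordinates

/-! ### Coordinates of block diagonal elements -/

section BlockIncl

variable (m l : ℕ)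

theorem blockIncl_entry (Z : so2 m × so l) (a b : (Fin 2 ⊕ Fin m) ⊕ Fin l) :
    (blockIncl m l Z).1 (coordEquiv m l a) (coordEquiv m l b) =
      Matrix.fromBlocks Z.1.1 0 0 Z.2.1 a b := by
  change blockMatrix m l Z.1.1 Z.2.1 _ _ = _
  simp [blockMatrix]

theorem so2Coord_blockIncl (Z : so2 m × so l) : so2Coord (blockIncl m l Z) = so2Coord Z.1 :=
  blockIncl_entry m l Z (Sum.inl (Sum.inl 1)) (Sum.inl (Sum.inl 0))

theorem boostCoord_blockIncl_castAdd (Z : so2 m × so l) (i : Fin m) :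
    boostCoord (blockIncl m l Z) (Fin.castAdd l i) = boostCoord Z.1 i := by
  have h := fun a => blockIncl_entry m l Z (Sum.inl (Sum.inl a)) (Sum.inl (Sum.inr i))
  simp only [coordEquiv, Equiv.trans_apply, Equiv.sumAssoc_apply_inl_inl,
    Equiv.sumAssoc_apply_inl_inr, Equiv.sumCongr_apply, Sum.map_inl, Sum.map_inr,
    finSumFinEquiv_apply_left, Equiv.refl_apply, Matrix.fromBlocks_apply₁₁] at h
  rw [boostCoord, h, h, boostCoord]

theorem boostCoord_blockIncl_natAdd (Z : so2 m × so l) (i : Fin l) :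
    boostCoord (blockIncl m l Z) (Fin.natAdd m i) = 0 := by
  have h := fun a => blockIncl_entry m l Z (Sum.inl (Sum.inl a)) (Sum.inr i)
  simp only [coordEquiv, Equiv.trans_apply, Equiv.sumAssoc_apply_inl_inl,
    Equiv.sumAssoc_apply_inr, Equiv.sumCongr_apply, Sum.map_inl, Sum.map_inr,
    finSumFinEquiv_apply_right, Equiv.refl_apply, Matrix.fromBlocks_apply₁₂] at h
  rw [boostCoord, h, h]
  simp

theorem rotCoord_blockIncl (Z : so2 m × so l) :
    rotCoord (blockIncl m l Z) = Matrix.reindex finSumFinEquiv finSumFinEquiv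
      (Matrix.fromBlocks (rotCoord Z.1) 0 0 Z.2.1) := by
  ext a b
  obtain ⟨a, rfl⟩ := finSumFinEquiv.surjective a
  obtain ⟨b, rfl⟩ := finSumFinEquiv.surjective b
  rcases a with a | a <;> rcases b with b | b
  · exact (blockIncl_entry m l Z (Sum.inl (Sum.inr a)) (Sum.inl (Sum.inr b))).trans
      (by simp [rotCoord, Matrix.toBlocks₂₂])
  · exact (blockIncl_entry m l Z (Sum.inl (Sum.inr a)) (Sum.inr b)).trans (by simp)
  · exact (blockIncl_entry m l Z (Sum.inr a) (Sum.inl (Sum.inr b))).trans (by simp)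
  · exact (blockIncl_entry m l Z (Sum.inr a) (Sum.inr b)).trans (by simp)

/-- The inclusion `𝔰𝔬(2, m) → 𝔰𝔬(2, m + l)`. -/
def leftIncl : so2 m →ₗ⁅ℝ⁆ so2 (m + l) :=
  (blockIncl m l).comp (LieHom.inl ℝ (so2 m) (so l))

end BlockIncl

/-! ### Scalar highest weight modules -/

section Scalar

variable {j : ℕ} {M : Type*} [AddCommGroup M] [Module ℂ M]

/-- The weight with parameter `lam` of the compact part of `𝔰𝔬(2, j)`. -/
def scalarWeight (j : ℕ) (lam : ℝ) (X : so2 j) : ℂ :=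
  -(Complex.I * (lam : ℂ) * (so2Coord X : ℂ))

/-- For X + iY in 𝔭⁺ the second component is forced, Y = -[Z₀, X], so 𝔭⁺ is parametrized by X in the
(-1)-eigenspace of (ad Z₀)². -/
theorem mem_highestWeightSpace_iff {π : so2 j →ₗ⁅ℝ⁆ Module.End ℂ M} {v : M} :
    v ∈ highestWeightSpace π ↔ ∀ X, ⁅Z0 j, ⁅Z0 j, X⁆⁆ = -X → raise (Z0 j) π X v = 0 := by
  constructor
  · intro h X hX
    have := h X (-⁅Z0 j, X⁆) (neg_neg _).symm (by rw [lie_neg, hX, neg_neg])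
    rw [← this, raise, map_neg]
    simp [sub_eq_add_neg]
  · intro h X Y h1 h2
    have := h X (by rw [h1, lie_neg, h2])
    rw [← this, raise, h1, map_neg]
    simp

theorem IsScalarHighestWeight.exists_vector {lam : ℝ} {π : so2 j →ₗ⁅ℝ⁆ Module.End ℂ M}
    {B : InnerProductSpace.Core ℂ M} (h : IsScalarHighestWeight j lam π B) :
    ∃ v : M, v ≠ 0 ∧ IsHighestWeightVector (Z0 j) (scalarWeight j lam) π v := by
  obtain ⟨v, hv, -⟩ := finrank_eq_one_iff'.1 h.scalar
  refine ⟨v.1, fun h0 => hv (Subtype.ext h0), mem_highestWeightSpace_iff.1 v.2, fun X hX => ?_⟩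
  exact h.weight v.1 v.2 X ((isCompactPart_iff X).2 hX)

/-- The submodule generated by a highest weight vector of a unitary module on which the raising
operators decrease a degree. -/
theorem isScalarHighestWeight_cyclic {lam : ℝ} {π : so2 j →ₗ⁅ℝ⁆ Module.End ℂ M}
    {B : InnerProductSpace.Core ℂ M} (hB : IsInvariantInner π B) {v : M} (hv0 : v ≠ 0)
    (hv : IsHighestWeightVector (Z0 j) (scalarWeight j lam) π v) (deg : M → ℕ)
    (hdeg : ∀ X, ⁅Z0 j, ⁅Z0 j, X⁆⁆ = -X → ∀ u, raise (Z0 j) π X u = 0 ∨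
      deg (raise (Z0 j) π X u) < deg u)
    (hfin : ∀ v : M, ∃ W : Submodule ℂ M,
      v ∈ W ∧ FiniteDimensional ℂ W ∧ IsStable π {X | IsCompactPart X} W) :
    IsScalarHighestWeight j lam (subRep π (cyclic π v) (cyclic_stable π v))
      (pullbackCore B (cyclic π v).subtype (cyclic π v).injective_subtype) := by
  have hv' : v ∈ cyclic π v := mem_cyclic_self π v
  have hraise : ∀ X (u : cyclic π v),
      (raise (Z0 j) (subRep π (cyclic π v) (cyclic_stable π v)) X u : M) =
        raise (Z0 j) π X u := fun _ _ => rfl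
  have hspan : ∀ u : cyclic π v,
      u ∈ highestWeightSpace (subRep π (cyclic π v) (cyclic_stable π v)) →
        u.1 ∈ Submodule.span ℂ {v} := fun u hu =>
    mem_span_of_raise_eq_zero Z0_lie_lie_lie hB hv u.2 fun X hX => by
      rw [← hraise, mem_highestWeightSpace_iff.1 hu X hX]; rfl
  have hvmem : (⟨v, hv'⟩ : cyclic π v) ∈
      highestWeightSpace (subRep π (cyclic π v) (cyclic_stable π v)) :=
    mem_highestWeightSpace_iff.2 fun X hX => Subtype.ext (hv.raise_eq X hX)
  refine ⟨⟨⟨0, ⟨v, hv'⟩, fun h => hv0 (congrArg Subtype.val h).symm⟩⟩, fun W hW => ?_, fun u => ?_,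
    fun X u w => hB X u w, ?_, fun u hu X hX => ?_⟩
  · by_cases h0 : W = ⊥
    · exact Or.inl h0
    · right
      -- A nonzero vector of least degree in W is killed by the raising operators, hence is a
      -- multiple of v; so W contains v and with it everything.
      obtain ⟨u, ⟨hu, hu0⟩, hmin⟩ := (measure (fun u : cyclic π v => deg u.1)).wf.has_min
        {u | u ∈ W ∧ u ≠ 0} ((Submodule.ne_bot_iff W).1 h0)
      have huh : u ∈ highestWeightSpace (subRep π (cyclic π v) (cyclic_stable π v)) := by
        refine mem_highestWeightSpace_iff.2 fun X hX => ?_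
        by_contra hne
        rcases hdeg X hX u.1 with h | h
        · exact hne (Subtype.ext h)
        · exact hmin _ ⟨raise_mem hW X hu, hne⟩ h
      obtain ⟨c, hc⟩ := Submodule.mem_span_singleton.1 (hspan u huh)
      have hc0 : c ≠ 0 := by
        rintro rfl
        exact hu0 (Subtype.ext (by rw [← hc, zero_smul]; rfl))
      have hvW : (⟨v, hv'⟩ : cyclic π v) ∈ W := by
        have : (⟨v, hv'⟩ : cyclic π v) = c⁻¹ • u :=
          Subtype.ext (by
            change v = c⁻¹ • u.1
            rw [← hc, smul_smul, inv_mul_cancel₀ hc0, one_smul])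
        rw [this]
        exact W.smul_mem _ hu
      have hle : cyclic π v ≤ W.map (cyclic π v).subtype := by
        refine cyclic_le ⟨_, hvW, rfl⟩ ?_
        rintro X _ _ ⟨w, hw, rfl⟩
        exact ⟨_, hW X trivial w hw, rfl⟩
      refine (Submodule.eq_top_iff').2 fun x => ?_
      obtain ⟨y, hy, hyx⟩ := hle x.2
      rwa [← Subtype.ext (a1 := y) (a2 := x) hyx]
  · obtain ⟨W, huW, hWf, hWs⟩ := hfin u.1
    refine ⟨W.comap (cyclic π v).subtype, huW, ?_, fun X hX w hw => hWs X hX _ hw⟩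
    refine Module.Finite.of_injective
      ((cyclic π v).subtype.restrict (p := W.comap (cyclic π v).subtype) (q := W) fun _ h => h) ?_
    intro a b hab
    exact Subtype.ext (Subtype.ext (congrArg (fun z : W => z.1) hab))
  · refine finrank_eq_one_iff'.2 ⟨⟨⟨v, hv'⟩, hvmem⟩, fun h => hv0 ?_, fun w => ?_⟩
    · exact congrArg (fun z => z.1.1) h
    · obtain ⟨c, hc⟩ := Submodule.mem_span_singleton.1 (hspan w.1 w.2)
      exact ⟨c, Subtype.ext (Subtype.ext hc)⟩
  · obtain ⟨c, hc⟩ := Submodule.mem_span_singleton.1 (hspan u hu)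
    refine Subtype.ext ?_
    change π X u.1 = (-(Complex.I * (lam : ℂ) * (so2Coord X : ℂ))) • u.1
    rw [← hc, map_smul, hv.weight_eq X ((isCompactPart_iff X).1 hX), smul_comm]
    rfl

end Scalar

/-! ### Conformal vector fields -/

section Conformal

open MvPolynomial Matrix

variable {n : ℕ}

/-- The linear form with coefficients `d`. -/
def linForm (d : Fin n → ℂ) : MvPolynomial (Fin n) ℂ := ∑ i, C (d i) * X i

/-- The quadratic form `∑ xᵢ²`. -/
def sqNorm (n : ℕ) : MvPolynomial (Fin n) ℂ := ∑ i, X i * X i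

theorem linForm_add (d d' : Fin n → ℂ) : linForm (d + d') = linForm d + linForm d' := by
  simp [linForm, add_mul, Finset.sum_add_distrib]

theorem linForm_sub (d d' : Fin n → ℂ) : linForm (d - d') = linForm d - linForm d' := by
  simp [linForm, sub_mul, Finset.sum_sub_distrib]

theorem linForm_smul (r : ℂ) (d : Fin n → ℂ) : linForm (r • d) = C r * linForm d := by
  simp [linForm, Finset.mul_sum, mul_assoc]

theorem linForm_single (i : Fin n) : linForm (Pi.single i 1) = (X i : MvPolynomial (Fin n) ℂ) := by
  rw [linForm, Finset.sum_eq_single i]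
  · simp
  · intro b _ hb; simp [hb]
  · simp

/-- The conformal vector field with dilation part `α`, rotation part `Y`, translation part `c` and
inversion part `e`. -/
def conformalField (α : ℂ) (Y : Matrix (Fin n) (Fin n) ℂ) (c e : Fin n → ℂ) :
    Derivation ℂ (MvPolynomial (Fin n) ℂ) (MvPolynomial (Fin n) ℂ) :=
  mkDerivation ℂ fun i => C α * X i - linForm (Y i) + C (2⁻¹ * c i) + C (2⁻¹ * e i) * sqNorm n -
    linForm e * X i

theorem conformalField_linForm (α : ℂ) (Y : Matrix (Fin n) (Fin n) ℂ) (c e d : Fin n → ℂ) :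
    conformalField α Y c e (linForm d) = C α * linForm d - linForm (d ᵥ* Y) +
      C (2⁻¹ * (d ⬝ᵥ c)) + C (2⁻¹ * (d ⬝ᵥ e)) * sqNorm n - linForm e * linForm d := by
  have h1 : conformalField α Y c e (linForm d) = ∑ i, C (d i) * (C α * X i - linForm (Y i) +
      C (2⁻¹ * c i) + C (2⁻¹ * e i) * sqNorm n - linForm e * X i) := by
    rw [linForm, map_sum]
    refine Finset.sum_congr rfl fun i _ => ?_
    rw [← smul_eq_C_mul, Derivation.map_smul, conformalField, mkDerivation_X, smul_eq_C_mul]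
  have h2 : linForm (d ᵥ* Y) = ∑ i, C (d i) * linForm (Y i) := by
    simp only [linForm, Matrix.vecMul, dotProduct, Finset.mul_sum, map_sum, Finset.sum_mul]
    rw [Finset.sum_comm]
    simp [mul_assoc]
  rw [h1, h2, show linForm d = ∑ i, C (d i) * X i from rfl]
  simp only [dotProduct, Finset.mul_sum, map_sum, Finset.sum_mul, ← Finset.sum_add_distrib,
    ← Finset.sum_sub_distrib, map_mul]
  refine Finset.sum_congr rfl fun i _ => ?_
  ring

theorem sum_X_mul_linForm {Y : Matrix (Fin n) (Fin n) ℂ} (hY : ∀ i j, Y i j = -Y j i) :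
    ∑ i, X i * linForm (Y i) = 0 := by
  have h : ∑ i, X i * linForm (Y i) = -∑ i, X i * linForm (Y i) := by
    simp only [linForm, Finset.mul_sum]
    conv_lhs => rw [Finset.sum_comm]
    rw [← Finset.sum_neg_distrib]
    refine Finset.sum_congr rfl fun i _ => ?_
    rw [← Finset.sum_neg_distrib]
    refine Finset.sum_congr rfl fun j _ => ?_
    rw [hY, map_neg]
    ring
  exact self_eq_neg.1 h

/-- Rotations annihilate |x|². The formula is needed for brackets because the inversion part of a
field has |x|² in its coefficients. -/
theorem conformalField_sqNorm (α : ℂ) {Y : Matrix (Fin n) (Fin n) ℂ} (hY : ∀ i j, Y i j = -Y j i)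
    (c e : Fin n → ℂ) :
    conformalField α Y c e (sqNorm n) =
      2 * C α * sqNorm n + linForm c - linForm e * sqNorm n := by
  have h1 : conformalField α Y c e (sqNorm n) = ∑ i, 2 * X i * (C α * X i - linForm (Y i) +
      C (2⁻¹ * c i) + C (2⁻¹ * e i) * sqNorm n - linForm e * X i) := by
    conv_lhs => rw [sqNorm]
    rw [map_sum]
    refine Finset.sum_congr rfl fun i _ => ?_
    rw [Derivation.leibniz, conformalField, mkDerivation_X]
    simp only [smul_eq_mul]
    ring
  have h2 : ∑ i, 2 * X i * (C α * X i - linForm (Y i) +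
      C (2⁻¹ * c i) + C (2⁻¹ * e i) * sqNorm n - linForm e * X i) =
      2 * C α * ∑ i, X i * X i - 2 * ∑ i, X i * linForm (Y i) + 2 * ∑ i, C (2⁻¹ * c i) * X i +
      2 * (∑ i, C (2⁻¹ * e i) * X i) * sqNorm n - 2 * linForm e * ∑ i, X i * X i := by
    simp only [Finset.mul_sum, Finset.sum_mul, ← Finset.sum_add_distrib, ← Finset.sum_sub_distrib]
    refine Finset.sum_congr rfl fun i _ => ?_
    ring
  have h3 : ∀ d : Fin n → ℂ, ∑ i, C (2⁻¹ * d i) * X i = C 2⁻¹ * linForm d :=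
    fun d => linForm_smul 2⁻¹ d
  have h4 : (2 : MvPolynomial (Fin n) ℂ) * C 2⁻¹ = 1 := by
    rw [← map_ofNat C, ← map_mul]; simp
  rw [h1, h2, sum_X_mul_linForm hY, h3, h3, ← sqNorm]
  linear_combination (linForm c + linForm e * sqNorm n) * h4

theorem dotProduct_vecMul_skew {Y : Matrix (Fin n) (Fin n) ℂ} (hY : ∀ i j, Y i j = -Y j i)
    (c d : Fin n → ℂ) : d ⬝ᵥ (c ᵥ* Y) = -((d ᵥ* Y) ⬝ᵥ c) := by
  have hT : Y.transpose = -Y := by ext i j; exact hY j i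
  rw [← Matrix.mulVec_transpose, hT, Matrix.neg_mulVec, dotProduct_neg, Matrix.dotProduct_mulVec]

/-- The rotation part of the bracket of two conformal vector fields. -/
def bracketRot (Y Y' : Matrix (Fin n) (Fin n) ℂ) (c e c' e' : Fin n → ℂ) :
    Matrix (Fin n) (Fin n) ℂ :=
  Matrix.of fun i k => (Y * Y' - Y' * Y) i k +
    2⁻¹ * (c i * e' k + e i * c' k - c' i * e k - e' i * c k)

theorem vecMul_bracketRot (Y Y' : Matrix (Fin n) (Fin n) ℂ) (c e c' e' d : Fin n → ℂ) :
    d ᵥ* bracketRot Y Y' c e c' e' = (d ᵥ* Y) ᵥ* Y' - (d ᵥ* Y') ᵥ* Y +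
      (2⁻¹ : ℂ) • ((d ⬝ᵥ c) • e' + (d ⬝ᵥ e) • c' - (d ⬝ᵥ c') • e - (d ⬝ᵥ e') • c) := by
  have h : bracketRot Y Y' c e c' e' = Y * Y' - Y' * Y + (2⁻¹ : ℂ) • (vecMulVec c e' +
      vecMulVec e c' - vecMulVec c' e - vecMulVec e' c) := by
    ext i k
    simp [bracketRot, vecMulVec_apply]
  rw [h]
  simp only [Matrix.vecMul_add, Matrix.vecMul_sub, Matrix.vecMul_smul, Matrix.vecMul_vecMul,
    Matrix.vecMul_vecMulVec]

/-- Conformal fields close under the bracket. Keeping c and e independent amounts to working in the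
complexified conformal algebra; the real form is imposed only in `conformalGen`. -/
theorem conformalField_lie {α α' : ℂ} {Y Y' : Matrix (Fin n) (Fin n) ℂ}
    (hY : ∀ i j, Y i j = -Y j i) (hY' : ∀ i j, Y' i j = -Y' j i) (c e c' e' : Fin n → ℂ) :
    ⁅conformalField α Y c e, conformalField α' Y' c' e'⁆ =
      conformalField (2⁻¹ * (e ⬝ᵥ c' - e' ⬝ᵥ c)) (bracketRot Y Y' c e c' e')
        (-α • c' + α' • c + c ᵥ* Y' - c' ᵥ* Y) (α • e' - α' • e + e ᵥ* Y' - e' ᵥ* Y) := by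
  apply MvPolynomial.derivation_ext
  intro i
  rw [← linForm_single, Derivation.commutator_apply]
  -- Derivations are compared on coordinates, but an arbitrary linear form lets the formula for
  -- linear forms be applied twice without expanding sums.
  generalize (Pi.single i 1 : Fin n → ℂ) = d
  simp only [conformalField_linForm, map_add, map_sub, Derivation.leibniz,
    conformalField_sqNorm α hY, conformalField_sqNorm α' hY', smul_eq_mul, vecMul_bracketRot, linForm_add, linForm_sub, linForm_smul,
    derivation_C, dotProduct_add, dotProduct_sub, dotProduct_smul, dotProduct_vecMul_skew hY,
    dotProduct_vecMul_skew hY', map_mul, map_neg, mul_zero, add_zero,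
    dotProduct_comm e' e, dotProduct_comm e c', dotProduct_comm e' c]
  ring

/-- The action of a conformal vector field on densities of weight `lam`. -/
def conformalOp (lam α : ℂ) (Y : Matrix (Fin n) (Fin n) ℂ) (c e : Fin n → ℂ) :
    Module.End ℂ (MvPolynomial (Fin n) ℂ) :=
  (conformalField α Y c e : MvPolynomial (Fin n) ℂ →ₗ[ℂ] MvPolynomial (Fin n) ℂ) +
    LinearMap.mulLeft ℂ (C (α * lam) - C lam * linForm e)

theorem conformalOp_apply (lam α : ℂ) (Y : Matrix (Fin n) (Fin n) ℂ) (c e : Fin n → ℂ)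
    (p : MvPolynomial (Fin n) ℂ) : conformalOp lam α Y c e p =
      conformalField α Y c e p + (C (α * lam) - C lam * linForm e) * p := rfl

/-- The multiplier is λ(α - e·x), where n(α - e·x) is the divergence of the field. The divergence is
a cocycle on vector fields, so adding a multiple of it preserves brackets for every λ. -/
theorem conformalOp_lie (lam : ℂ) {α α' : ℂ} {Y Y' : Matrix (Fin n) (Fin n) ℂ}
    (hY : ∀ i j, Y i j = -Y j i) (hY' : ∀ i j, Y' i j = -Y' j i) (c e c' e' : Fin n → ℂ) :
    ⁅conformalOp lam α Y c e, conformalOp lam α' Y' c' e'⁆ =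
      conformalOp lam (2⁻¹ * (e ⬝ᵥ c' - e' ⬝ᵥ c)) (bracketRot Y Y' c e c' e')
        (-α • c' + α' • c + c ᵥ* Y' - c' ᵥ* Y) (α • e' - α' • e + e ᵥ* Y' - e' ᵥ* Y) := by
  refine LinearMap.ext fun p => ?_
  have h : (conformalField α Y c e) (conformalField α' Y' c' e' p) -
      (conformalField α' Y' c' e') (conformalField α Y c e p) =
      conformalField (2⁻¹ * (e ⬝ᵥ c' - e' ⬝ᵥ c)) (bracketRot Y Y' c e c' e')
        (-α • c' + α' • c + c ᵥ* Y' - c' ᵥ* Y) (α • e' - α' • e + e ᵥ* Y' - e' ᵥ* Y) p := by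
    rw [← conformalField_lie hY hY', Derivation.commutator_apply]
  rw [Ring.lie_def, LinearMap.sub_apply, Module.End.mul_apply, Module.End.mul_apply,
    conformalOp_apply lam (2⁻¹ * _), ← h]
  simp only [conformalOp_apply, map_add, map_sub, Derivation.leibniz, conformalField_linForm,
    smul_eq_mul, linForm_add, linForm_sub, linForm_smul, derivation_C, map_mul, mul_zero, add_zero,
    dotProduct_comm e' e, dotProduct_comm e c']
  ring

/-- The infinitesimal dilation, shifted by `lam`. -/
def dilation (lam : ℂ) : MvPolynomial (Fin n) ℂ →ₗ[ℂ] MvPolynomial (Fin n) ℂ :=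
  ∑ i, LinearMap.mulLeft ℂ (X i) ∘ₗ (pderiv i).toLinearMap + LinearMap.mulLeft ℂ (C lam)

theorem dilation_apply (lam : ℂ) (p : MvPolynomial (Fin n) ℂ) :
    dilation lam p = ∑ i, X i * pderiv i p + C lam * p := by
  simp [dilation]

/-- The infinitesimal inversions `|x|² ∂ⱼ - 2 xⱼ (E + lam)`. -/
def inversionOp (lam : ℂ) (j : Fin n) : MvPolynomial (Fin n) ℂ →ₗ[ℂ] MvPolynomial (Fin n) ℂ :=
  LinearMap.mulLeft ℂ (sqNorm n) ∘ₗ (pderiv j).toLinearMap -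
    LinearMap.mulLeft ℂ (2 * X j) ∘ₗ dilation lam

theorem inversionOp_apply (lam : ℂ) (j : Fin n) (p : MvPolynomial (Fin n) ℂ) :
    inversionOp lam j p = sqNorm n * pderiv j p - 2 * X j * dilation lam p := rfl

theorem conformalField_apply (α : ℂ) (Y : Matrix (Fin n) (Fin n) ℂ) (c e : Fin n → ℂ)
    (p : MvPolynomial (Fin n) ℂ) : conformalField α Y c e p =
      ∑ i, (C α * X i - linForm (Y i) + C (2⁻¹ * c i) + C (2⁻¹ * e i) * sqNorm n -
        linForm e * X i) * pderiv i p := by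
  have h : ∀ f : Fin n → MvPolynomial (Fin n) ℂ,
      mkDerivation ℂ f = ∑ i, f i • (pderiv i : Derivation ℂ _ (MvPolynomial (Fin n) ℂ)) := by
    intro f
    apply MvPolynomial.derivation_ext
    intro k
    rw [mkDerivation_X, ← Derivation.coeFnAddMonoidHom_apply, map_sum]
    simp [pderiv_X, Pi.single_apply]
  rw [conformalField, h, ← Derivation.coeFnAddMonoidHom_apply, map_sum]
  simp

/-- Sorts the operator into the Euler operator, rotations, translations and inversions, the pieces
for which harmonicity and adjoints are computed. -/
theorem conformalOp_eq (lam α : ℂ) (Y : Matrix (Fin n) (Fin n) ℂ) (c e : Fin n → ℂ)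
    (p : MvPolynomial (Fin n) ℂ) : conformalOp lam α Y c e p =
      α • dilation lam p - ∑ i, linForm (Y i) * pderiv i p +
        (2⁻¹ : ℂ) • ∑ i, (c i • pderiv i p + e i • inversionOp lam i p) := by
  have h2 : (2 : MvPolynomial (Fin n) ℂ) * C 2⁻¹ = 1 := by
    rw [← map_ofNat C, ← map_mul]; simp
  have h3 : ∑ i, e i • inversionOp lam i p = sqNorm n * ∑ i, C (e i) * pderiv i p -
      2 * linForm e * dilation lam p := by
    simp only [inversionOp_apply, linForm, smul_eq_C_mul, Finset.mul_sum, Finset.sum_mul,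
      ← Finset.sum_sub_distrib]
    refine Finset.sum_congr rfl fun i _ => ?_
    ring
  have h4 : ∑ i, (C α * X i - linForm (Y i) + C (2⁻¹ * c i) + C (2⁻¹ * e i) * sqNorm n -
        linForm e * X i) * pderiv i p = C α * ∑ i, X i * pderiv i p -
      ∑ i, linForm (Y i) * pderiv i p + C 2⁻¹ * ∑ i, C (c i) * pderiv i p +
      C 2⁻¹ * (sqNorm n * ∑ i, C (e i) * pderiv i p) - linForm e * ∑ i, X i * pderiv i p := by
    simp only [Finset.mul_sum, ← Finset.sum_sub_distrib, ← Finset.sum_add_distrib, map_mul]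
    refine Finset.sum_congr rfl fun i _ => ?_
    ring
  rw [conformalOp_apply, conformalField_apply, h4, Finset.sum_add_distrib, h3, dilation_apply]
  simp only [smul_eq_C_mul, map_mul]
  linear_combination (linForm e * (∑ i, X i * pderiv i p + C lam * p)) * h2

theorem conformalOp_smul (lam r α : ℂ) (Y : Matrix (Fin n) (Fin n) ℂ) (c e : Fin n → ℂ)
    (p : MvPolynomial (Fin n) ℂ) :
    conformalOp lam (r * α) (r • Y) (r • c) (r • e) p = r • conformalOp lam α Y c e p := by
  have h : ∀ i, linForm ((r • Y) i) = C r * linForm (Y i) := fun i => linForm_smul r (Y i)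
  simp only [conformalOp_eq, h, Pi.smul_apply, smul_eq_mul, mul_smul, smul_add, smul_sub,
    Finset.smul_sum, ← smul_eq_C_mul, smul_mul_assoc, smul_comm (2⁻¹ : ℂ) r]

/-- The action of an element of `𝔰𝔬(2, n)` on polynomials by a conformal vector field. -/
def conformalGen (lam : ℂ) (A : so2 n) : Module.End ℂ (MvPolynomial (Fin n) ℂ) :=
  conformalOp lam (-(Complex.I * so2Coord A)) ((rotCoord A).map Complex.ofReal)
    (boostCoord A) (star (boostCoord A))

theorem conformalGen_apply (lam : ℂ) (A : so2 n) (p : MvPolynomial (Fin n) ℂ) :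
    conformalGen lam A p = -(Complex.I * so2Coord A) • dilation lam p + rotation (rotCoord A) p +
      (2⁻¹ : ℂ) • ∑ i, (boostCoord A i • pderiv i p +
        starRingEnd ℂ (boostCoord A i) • inversionOp lam i p) := by
  rw [conformalGen, conformalOp_eq, rotation_apply, ← sub_eq_add_neg]
  rfl

theorem conformalGen_add (lam : ℂ) (A A' : so2 n) :
    conformalGen lam (A + A') = conformalGen lam A + conformalGen lam A' := by
  refine LinearMap.ext fun p => ?_
  simp only [LinearMap.add_apply, conformalGen_apply, so2Coord_add, rotCoord_add, boostCoord_add,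
    rotation_apply, Matrix.add_apply, Pi.add_apply, Complex.ofReal_add,
    map_add, add_mul, Finset.sum_add_distrib, add_smul, smul_add, mul_add, neg_add]
  abel

theorem conformalGen_smul (lam : ℂ) (r : ℝ) (A : so2 n) :
    conformalGen lam (r • A) = (r : ℂ) • conformalGen lam A := by
  refine LinearMap.ext fun p => ?_
  have h : (rotCoord (r • A)).map Complex.ofReal =
      (r : ℂ) • (rotCoord A).map Complex.ofReal := by
    ext i k; simp [rotCoord_smul]
  have h' : star (boostCoord (r • A)) = (r : ℂ) • star (boostCoord A) := by
    rw [boostCoord_smul, star_smul, Complex.star_def, Complex.conj_ofReal]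
  rw [LinearMap.smul_apply, conformalGen, conformalGen, ← conformalOp_smul, h, h', boostCoord_smul,
    so2Coord_smul]
  congr 2
  push_cast
  ring

/-- The element with coordinates (a, c, Y) is sent to the conformal operator with dilation part -ia,
translation part c and inversion part c̄. The coordinate formulas for the bracket in 𝔰𝔬(2,n) then
match those of `conformalOp_lie`. -/
theorem conformalGen_lie (lam : ℂ) (A A' : so2 n) :
    conformalGen lam ⁅A, A'⁆ = ⁅conformalGen lam A, conformalGen lam A'⁆ := by
  have hskew : ∀ A : so2 n, ∀ i j, (rotCoord A).map Complex.ofReal i j =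
      -(rotCoord A).map Complex.ofReal j i := by
    intro A i j
    rw [Matrix.map_apply, Matrix.map_apply, ← Complex.ofReal_neg]
    exact congrArg _ ((so2_entries A).2.2.2.2 i j)
  rw [conformalGen, conformalGen, conformalGen, conformalOp_lie lam (hskew A) (hskew A')]
  have hb : ∀ i, boostCoord ⁅A, A'⁆ i = (-(-(Complex.I * so2Coord A)) • boostCoord A' +
      (-(Complex.I * so2Coord A')) • boostCoord A +
      boostCoord A ᵥ* (rotCoord A').map Complex.ofReal -
      boostCoord A' ᵥ* (rotCoord A).map Complex.ofReal) i := by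
    intro i
    rw [boostCoord_lie, Finset.sum_sub_distrib]
    simp only [Pi.add_apply, Pi.sub_apply, Pi.smul_apply, smul_eq_mul, Matrix.vecMul, dotProduct,
      Matrix.map_apply]
    ring
  congr 1
  · rw [so2Coord_lie, dotProduct, dotProduct, ← Finset.sum_sub_distrib, ← mul_assoc, ← neg_mul]
    congr 1
    linear_combination (-2⁻¹ : ℂ) * Complex.I_mul_I
  · ext i k
    refine (rotCoord_lie A A' i k).trans ?_
    rw [bracketRot, Matrix.of_apply, Ring.lie_def, Matrix.sub_apply, Matrix.sub_apply,
      Matrix.mul_apply, Matrix.mul_apply, Matrix.mul_apply, Matrix.mul_apply]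
    simp
  · ext i
    exact hb i
  · ext i
    rw [Pi.star_apply, hb]
    simp only [Pi.add_apply, Pi.sub_apply, Pi.smul_apply, smul_eq_mul, Matrix.vecMul, dotProduct,
      Matrix.map_apply, Complex.star_def, map_add, map_sub, map_mul, map_neg, map_sum,
      Complex.conj_I, Complex.conj_ofReal, Pi.star_apply]
    ring

end Conformal

/-! ### The Fischer form -/

section Fischer

open MvPolynomial

variable {n : ℕ}

/-- The operator multiplying the component of degree `d` by `f d`. -/
def degreeOp (f : ℕ → ℂ) : MvPolynomial (Fin n) ℂ →ₗ[ℂ] MvPolynomial (Fin n) ℂ :=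
  (basisMonomials (Fin n) ℂ).constr ℂ fun s => monomial s (f s.degree)

theorem degreeOp_monomial (f : ℕ → ℂ) (s : Fin n →₀ ℕ) (a : ℂ) :
    degreeOp f (monomial s a) = monomial s (f s.degree * a) := by
  have h : (monomial s a : MvPolynomial (Fin n) ℂ) = a • basisMonomials (Fin n) ℂ s := by
    rw [coe_basisMonomials, smul_monomial, smul_eq_mul, mul_one]
  rw [h, map_smul, degreeOp, Module.Basis.constr_basis, smul_monomial, smul_eq_mul, mul_comm]

theorem coeff_degreeOp (f : ℕ → ℂ) (s : Fin n →₀ ℕ) (p : MvPolynomial (Fin n) ℂ) :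
    coeff s (degreeOp f p) = f s.degree * coeff s p := by
  induction p using MvPolynomial.induction_on' with
  | monomial t a =>
    rw [degreeOp_monomial, coeff_monomial, coeff_monomial]
    split_ifs with h
    · rw [h]
    · rw [mul_zero]
  | add p q hp hq => rw [map_add, coeff_add, coeff_add, hp, hq, mul_add]

theorem degreeOp_X_mul (f : ℕ → ℂ) (i : Fin n) (p : MvPolynomial (Fin n) ℂ) :
    degreeOp f (X i * p) = X i * degreeOp (fun d => f (d + 1)) p := by
  induction p using MvPolynomial.induction_on' with
  | monomial t a =>
    rw [degreeOp_monomial, X, monomial_mul, degreeOp_monomial, monomial_mul]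
    simp [add_comm]
  | add p q hp hq => rw [mul_add, map_add, hp, hq, map_add, mul_add]

theorem pderiv_degreeOp (f : ℕ → ℂ) (i : Fin n) (p : MvPolynomial (Fin n) ℂ) :
    pderiv i (degreeOp f p) = degreeOp (fun d => f (d + 1)) (pderiv i p) := by
  ext s
  rw [coeff_pderiv, coeff_degreeOp, coeff_degreeOp, coeff_pderiv, map_add,
    Finsupp.degree_single]
  ring

theorem degreeOp_degreeOp (f g : ℕ → ℂ) (p : MvPolynomial (Fin n) ℂ) :
    degreeOp f (degreeOp g p) = degreeOp (fun d => f d * g d) p := by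
  ext s
  simp only [coeff_degreeOp, mul_assoc]

theorem dilation_eq (lam : ℂ) (p : MvPolynomial (Fin n) ℂ) :
    dilation lam p = degreeOp (fun d => d + lam) p := by
  induction p using MvPolynomial.induction_on' with
  | monomial t a =>
    rw [dilation_apply, degreeOp_monomial, C_mul_monomial]
    simp only [X_mul_pderiv_monomial]
    rw [← Finset.sum_smul, add_mul, map_add, Finsupp.degree_eq_sum, ← Nat.cast_smul_eq_nsmul ℂ,
      smul_monomial, smul_eq_mul]
  | add p q hp hq => rw [map_add, hp, hq, map_add]

/-- The product of the factorials of the exponents. -/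
def multiFactorial (s : Fin n →₀ ℕ) : ℝ := ∏ i, ((s i).factorial : ℝ)

theorem multiFactorial_pos (s : Fin n →₀ ℕ) : 0 < multiFactorial s :=
  Finset.prod_pos fun i _ => by exact_mod_cast (s i).factorial_pos

theorem multiFactorial_add_single (s : Fin n →₀ ℕ) (i : Fin n) :
    multiFactorial (s + Finsupp.single i 1) = (s i + 1) * multiFactorial s := by
  rw [multiFactorial, multiFactorial, ← Finset.mul_prod_erase _ _ (Finset.mem_univ i),
    ← Finset.mul_prod_erase Finset.univ (fun i => ((s i).factorial : ℝ)) (Finset.mem_univ i),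
    ← mul_assoc]
  congr 1
  · simp [Nat.factorial_succ]
  · refine Finset.prod_congr rfl fun k hk => ?_
    rw [Finsupp.add_apply, Finsupp.single_eq_of_ne (Finset.ne_of_mem_erase hk), add_zero]

/-- The Fischer form on polynomials. -/
def fischer (p q : MvPolynomial (Fin n) ℂ) : ℂ :=
  (basisMonomials (Fin n) ℂ).constr ℂ
    (fun s => starRingEnd ℂ (coeff s p) * (multiFactorial s : ℂ)) q

theorem fischer_add_right (p q q' : MvPolynomial (Fin n) ℂ) :
    fischer p (q + q') = fischer p q + fischer p q' := map_add _ _ _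

theorem fischer_smul_right (a : ℂ) (p q : MvPolynomial (Fin n) ℂ) :
    fischer p (a • q) = a * fischer p q := map_smul _ _ _

theorem fischer_sum_right {ι : Type*} (S : Finset ι) (p : MvPolynomial (Fin n) ℂ)
    (q : ι → MvPolynomial (Fin n) ℂ) : fischer p (∑ i ∈ S, q i) = ∑ i ∈ S, fischer p (q i) :=
  map_sum _ _ _

theorem fischer_monomial_right (p : MvPolynomial (Fin n) ℂ) (s : Fin n →₀ ℕ) (a : ℂ) :
    fischer p (monomial s a) = starRingEnd ℂ (coeff s p) * (multiFactorial s : ℂ) * a := by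
  have h : (monomial s a : MvPolynomial (Fin n) ℂ) = a • basisMonomials (Fin n) ℂ s := by
    rw [coe_basisMonomials, smul_monomial, smul_eq_mul, mul_one]
  rw [h, fischer_smul_right, fischer, Module.Basis.constr_basis, mul_comm]

theorem fischer_add_left (p p' q : MvPolynomial (Fin n) ℂ) :
    fischer (p + p') q = fischer p q + fischer p' q := by
  induction q using MvPolynomial.induction_on' with
  | monomial t a => simp only [fischer_monomial_right, coeff_add, map_add, add_mul]
  | add q r hq hr => simp only [fischer_add_right, hq, hr]; ring

theorem fischer_smul_left (a : ℂ) (p q : MvPolynomial (Fin n) ℂ) :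
    fischer (a • p) q = starRingEnd ℂ a * fischer p q := by
  induction q using MvPolynomial.induction_on' with
  | monomial t b => simp only [fischer_monomial_right, coeff_smul, smul_eq_mul, map_mul]; ring
  | add q r hq hr => simp only [fischer_add_right, hq, hr]; ring

theorem fischer_conj (p q : MvPolynomial (Fin n) ℂ) :
    starRingEnd ℂ (fischer q p) = fischer p q := by
  induction q using MvPolynomial.induction_on' with
  | monomial t b =>
    induction p using MvPolynomial.induction_on' with
    | monomial s a =>
      rw [fischer_monomial_right, fischer_monomial_right, coeff_monomial, coeff_monomial]
      by_cases h : t = s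
      · subst h
        simp only [if_true, map_mul, Complex.conj_conj, Complex.conj_ofReal]
        ring
      · rw [if_neg h, if_neg (Ne.symm h)]
        simp
    | add p q hp hq => rw [fischer_add_right, map_add, hp, hq, fischer_add_left]
  | add q r hq hr => rw [fischer_add_left, map_add, hq, hr, fischer_add_right]

theorem fischer_eq_sum (p q : MvPolynomial (Fin n) ℂ) :
    fischer p q = ∑ s ∈ q.support,
      starRingEnd ℂ (coeff s p) * (multiFactorial s : ℂ) * coeff s q := by
  conv_lhs => rw [q.as_sum, fischer_sum_right]
  exact Finset.sum_congr rfl fun s _ => fischer_monomial_right _ _ _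

/-- Multiplication by xᵢ is adjoint to ∂ᵢ because (s + eᵢ)! = (sᵢ + 1) s!. -/
theorem fischer_X_mul_right (i : Fin n) (p q : MvPolynomial (Fin n) ℂ) :
    fischer p (X i * q) = fischer (pderiv i p) q := by
  induction q using MvPolynomial.induction_on' with
  | monomial t b =>
    rw [X, monomial_mul, fischer_monomial_right, fischer_monomial_right, coeff_pderiv, add_comm _ t,
      multiFactorial_add_single, map_mul]
    simp only [map_add, map_natCast, map_one]
    push_cast
    ring
  | add q r hq hr => rw [mul_add, fischer_add_right, hq, hr, fischer_add_right]

theorem fischer_X_mul_left (i : Fin n) (p q : MvPolynomial (Fin n) ℂ) :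
    fischer (X i * p) q = fischer p (pderiv i q) := by
  rw [← fischer_conj, fischer_X_mul_right, fischer_conj]

theorem fischer_degreeOp_left (f : ℕ → ℝ) (p q : MvPolynomial (Fin n) ℂ) :
    fischer (degreeOp (fun d => f d) p) q = fischer p (degreeOp (fun d => f d) q) := by
  induction q using MvPolynomial.induction_on' with
  | monomial t b =>
    rw [degreeOp_monomial, fischer_monomial_right, fischer_monomial_right, coeff_degreeOp, map_mul,
      Complex.conj_ofReal]
    ring
  | add q r hq hr => rw [map_add, fischer_add_right, hq, hr, fischer_add_right]

/-- Consequently harmonic polynomials are orthogonal to all multiples of |x|². -/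
theorem fischer_sqNorm_mul (p q : MvPolynomial (Fin n) ℂ) :
    fischer p (sqNorm n * q) = fischer (laplacian n p) q := by
  rw [sqNorm, Finset.sum_mul, fischer_sum_right, laplacian_apply]
  conv_rhs => rw [← fischer_conj, fischer_sum_right, map_sum]
  refine Finset.sum_congr rfl fun i _ => ?_
  rw [mul_assoc, fischer_X_mul_right, fischer_X_mul_right, fischer_conj]

/-! ### The Fischer form rescaled by degree -/

/-- The weights of the invariant inner product, relative to the Fischer form. -/
def ladderWeight (lam : ℝ) : ℕ → ℝ
  | 0 => 1
  | d + 1 => ladderWeight lam d / (2 * (d + lam))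

theorem ladderWeight_pos {lam : ℝ} (h : 0 < lam) (d : ℕ) : 0 < ladderWeight lam d := by
  induction d with
  | zero => exact one_pos
  | succ d ih => rw [ladderWeight]; positivity

theorem ladderWeight_succ {lam : ℝ} (h : 0 < lam) (d : ℕ) :
    ladderWeight lam (d + 1) * (2 * (d + lam)) = ladderWeight lam d := by
  rw [ladderWeight, div_mul_cancel₀]
  positivity

/-- The form on polynomials that is invariant on harmonic polynomials. -/
def ladderForm (lam : ℝ) (p q : MvPolynomial (Fin n) ℂ) : ℂ :=
  fischer p (degreeOp (fun d => (ladderWeight lam d : ℂ)) q)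

theorem ladderForm_conj (lam : ℝ) (p q : MvPolynomial (Fin n) ℂ) :
    starRingEnd ℂ (ladderForm lam q p) = ladderForm lam p q := by
  rw [ladderForm, fischer_conj, fischer_degreeOp_left]
  rfl

theorem ladderForm_self (lam : ℝ) (p : MvPolynomial (Fin n) ℂ) :
    ladderForm lam p p = ((∑ s ∈ p.support,
      ladderWeight lam s.degree * multiFactorial s * Complex.normSq (coeff s p) : ℝ) : ℂ) := by
  have hsub : (degreeOp (fun d => (ladderWeight lam d : ℂ)) p).support ⊆ p.support := by
    intro s hs
    rw [mem_support_iff, coeff_degreeOp] at hs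
    exact mem_support_iff.2 (right_ne_zero_of_mul hs)
  rw [ladderForm, fischer_eq_sum, Complex.ofReal_sum, Finset.sum_subset hsub]
  · refine Finset.sum_congr rfl fun s _ => ?_
    rw [coeff_degreeOp, Complex.ofReal_mul, Complex.ofReal_mul, Complex.normSq_eq_conj_mul_self]
    ring
  · intro s _ hs
    rw [notMem_support_iff.1 hs, mul_zero]

/-- The inner product on polynomials that is invariant on harmonic polynomials. -/
@[reducible] def ladderCore (lam : ℝ) (h : 0 < lam) :
    InnerProductSpace.Core ℂ (MvPolynomial (Fin n) ℂ) where
  inner := ladderForm lam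
  conj_inner_symm p q := ladderForm_conj lam p q
  re_inner_nonneg p := by
    change 0 ≤ (ladderForm lam p p).re
    rw [ladderForm_self, Complex.ofReal_re]
    exact Finset.sum_nonneg fun s _ => mul_nonneg
      (mul_nonneg (ladderWeight_pos h _).le (multiFactorial_pos s).le) (Complex.normSq_nonneg _)
  add_left p q r := fischer_add_left _ _ _
  smul_left p q a := fischer_smul_left _ _ _
  definite p hp := by
    have h0 : ladderForm lam p p = 0 := hp
    rw [ladderForm_self, Complex.ofReal_eq_zero, Finset.sum_eq_zero_iff_of_nonneg
      fun s _ => mul_nonneg (mul_nonneg (ladderWeight_pos h _).le (multiFactorial_pos s).le)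
        (Complex.normSq_nonneg _)] at h0
    by_contra hne
    obtain ⟨s, hs⟩ := support_nonempty.2 hne
    have := h0 s hs
    rw [mul_eq_zero, Complex.normSq_eq_zero] at this
    rcases this with h1 | h1
    · exact (mul_pos (ladderWeight_pos h _) (multiFactorial_pos s)).ne' h1
    · exact mem_support_iff.1 hs h1

theorem ladderForm_dilation (lam : ℝ) (p q : MvPolynomial (Fin n) ℂ) :
    ladderForm lam (dilation lam p) q = ladderForm lam p (dilation lam q) := by
  have h : (fun d : ℕ => (d : ℂ) + lam) = fun d : ℕ => (((d : ℝ) + lam : ℝ) : ℂ) := by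
    ext d; push_cast; rfl
  rw [dilation_eq, dilation_eq, ladderForm, h, fischer_degreeOp_left, ladderForm, degreeOp_degreeOp,
    degreeOp_degreeOp]
  simp only [mul_comm]

/-- For harmonic p the |x|²∂ᵢ part of Kᵢ contributes nothing. In -2xᵢ(E + λ) the factor 2(d + λ) is
cancelled by the ratio of consecutive weights, and xᵢ is Fischer adjoint to ∂ᵢ; this is the
recursion defining `ladderWeight`. -/
theorem ladderForm_pderiv {lam : ℝ} (h : 0 < lam) (i : Fin n) {p : MvPolynomial (Fin n) ℂ}
    (hp : laplacian n p = 0) (q : MvPolynomial (Fin n) ℂ) :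
    ladderForm lam (pderiv i p) q = -ladderForm lam p (inversionOp lam i q) := by
  have h1 : ladderForm lam p (sqNorm n * pderiv i q) = 0 := by
    have : degreeOp (fun d => (ladderWeight lam d : ℂ)) (sqNorm n * pderiv i q) =
        sqNorm n * degreeOp (fun d => (ladderWeight lam (d + 1 + 1) : ℂ)) (pderiv i q) := by
      rw [sqNorm, Finset.sum_mul, map_sum, Finset.sum_mul]
      refine Finset.sum_congr rfl fun k _ => ?_
      rw [mul_assoc, degreeOp_X_mul, degreeOp_X_mul, mul_assoc]
    rw [ladderForm, this, fischer_sqNorm_mul, hp, ← zero_smul ℂ (0 : MvPolynomial (Fin n) ℂ),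
      fischer_smul_left, map_zero, zero_mul]
  have h2 : ladderForm lam p (X i * dilation lam q) = 2⁻¹ * ladderForm lam (pderiv i p) q := by
    rw [ladderForm, degreeOp_X_mul, fischer_X_mul_right, dilation_eq, degreeOp_degreeOp, ladderForm,
      ← fischer_smul_right]
    congr 1
    ext s
    rw [coeff_degreeOp, coeff_smul, coeff_degreeOp, smul_eq_mul,
      ← ladderWeight_succ h s.degree]
    push_cast
    ring
  have h3 : inversionOp lam i q = sqNorm n * pderiv i q + (-2 : ℂ) • (X i * dilation lam q) := by
    rw [inversionOp_apply, smul_eq_C_mul, map_neg, map_ofNat]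
    ring
  have h4 : ladderForm lam p (inversionOp lam i q) = ladderForm lam p (sqNorm n * pderiv i q) +
      (-2) * ladderForm lam p (X i * dilation lam q) := by
    rw [h3, ladderForm, map_add, fischer_add_right, map_smul, fischer_smul_right]
    rfl
  rw [h4, h1, h2]
  ring

theorem ladderForm_X_mul_pderiv (lam : ℝ) (i k : Fin n) (p q : MvPolynomial (Fin n) ℂ) :
    ladderForm lam (X k * pderiv i p) q = ladderForm lam p (X i * pderiv k q) := by
  rw [ladderForm, fischer_X_mul_left, ← fischer_X_mul_right, pderiv_degreeOp, ladderForm,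
    degreeOp_X_mul]

/-- The adjoint of xₖ∂ᵢ is xᵢ∂ₖ, also after rescaling since both preserve the degree; skewness of Y
supplies the sign. -/
theorem ladderForm_rotation (lam : ℝ) (Y : so n) (p q : MvPolynomial (Fin n) ℂ) :
    ladderForm lam (rotation Y.1 p) q = -ladderForm lam p (rotation Y.1 q) := by
  have hY : ∀ i j, Y.1 i j = -Y.1 j i := by
    intro i j
    have h := (LieAlgebra.Orthogonal.mem_so _ _ _).1 Y.2
    exact congrFun (congrFun h j) i
  have hrot : ∀ p : MvPolynomial (Fin n) ℂ,
      rotation Y.1 p = ∑ i, ∑ k, (-(Y.1 i k) : ℂ) • (X k * pderiv i p) := by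
    intro p
    rw [rotation_apply, ← Finset.sum_neg_distrib]
    refine Finset.sum_congr rfl fun i _ => ?_
    rw [Finset.sum_mul, ← Finset.sum_neg_distrib]
    refine Finset.sum_congr rfl fun k _ => ?_
    rw [smul_eq_C_mul, map_neg]
    ring
  have hr : ladderForm lam p (rotation Y.1 q) =
      ∑ i, ∑ k, (-(Y.1 i k) : ℂ) * ladderForm lam p (X k * pderiv i q) := by
    rw [hrot, ladderForm, map_sum, fischer_sum_right]
    refine Finset.sum_congr rfl fun i _ => ?_
    rw [map_sum, fischer_sum_right]
    refine Finset.sum_congr rfl fun k _ => ?_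
    rw [map_smul, fischer_smul_right]
    rfl
  have hl : ladderForm lam (rotation Y.1 p) q =
      ∑ i, ∑ k, (-(Y.1 i k) : ℂ) * ladderForm lam (X k * pderiv i p) q := by
    rw [← ladderForm_conj, hrot, ladderForm, map_sum, fischer_sum_right, map_sum]
    refine Finset.sum_congr rfl fun i _ => ?_
    rw [map_sum, fischer_sum_right, map_sum]
    refine Finset.sum_congr rfl fun k _ => ?_
    rw [map_smul, fischer_smul_right, map_mul, ← Complex.ofReal_neg, Complex.conj_ofReal,
      ← ladderForm_conj lam (X k * pderiv i p)]
    rfl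
  rw [hl, hr, Finset.sum_comm, ← Finset.sum_neg_distrib]
  refine Finset.sum_congr rfl fun i _ => ?_
  rw [← Finset.sum_neg_distrib]
  refine Finset.sum_congr rfl fun k _ => ?_
  rw [ladderForm_X_mul_pderiv, hY k i]
  push_cast
  ring

end Fischer

/-! ### The minimal representation on harmonic polynomials -/

theorem exists_orthogonal_decomposition {M : Type*} [AddCommGroup M] [Module ℂ M]
    (B : InnerProductSpace.Core ℂ M) (S : Submodule ℂ M) [FiniteDimensional ℂ S] (u : M) :
    ∃ w ∈ S, ∀ s ∈ S, coreForm B (u - w) s = 0 := by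
  let : NormedAddCommGroup M := B.toNormedAddCommGroup
  let : InnerProductSpace ℂ M := InnerProductSpace.ofCore B.toCore
  refine ⟨S.starProjection u, Submodule.starProjection_apply_mem _ _, fun s hs => ?_⟩
  exact Submodule.starProjection_inner_eq_zero u s hs

section Harmonic

open MvPolynomial

variable {n : ℕ}

theorem totalDegree_le_iff_degree {p : MvPolynomial (Fin n) ℂ} {d : ℕ} :
    p.totalDegree ≤ d ↔ ∀ s, coeff s p ≠ 0 → s.degree ≤ d := by
  rw [totalDegree, Finset.sup_le_iff]
  exact forall_congr' fun s => by rw [mem_support_iff]; rfl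

theorem totalDegree_pderiv_lt (i : Fin n) (p : MvPolynomial (Fin n) ℂ) :
    pderiv i p = 0 ∨ (pderiv i p).totalDegree < p.totalDegree := by
  by_cases h : p.totalDegree = 0
  · left
    rw [totalDegree_eq_zero_iff_eq_C.1 h, pderiv_C]
  · right
    refine Nat.lt_of_le_pred (Nat.pos_of_ne_zero h) (totalDegree_le_iff_degree.2 fun s hs => ?_)
    rw [coeff_pderiv] at hs
    have := totalDegree_le_iff_degree.1 (le_refl p.totalDegree) _ (left_ne_zero_of_mul hs)
    rw [map_add, Finsupp.degree_single] at this
    exact Nat.le_pred_of_lt this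

theorem totalDegree_degreeOp_le (f : ℕ → ℂ) (p : MvPolynomial (Fin n) ℂ) :
    (degreeOp f p).totalDegree ≤ p.totalDegree :=
  totalDegree_le_iff_degree.2 fun s hs => totalDegree_le_iff_degree.1 le_rfl s
    (right_ne_zero_of_mul (by rwa [coeff_degreeOp] at hs))

theorem totalDegree_dilation_le (lam : ℂ) (p : MvPolynomial (Fin n) ℂ) :
    (dilation lam p).totalDegree ≤ p.totalDegree := by
  rw [dilation_eq]
  exact totalDegree_degreeOp_le _ _

theorem totalDegree_mul_pderiv_le {r : MvPolynomial (Fin n) ℂ} {a : ℕ}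
    (hr : r.totalDegree ≤ a + 1) (i : Fin n) (p : MvPolynomial (Fin n) ℂ) :
    (r * pderiv i p).totalDegree ≤ p.totalDegree + a := by
  rcases totalDegree_pderiv_lt i p with h | h
  · rw [h, mul_zero, totalDegree_zero]
    exact Nat.zero_le _
  · refine (totalDegree_mul _ _).trans ?_
    omega

theorem totalDegree_rotation_le (Y : Matrix (Fin n) (Fin n) ℝ) (p : MvPolynomial (Fin n) ℂ) :
    (rotation Y p).totalDegree ≤ p.totalDegree := by
  rw [rotation_apply, totalDegree_neg]
  refine totalDegree_finsetSum_le fun i _ => totalDegree_mul_pderiv_le (a := 0) ?_ i p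
  refine totalDegree_finsetSum_le fun k _ => (totalDegree_mul _ _).trans ?_
  rw [totalDegree_C, totalDegree_X]

theorem totalDegree_inversionOp_le (lam : ℂ) (i : Fin n) (p : MvPolynomial (Fin n) ℂ) :
    (inversionOp lam i p).totalDegree ≤ p.totalDegree + 1 := by
  rw [inversionOp_apply]
  refine (totalDegree_sub _ _).trans (max_le (totalDegree_mul_pderiv_le ?_ i p) ?_)
  · refine totalDegree_finsetSum_le fun k _ => (totalDegree_mul _ _).trans ?_
    rw [totalDegree_X]
  · refine (totalDegree_mul _ _).trans ?_
    have h1 : (2 * X i : MvPolynomial (Fin n) ℂ).totalDegree ≤ 1 := by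
      rw [← map_ofNat (C : ℂ →+* MvPolynomial (Fin n) ℂ)]
      refine (totalDegree_mul _ _).trans ?_
      rw [totalDegree_C, totalDegree_X]
    have h2 := totalDegree_dilation_le lam p
    omega

theorem laplacian_pderiv (i : Fin n) (p : MvPolynomial (Fin n) ℂ) :
    laplacian n (pderiv i p) = pderiv i (laplacian n p) := by
  rw [laplacian_apply, laplacian_apply, map_sum]
  exact Finset.sum_congr rfl fun k _ => by rw [pderiv_comm k i, pderiv_comm k i]

theorem laplacian_degreeOp (f : ℕ → ℂ) (p : MvPolynomial (Fin n) ℂ) :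
    laplacian n (degreeOp f p) = degreeOp (fun d => f (d + 1 + 1)) (laplacian n p) := by
  rw [laplacian_apply, laplacian_apply, map_sum]
  exact Finset.sum_congr rfl fun k _ => by rw [pderiv_degreeOp, pderiv_degreeOp]

theorem laplacian_X_mul (i : Fin n) (p : MvPolynomial (Fin n) ℂ) :
    laplacian n (X i * p) = 2 * pderiv i p + X i * laplacian n p := by
  have h : ∀ k, pderiv k (pderiv k (X i * p)) =
      (if k = i then 2 * pderiv k p else 0) + X i * pderiv k (pderiv k p) := by
    intro k
    rw [pderiv_mul, pderiv_X, Pi.single_apply, map_add, pderiv_mul, pderiv_mul, pderiv_X,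
      Pi.single_apply]
    by_cases hk : i = k
    · subst hk; simp; ring
    · simp [hk, Ne.symm hk]
  rw [laplacian_apply, Finset.sum_congr rfl fun k _ => h k, Finset.sum_add_distrib,
    laplacian_apply, Finset.mul_sum]
  simp

theorem laplacian_sqNorm_mul (p : MvPolynomial (Fin n) ℂ) :
    laplacian n (sqNorm n * p) = (2 * n : ℂ) • p + (4 : ℂ) • dilation 0 p +
      sqNorm n * laplacian n p := by
  have h : ∀ i, laplacian n (X i * X i * p) = 2 * p + 4 * (X i * pderiv i p) +
      X i * X i * laplacian n p := by
    intro i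
    rw [mul_assoc, laplacian_X_mul, laplacian_X_mul, pderiv_mul, pderiv_X_self]
    ring
  rw [sqNorm, Finset.sum_mul, map_sum, Finset.sum_congr rfl fun i _ => h i,
    Finset.sum_add_distrib, Finset.sum_add_distrib, ← Finset.mul_sum, Finset.sum_mul,
    dilation_apply, map_zero, zero_mul, add_zero]
  simp only [smul_eq_C_mul, map_mul, map_ofNat, map_natCast, Finset.sum_const, Finset.card_univ,
    Fintype.card_fin, nsmul_eq_mul, ← Finset.mul_sum, ← Finset.sum_mul]
  ring

theorem dilation_pderiv (lam : ℂ) (i : Fin n) (p : MvPolynomial (Fin n) ℂ) :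
    pderiv i (dilation lam p) = dilation 0 (pderiv i p) + (lam + 1) • pderiv i p := by
  rw [dilation_eq, dilation_eq, pderiv_degreeOp]
  ext s
  rw [coeff_add, coeff_smul, coeff_degreeOp, coeff_degreeOp, smul_eq_mul]
  push_cast
  ring

/-- The parameter `(n - 2) / 2`. -/
def minWeight (n : ℕ) : ℝ := ((n : ℝ) - 2) / 2

/-- For harmonic p one has Δ(|x|²∂ᵢp) = (2n + 4E)∂ᵢp and Δ(xᵢ(E + λ)p) = 2(E + λ + 1)∂ᵢp. Hence ΔKᵢp
= (2n - 4 - 4λ)∂ᵢp, which vanishes for λ = (n-2)/2. -/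
theorem laplacian_inversionOp (i : Fin n) {p : MvPolynomial (Fin n) ℂ} (hp : laplacian n p = 0) :
    laplacian n (inversionOp (minWeight n : ℂ) i p) = 0 := by
  have h2 : inversionOp (minWeight n : ℂ) i p = sqNorm n * pderiv i p +
      (-2 : ℂ) • (X i * dilation (minWeight n : ℂ) p) := by
    rw [inversionOp_apply, smul_eq_C_mul, map_neg, map_ofNat]
    ring
  have h3 : laplacian n (dilation (minWeight n : ℂ) p) = 0 := by
    rw [dilation_eq, laplacian_degreeOp, hp, map_zero]
  rw [h2, map_add, map_smul, laplacian_sqNorm_mul, laplacian_X_mul, h3, laplacian_pderiv, hp,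
    dilation_pderiv, map_zero, mul_zero, mul_zero, add_zero, add_zero]
  have h4 : (minWeight n : ℂ) = ((n : ℂ) - 2) / 2 := by rw [minWeight]; push_cast; rfl
  rw [h4]
  simp only [smul_eq_C_mul, map_mul, map_ofNat, map_natCast, map_add, map_sub, map_neg, map_one,
    div_eq_mul_inv]
  have h5 : (2 : MvPolynomial (Fin n) ℂ) * C 2⁻¹ = 1 := by
    rw [← map_ofNat C, ← map_mul]; simp
  linear_combination (-2 * (n - 2) * pderiv i p) * h5

theorem laplacian_conformalGen (A : so2 n) {p : MvPolynomial (Fin n) ℂ}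
    (hp : laplacian n p = 0) : laplacian n (conformalGen (minWeight n : ℂ) A p) = 0 := by
  have h1 : laplacian n (dilation (minWeight n : ℂ) p) = 0 := by
    rw [dilation_eq, laplacian_degreeOp, hp, map_zero]
  have h2 : laplacian n (rotation (rotCoord A) p) = 0 := by
    have := laplacian_rotation ⟨rotCoord A, rotCoord_mem A⟩ p
    rwa [hp, map_zero] at this
  rw [conformalGen_apply, map_add, map_add, map_smul, h1, h2, map_smul, map_sum]
  simp [laplacian_pderiv, hp, laplacian_inversionOp _ hp]

/-- The space of harmonic polynomials. -/
def HarmPoly (n : ℕ) : Type := LinearMap.ker (laplacian n)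

instance (n : ℕ) : AddCommGroup (HarmPoly n) :=
  inferInstanceAs (AddCommGroup (LinearMap.ker (laplacian n)))

instance (n : ℕ) : Module ℂ (HarmPoly n) :=
  inferInstanceAs (Module ℂ (LinearMap.ker (laplacian n)))

/-- The inclusion of harmonic polynomials into polynomials. -/
def harmIncl (n : ℕ) : HarmPoly n →ₗ[ℂ] MvPolynomial (Fin n) ℂ :=
  (LinearMap.ker (laplacian n)).subtype

theorem harmIncl_injective : Function.Injective (harmIncl n) := Subtype.val_injective

theorem laplacian_harmIncl (u : HarmPoly n) : laplacian n (harmIncl n u) = 0 := u.2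

theorem exists_harmIncl {p : MvPolynomial (Fin n) ℂ} (hp : laplacian n p = 0) :
    ∃ u : HarmPoly n, harmIncl n u = p := ⟨⟨p, hp⟩, rfl⟩

/-- The minimal representation of `𝔰𝔬(2, n)`, on harmonic polynomials. -/
def harmRep (n : ℕ) : so2 n →ₗ⁅ℝ⁆ Module.End ℂ (HarmPoly n) where
  toFun A := (conformalGen (minWeight n : ℂ) A).restrict (p := LinearMap.ker (laplacian n))
    (q := LinearMap.ker (laplacian n)) fun _ hp => laplacian_conformalGen A hp
  map_add' A A' := by
    refine LinearMap.ext fun p => Subtype.ext ?_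
    change conformalGen _ _ p.1 = conformalGen _ _ p.1 + conformalGen _ _ p.1
    rw [conformalGen_add, LinearMap.add_apply]
  map_smul' r A := by
    refine LinearMap.ext fun p => Subtype.ext ?_
    change conformalGen _ _ p.1 = (r : ℂ) • conformalGen _ _ p.1
    rw [conformalGen_smul, LinearMap.smul_apply]
  map_lie' {A A'} := by
    refine LinearMap.ext fun p => Subtype.ext ?_
    change conformalGen _ ⁅A, A'⁆ p.1 = _
    rw [conformalGen_lie]
    rfl

theorem harmIncl_harmRep (A : so2 n) (u : HarmPoly n) :
    harmIncl n (harmRep n A u) = conformalGen (minWeight n : ℂ) A (harmIncl n u) := rfl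

theorem minWeight_pos (hn : 3 ≤ n) : 0 < minWeight n := by
  have : (3 : ℝ) ≤ n := by exact_mod_cast hn
  unfold minWeight
  linarith

/-- The invariant inner product on harmonic polynomials. -/
@[reducible] def harmCore (n : ℕ) (hn : 3 ≤ n) : InnerProductSpace.Core ℂ (HarmPoly n) :=
  pullbackCore (ladderCore (minWeight n) (minWeight_pos hn)) (harmIncl n) harmIncl_injective

theorem coreForm_harmCore (hn : 3 ≤ n) (u v : HarmPoly n) :
    coreForm (harmCore n hn) u v =
      coreForm (ladderCore (minWeight n) (minWeight_pos hn)) (harmIncl n u) (harmIncl n v) := rfl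

theorem ladderCore_apply {lam : ℝ} (h : 0 < lam) (p q : MvPolynomial (Fin n) ℂ) :
    coreForm (ladderCore lam h) p q = ladderForm lam p q := rfl

/-- Dilation is self-adjoint and enters with an imaginary coefficient, rotations are skew, and cᵢ∂ᵢ
is paired with c̄ᵢKᵢ, where ∂ᵢ and -Kᵢ are adjoint. The two adjunctions use harmonicity of the first
and of the second argument respectively. -/
theorem harmRep_invariant (hn : 3 ≤ n) : IsInvariantInner (harmRep n) (harmCore n hn) := by
  intro A u v
  rw [← coreForm_apply, ← coreForm_apply, coreForm_harmCore, coreForm_harmCore, harmIncl_harmRep,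
    harmIncl_harmRep]
  have hu := laplacian_harmIncl u
  have hv := laplacian_harmIncl v
  generalize harmIncl n u = p at *
  generalize harmIncl n v = q at *
  have hpos := minWeight_pos hn
  have h1 : ∀ i, ladderForm (minWeight n) (pderiv i p) q =
      -ladderForm (minWeight n) p (inversionOp (minWeight n : ℂ) i q) :=
    fun i => ladderForm_pderiv hpos i hu q
  have h2 : ∀ i, ladderForm (minWeight n) (inversionOp (minWeight n : ℂ) i p) q =
      -ladderForm (minWeight n) p (pderiv i q) := by
    intro i
    rw [← ladderForm_conj, ← ladderForm_conj _ p, ladderForm_pderiv hpos i hv p, map_neg, neg_neg]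
  have h3 := ladderForm_rotation (minWeight n) ⟨rotCoord A, rotCoord_mem A⟩ p q
  have h4 := ladderForm_dilation (minWeight n) p q
  rw [conformalGen_apply, conformalGen_apply]
  simp only [map_add, map_sum, LinearMap.add_apply, LinearMap.map_smulₛₗ, LinearMap.smul_apply,
    LinearMap.sum_apply, ladderCore_apply, h1, h2, h3, h4, smul_eq_mul, Complex.conj_conj, map_neg,
    map_mul, Complex.conj_I, Complex.conj_ofReal, RingHom.id_apply, map_inv₀, map_ofNat]
  simp only [neg_add, neg_mul, mul_neg, Finset.sum_add_distrib, Finset.sum_neg_distrib, neg_neg]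
  ring

/-- Bracketing with Z₀ multiplies c by i and c̄ by -i, so the combination defining `raise` doubles
the derivatives and cancels the inversions; in `lower` the roles are exchanged. -/
theorem harmRep_raise {A : so2 n} (hA : ⁅Z0 n, ⁅Z0 n, A⁆⁆ = -A) (u : HarmPoly n) :
    harmIncl n (raise (Z0 n) (harmRep n) A u) =
      ∑ i, boostCoord A i • pderiv i (harmIncl n u) := by
  obtain ⟨h1, h2⟩ := Z0_lie_lie_eq_neg hA
  rw [raise, LinearMap.sub_apply, LinearMap.smul_apply, map_sub, map_smul, harmIncl_harmRep,
    harmIncl_harmRep, conformalGen_apply, conformalGen_apply, so2Coord_Z0_lie, rotCoord_Z0_lie,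
    boostCoord_Z0_lie, h1, h2]
  have h0 : rotation (0 : Matrix (Fin n) (Fin n) ℝ) (harmIncl n u) = 0 := by simp [rotation_apply]
  simp only [h0, Complex.ofReal_zero, mul_zero, neg_zero, zero_smul, zero_add, Finset.smul_sum,
    ← Finset.sum_sub_distrib, Pi.smul_apply, smul_eq_mul, map_mul, Complex.conj_I]
  refine Finset.sum_congr rfl fun i _ => ?_
  have hI : Complex.I * Complex.I = -1 := Complex.I_mul_I
  match_scalars
  · linear_combination (-2⁻¹ * boostCoord A i) * hI
  · linear_combination (2⁻¹ * starRingEnd ℂ (boostCoord A i)) * hI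

theorem harmRep_lower {A : so2 n} (hA : ⁅Z0 n, ⁅Z0 n, A⁆⁆ = -A) (u : HarmPoly n) :
    harmIncl n (lower (Z0 n) (harmRep n) A u) =
      ∑ i, starRingEnd ℂ (boostCoord A i) • inversionOp (minWeight n : ℂ) i (harmIncl n u) := by
  obtain ⟨h1, h2⟩ := Z0_lie_lie_eq_neg hA
  rw [lower, LinearMap.add_apply, LinearMap.smul_apply, map_add, map_smul, harmIncl_harmRep,
    harmIncl_harmRep, conformalGen_apply, conformalGen_apply, so2Coord_Z0_lie, rotCoord_Z0_lie,
    boostCoord_Z0_lie, h1, h2]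
  have h0 : rotation (0 : Matrix (Fin n) (Fin n) ℝ) (harmIncl n u) = 0 := by simp [rotation_apply]
  simp only [h0, Complex.ofReal_zero, mul_zero, neg_zero, zero_smul, zero_add, Finset.smul_sum,
    ← Finset.sum_add_distrib, Pi.smul_apply, smul_eq_mul, map_mul, Complex.conj_I]
  refine Finset.sum_congr rfl fun i _ => ?_
  have hI : Complex.I * Complex.I = -1 := Complex.I_mul_I
  match_scalars
  · linear_combination (2⁻¹ * boostCoord A i) * hI
  · linear_combination (-2⁻¹ * starRingEnd ℂ (boostCoord A i)) * hI

/-- A space of harmonic polynomials is everything if it is stable under the inversions in some of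
the variables and contains the harmonic polynomials that do not depend on these variables. -/
theorem harmonic_completeness (hn : 3 ≤ n) (J : Set (Fin n))
    (W : Submodule ℂ (MvPolynomial (Fin n) ℂ)) (hW : ∀ p ∈ W, laplacian n p = 0)
    (hK : ∀ i ∈ J, ∀ p ∈ W, inversionOp (minWeight n : ℂ) i p ∈ W)
    (hJ : ∀ p, laplacian n p = 0 → (∀ i ∈ J, pderiv i p = 0) → p ∈ W)
    {p : MvPolynomial (Fin n) ℂ} (hp : laplacian n p = 0) : p ∈ W := by
  induction hd : p.totalDegree using Nat.strong_induction_on generalizing p with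
  | _ d ih =>
  -- Truncating W at degree d makes it finite-dimensional, so that p can be projected orthogonally
  -- onto it without completeness of the whole space.
  let S : Submodule ℂ (MvPolynomial (Fin n) ℂ) := W ⊓ restrictTotalDegree (Fin n) ℂ d
  have : FiniteDimensional ℂ S := Submodule.finiteDimensional_of_le
    (S₂ := restrictTotalDegree (Fin n) ℂ d) inf_le_right
  have hpos := minWeight_pos hn
  obtain ⟨w, ⟨hwW, hwd⟩, hw⟩ :=
    exists_orthogonal_decomposition (ladderCore (minWeight n) hpos) S p
  have hdiff : laplacian n (p - w) = 0 := by rw [map_sub, hp, hW w hwW, sub_zero]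
  have hdeg : (p - w).totalDegree ≤ d :=
    (totalDegree_sub _ _).trans (max_le hd.le ((mem_restrictTotalDegree _ _ _).1 hwd))
  have hmem : p - w ∈ W := by
    refine hJ _ hdiff fun i hi => ?_
    rcases totalDegree_pderiv_lt i (p - w) with h | h
    · exact h
    · have h1 : pderiv i (p - w) ∈ W := ih _ (h.trans_le hdeg)
        (by rw [laplacian_pderiv, hdiff, map_zero]) rfl
      -- With q = p - w, ‖∂ᵢq‖² = -⟨q, Kᵢ∂ᵢq⟩. By induction ∂ᵢq is in W, and Kᵢ raises the degree by
      -- at most one, so Kᵢ∂ᵢq lies in S, to which q is orthogonal.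
      refine coreForm_definite (ladderCore (minWeight n) hpos) ?_
      rw [ladderCore_apply, ladderForm_pderiv hpos i hdiff, ← ladderCore_apply hpos, hw, neg_zero]
      refine ⟨hK i hi _ h1, (mem_restrictTotalDegree _ _ _).2 ?_⟩
      exact (totalDegree_inversionOp_le _ _ _).trans (by omega)
  have := W.add_mem hmem hwW
  rwa [sub_add_cancel] at this

end Harmonic

/-! ### Restriction to `𝔰𝔬(2, m)` -/

section Restriction

variable {m l : ℕ} {M : Type*} [AddCommGroup M] [Module ℂ M]

theorem leftIncl_apply (X : so2 m) : leftIncl m l X = blockIncl m l (X, 0) := rfl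

theorem so2Coord_leftIncl (X : so2 m) : so2Coord (leftIncl m l X) = so2Coord X :=
  so2Coord_blockIncl m l (X, 0)

theorem boostCoord_leftIncl_castAdd (X : so2 m) (i : Fin m) :
    boostCoord (leftIncl m l X) (Fin.castAdd l i) = boostCoord X i :=
  boostCoord_blockIncl_castAdd m l (X, 0) i

theorem boostCoord_leftIncl_natAdd (X : so2 m) (i : Fin l) :
    boostCoord (leftIncl m l X) (Fin.natAdd m i) = 0 :=
  boostCoord_blockIncl_natAdd m l (X, 0) i

theorem rotCoord_blockIncl_natAdd (Z : so2 m × so l) (i : Fin l) (k : Fin (m + l)) :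
    rotCoord (blockIncl m l Z) (Fin.natAdd m i) k =
      Fin.addCases (fun _ => 0) (fun k => Z.2.1 i k) k := by
  rw [rotCoord_blockIncl]
  refine Fin.addCases (fun k => ?_) (fun k => ?_) k <;> simp

theorem leftIncl_Z0 : leftIncl m l (Z0 m) = Z0 (m + l) := by
  refine so2_ext ?_ ?_ ?_
  · rw [so2Coord_leftIncl, so2Coord_Z0, so2Coord_Z0]
  · rw [boostCoord_Z0]
    ext i
    refine Fin.addCases (fun i => ?_) (fun i => ?_) i
    · rw [boostCoord_leftIncl_castAdd, boostCoord_Z0]; rfl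
    · rw [boostCoord_leftIncl_natAdd]; rfl
  · rw [leftIncl_apply, rotCoord_blockIncl, rotCoord_Z0, rotCoord_Z0]
    ext i k
    have h : Matrix.fromBlocks (0 : Matrix (Fin m) (Fin m) ℝ) 0 0
        ((0 : so l) : Matrix (Fin l) (Fin l) ℝ) = 0 := Matrix.fromBlocks_zero
    rw [h]
    rfl

theorem leftIncl_Z0_lie (X : so2 m) :
    leftIncl m l ⁅Z0 m, X⁆ = ⁅Z0 (m + l), leftIncl m l X⁆ := by
  rw [LieHom.map_lie, leftIncl_Z0]

theorem leftIncl_lie_lie {X : so2 m} (hX : ⁅Z0 m, ⁅Z0 m, X⁆⁆ = -X) :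
    ⁅Z0 (m + l), ⁅Z0 (m + l), leftIncl m l X⁆⁆ = -leftIncl m l X := by
  rw [← leftIncl_Z0_lie, ← leftIncl_Z0_lie, hX, map_neg]

theorem raise_leftIncl (π : so2 (m + l) →ₗ⁅ℝ⁆ Module.End ℂ M) (X : so2 m) :
    raise (Z0 m) (π.comp (leftIncl m l)) X = raise (Z0 (m + l)) π (leftIncl m l X) := by
  rw [raise, raise, LieHom.comp_apply, LieHom.comp_apply, leftIncl_Z0_lie]

theorem lower_leftIncl (π : so2 (m + l) →ₗ⁅ℝ⁆ Module.End ℂ M) (X : so2 m) :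
    lower (Z0 m) (π.comp (leftIncl m l)) X = lower (Z0 (m + l)) π (leftIncl m l X) := by
  rw [lower, lower, LieHom.comp_apply, LieHom.comp_apply, leftIncl_Z0_lie]

theorem IsHighestWeightVector.restrict {lam : ℝ} {π : so2 (m + l) →ₗ⁅ℝ⁆ Module.End ℂ M} {v : M}
    (hv : IsHighestWeightVector (Z0 (m + l)) (scalarWeight (m + l) lam) π v) :
    IsHighestWeightVector (Z0 m) (scalarWeight m lam) (π.comp (leftIncl m l)) v := by
  refine ⟨fun X hX => ?_, fun X hX => ?_⟩
  · rw [raise_leftIncl]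
    exact hv.raise_eq _ (leftIncl_lie_lie hX)
  · have h := hv.weight_eq (leftIncl m l X) (by rw [← leftIncl_Z0_lie, hX, map_zero])
    rw [scalarWeight, so2Coord_leftIncl] at h
    exact h

theorem IsInvariantInner.restrict {π : so2 (m + l) →ₗ⁅ℝ⁆ Module.End ℂ M}
    {B : InnerProductSpace.Core ℂ M} (hB : IsInvariantInner π B) :
    IsInvariantInner (π.comp (leftIncl m l)) B := fun X u v => hB (leftIncl m l X) u v

end Restriction

/-! ### Existence -/

section Existence

open MvPolynomial

/-- Derivatives and rotations kill constants, and the shifted dilation acts on them by λ. -/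
theorem exists_constant (n : ℕ) : ∃ u : HarmPoly n, harmIncl n u = 1 ∧
    IsHighestWeightVector (Z0 n) (scalarWeight n (minWeight n)) (harmRep n) u := by
  obtain ⟨u, hu⟩ := exists_harmIncl (n := n) (p := 1) (by simp [laplacian_apply])
  refine ⟨u, hu, fun X hX => harmIncl_injective ?_, fun X hX => harmIncl_injective ?_⟩
  · rw [harmRep_raise hX, hu, map_zero]
    simp
  · rw [harmIncl_harmRep, map_smul, hu, conformalGen_apply, rotation_apply,
      (Z0_lie_eq_zero_iff X).1 hX, dilation_apply, scalarWeight]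
    simp only [Pi.zero_apply, zero_smul, map_zero, pderiv_one, mul_zero, Finset.sum_const_zero,
      neg_zero, smul_zero, add_zero, zero_add, mul_one, smul_eq_C_mul, ← map_mul]
    congr 1
    ring

/-- 𝔨 acts through dilations and rotations only, which do not raise the degree; the harmonic
polynomials of bounded degree serve as W. -/
theorem harmRep_compact_stable {n : ℕ} (u : HarmPoly n) : ∃ W : Submodule ℂ (HarmPoly n),
    u ∈ W ∧ FiniteDimensional ℂ W ∧ IsStable (harmRep n) {X | IsCompactPart X} W := by
  let W := (restrictTotalDegree (Fin n) ℂ (harmIncl n u).totalDegree).comap (harmIncl n)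
  refine ⟨W, ?_, ?_, fun X hX w hw => ?_⟩
  · exact (mem_restrictTotalDegree _ _ _).2 le_rfl
  · refine Module.Finite.of_injective ((harmIncl n).restrict (p := W)
      (q := restrictTotalDegree (Fin n) ℂ (harmIncl n u).totalDegree) fun _ h => h) ?_
    intro a b hab
    exact Subtype.ext (harmIncl_injective (congrArg (fun z => z.1) hab))
  · have hw' := (mem_restrictTotalDegree _ _ _).1 hw
    refine (mem_restrictTotalDegree _ _ _).2 ?_
    rw [harmIncl_harmRep, conformalGen_apply,
      (Z0_lie_eq_zero_iff X).1 ((isCompactPart_iff X).1 hX)]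
    simp only [Pi.zero_apply, zero_smul, map_zero, add_zero, Finset.sum_const_zero, smul_zero]
    exact (totalDegree_add _ _).trans (max_le
      ((totalDegree_smul_le _ _).trans ((totalDegree_dilation_le _ _).trans hw'))
      ((totalDegree_rotation_le _ _).trans hw'))

theorem totalDegree_raise_lt {n : ℕ} {X : so2 n} (hX : ⁅Z0 n, ⁅Z0 n, X⁆⁆ = -X) (u : HarmPoly n) :
    raise (Z0 n) (harmRep n) X u = 0 ∨
      (harmIncl n (raise (Z0 n) (harmRep n) X u)).totalDegree < (harmIncl n u).totalDegree := by
  by_cases h : (harmIncl n u).totalDegree = 0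
  · left
    refine harmIncl_injective ?_
    rw [harmRep_raise hX, map_zero]
    refine Finset.sum_eq_zero fun i _ => ?_
    rcases totalDegree_pderiv_lt i (harmIncl n u) with h' | h'
    · rw [h', smul_zero]
    · omega
  · right
    rw [harmRep_raise hX]
    refine Nat.lt_of_le_pred (Nat.pos_of_ne_zero h) (totalDegree_finsetSum_le fun i _ => ?_)
    refine (totalDegree_smul_le _ _).trans ?_
    rcases totalDegree_pderiv_lt i (harmIncl n u) with h' | h'
    · rw [h', totalDegree_zero]; exact Nat.zero_le _
    · exact Nat.le_pred_of_lt h'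

/-- The submodule for `𝔰𝔬(2, m)` generated by the constants, in the minimal representation of
`𝔰𝔬(2, m + l)`. -/
theorem exists_isScalarHighestWeight (m l : ℕ) (hn : 3 ≤ m + l) :
    ∃ (N : Type) (_ : AddCommGroup N) (_ : Module ℂ N)
      (σ : so2 m →ₗ⁅ℝ⁆ Module.End ℂ N) (C : InnerProductSpace.Core ℂ N),
      IsScalarHighestWeight m (minWeight (m + l)) σ C := by
  obtain ⟨u, hu, huw⟩ := exists_constant (m + l)
  have hu0 : u ≠ 0 := by
    rintro rfl
    rw [map_zero] at hu
    exact zero_ne_one hu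
  refine ⟨_, _, _, _, _, isScalarHighestWeight_cyclic (harmRep_invariant hn).restrict hu0
    huw.restrict (fun u => (harmIncl (m + l) u).totalDegree) (fun X hX v => ?_) fun v => ?_⟩
  · rw [raise_leftIncl]
    exact totalDegree_raise_lt (leftIncl_lie_lie hX) v
  · obtain ⟨W, h1, h2, h3⟩ := harmRep_compact_stable v
    refine ⟨W, h1, h2, fun X hX w hw => h3 (leftIncl m l X) ?_ w hw⟩
    refine (isCompactPart_iff _).2 ?_
    rw [← leftIncl_Z0_lie, (isCompactPart_iff X).1 hX, map_zero]

end Existence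

/-! ### Spherical harmonics in the minimal representation -/

section Embedding

open MvPolynomial

variable {m l : ℕ}

theorem natAdd_left_injective : Function.Injective (Fin.natAdd m : Fin l → Fin (m + l)) :=
  fun a b h => by simpa [Fin.ext_iff] using h

theorem pderiv_castAdd_rename (i : Fin m) (p : MvPolynomial (Fin l) ℂ) :
    pderiv (Fin.castAdd l i) (rename (Fin.natAdd m) p) = 0 := by
  classical
  refine pderiv_eq_zero_of_notMem_vars fun h => ?_
  obtain ⟨k, -, hk⟩ := Finset.mem_image.1 (vars_rename (Fin.natAdd m) p h)
  have := congrArg Fin.val hk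
  simp at this
  omega

theorem laplacian_rename (p : MvPolynomial (Fin l) ℂ) :
    laplacian (m + l) (rename (Fin.natAdd m) p) = rename (Fin.natAdd m) (laplacian l p) := by
  rw [laplacian_apply, laplacian_apply, map_sum, Fin.sum_univ_add]
  simp [pderiv_castAdd_rename, pderiv_rename natAdd_left_injective]

/-- Spherical harmonics in the last `l` variables as harmonic polynomials in all variables. -/
def sphIncl (m l k : ℕ) : SphHarm l k →ₗ[ℂ] HarmPoly (m + l) :=
  ((rename (Fin.natAdd m)).toLinearMap : MvPolynomial (Fin l) ℂ →ₗ[ℂ] _).restrict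
    (p := harmonicSubmodule l k) (q := LinearMap.ker (laplacian (m + l))) fun p hp => by
      have h : laplacian l p = 0 := hp.2
      rw [LinearMap.mem_ker, AlgHom.toLinearMap_apply, laplacian_rename, h, map_zero]

theorem harmIncl_sphIncl {k : ℕ} (y : SphHarm l k) :
    harmIncl (m + l) (sphIncl m l k y) = rename (Fin.natAdd m) y.1 := rfl

theorem sphIncl_injective (k : ℕ) : Function.Injective (sphIncl m l k) := fun _ _ h =>
  Subtype.ext (rename_injective _ natAdd_left_injective (congrArg (harmIncl (m + l)) h))

theorem rotation_blockIncl_rename (Z : so2 m × so l) (p : MvPolynomial (Fin l) ℂ) :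
    rotation (rotCoord (blockIncl m l Z)) (rename (Fin.natAdd m) p) =
      rename (Fin.natAdd m) (rotation Z.2.1 p) := by
  rw [rotation_apply, rotation_apply, map_neg, map_sum, Fin.sum_univ_add]
  congr 1
  simp only [pderiv_castAdd_rename, mul_zero, Finset.sum_const_zero, zero_add,
    pderiv_rename natAdd_left_injective, map_mul, map_sum]
  refine Finset.sum_congr rfl fun i _ => ?_
  congr 1
  rw [Fin.sum_univ_add]
  simp [rotCoord_blockIncl_natAdd]

theorem harmRep_blockIncl_sphIncl {k : ℕ} (Y : so l) (y : SphHarm l k) :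
    harmRep (m + l) (blockIncl m l (0, Y)) (sphIncl m l k y) =
      sphIncl m l k (sphHarmRep l k Y y) := by
  have hb : boostCoord (blockIncl m l ((0 : so2 m), Y)) = 0 := by
    ext i
    refine Fin.addCases (fun i => ?_) (fun i => ?_) i
    · rw [boostCoord_blockIncl_castAdd]; simp [boostCoord]
    · rw [boostCoord_blockIncl_natAdd]; rfl
  have ha : so2Coord (blockIncl m l ((0 : so2 m), Y)) = 0 := so2Coord_blockIncl m l _
  refine harmIncl_injective ?_
  rw [harmIncl_harmRep, harmIncl_sphIncl, harmIncl_sphIncl, conformalGen_apply, hb, ha,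
    rotation_blockIncl_rename]
  simp only [Pi.zero_apply, zero_smul, map_zero, add_zero, Finset.sum_const_zero, smul_zero,
    Complex.ofReal_zero, mul_zero, neg_zero, zero_add]
  rfl

theorem dilation_of_isHomogeneous (lam : ℂ) {n k : ℕ} {p : MvPolynomial (Fin n) ℂ}
    (hp : p.IsHomogeneous k) : dilation lam p = ((k : ℂ) + lam) • p := by
  rw [dilation_eq]
  ext s
  rw [coeff_degreeOp, coeff_smul, smul_eq_mul]
  by_cases h : coeff s p = 0
  · rw [h, mul_zero, mul_zero]
  · have : s.degree = k := by
      have := hp h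
      exact (DFunLike.congr_fun (Finsupp.degree_eq_weight_one (R := ℕ)) s).trans this
    rw [this]

/-- Raising operators of 𝔰𝔬(2,m) differentiate only in the first m variables and 𝔰𝔬(m) rotates only
these. The shift of the parameter by k is the eigenvalue of the Euler operator. -/
theorem sphIncl_isHighestWeightVector {k : ℕ} (y : SphHarm l k) :
    IsHighestWeightVector (Z0 m) (scalarWeight m (minWeight (m + l) + k))
      ((harmRep (m + l)).comp (leftIncl m l)) (sphIncl m l k y) := by
  refine ⟨fun X hX => harmIncl_injective ?_, fun X hX => harmIncl_injective ?_⟩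
  · rw [raise_leftIncl, harmRep_raise (leftIncl_lie_lie hX), harmIncl_sphIncl, Fin.sum_univ_add]
    simp [pderiv_castAdd_rename, boostCoord_leftIncl_natAdd]
  · have hb : boostCoord (leftIncl m l X) = 0 := by
      rw [← Z0_lie_eq_zero_iff, ← leftIncl_Z0_lie, hX, map_zero]
    have hr : rotation (rotCoord (leftIncl m l X)) (rename (Fin.natAdd m) y.1) = 0 := by
      rw [leftIncl_apply, rotation_blockIncl_rename, rotation_apply]
      simp
    have hy : y.1.IsHomogeneous k := y.2.1
    rw [LieHom.comp_apply, harmIncl_harmRep, map_smul, harmIncl_sphIncl, conformalGen_apply, hb, hr,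
      so2Coord_leftIncl, dilation_of_isHomogeneous _ hy.rename_isHomogeneous, scalarWeight,
      smul_smul]
    simp only [Pi.zero_apply, zero_smul, map_zero, add_zero, Finset.sum_const_zero, smul_zero]
    congr 1
    push_cast
    ring

/-- In characteristic zero the factor sᵢ produced by differentiating a monomial does not vanish. -/
theorem notMem_vars_of_pderiv_eq_zero {n : ℕ} {i : Fin n} {p : MvPolynomial (Fin n) ℂ}
    (h : pderiv i p = 0) : i ∉ p.vars := by
  intro hi
  obtain ⟨s, hs, hsi⟩ := (mem_vars_iff_mem_support i).1 hi
  have h0 : s i ≠ 0 := Finsupp.mem_support_iff.1 hsi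
  have h1 : s - Finsupp.single i 1 + Finsupp.single i 1 = s :=
    tsub_add_cancel_of_le (Finsupp.single_le_iff.2 (Nat.one_le_iff_ne_zero.2 h0))
  have h2 := congrArg (coeff (s - Finsupp.single i 1)) h
  rw [coeff_pderiv, h1, coeff_zero] at h2
  rcases mul_eq_zero.1 h2 with h3 | h3
  · exact mem_support_iff.1 hs h3
  · exact Nat.cast_add_one_ne_zero _ h3

/-- A harmonic polynomial that does not depend on the first `m` variables is a sum of spherical
harmonics in the other variables. -/
theorem mem_of_pderiv_castAdd_eq_zero (W : Submodule ℂ (MvPolynomial (Fin (m + l)) ℂ))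
    (hW : ∀ k (y : SphHarm l k), harmIncl (m + l) (sphIncl m l k y) ∈ W)
    {p : MvPolynomial (Fin (m + l)) ℂ} (hp : laplacian (m + l) p = 0)
    (hp' : ∀ i : Fin m, pderiv (Fin.castAdd l i) p = 0) : p ∈ W := by
  obtain ⟨r, rfl⟩ := exists_rename_eq_of_vars_subset_range p (Fin.natAdd m)
    natAdd_left_injective (by
      intro i hi
      revert hi
      refine Fin.addCases (fun i => ?_) (fun i => ?_) i
      · intro hi
        exact absurd hi (notMem_vars_of_pderiv_eq_zero (hp' i))
      · intro _
        exact ⟨i, rfl⟩)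
  have hr : laplacian l r = 0 := by
    rw [laplacian_rename] at hp
    exact rename_injective _ natAdd_left_injective (by rw [hp, map_zero])
  rw [← sum_homogeneousComponent r, map_sum]
  refine W.sum_mem fun k _ => ?_
  -- As a degree operator, the projection to a homogeneous component commutes with the Laplacian up
  -- to a shift, so components of harmonic polynomials are harmonic.
  have hk : homogeneousComponent k r = degreeOp (fun d => if d = k then 1 else 0) r := by
    ext s
    rw [coeff_homogeneousComponent, coeff_degreeOp]
    split_ifs <;> simp
  exact hW k ⟨homogeneousComponent k r, homogeneousComponent_isHomogeneous k r, by
    change laplacian l _ = 0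
    rw [hk, laplacian_degreeOp, hr, map_zero]⟩

end Embedding

/-! ### Comparison of invariant inner products -/

section Comparison

/-- A is the positive square root of the operator P with ⟨x, Py⟩ = H(x, y). An S that is skew for
both forms commutes with P, hence with its square root. -/
theorem exists_sqrt_of_inner {F : Type*} [NormedAddCommGroup F] [InnerProductSpace ℂ F]
    [FiniteDimensional ℂ F] (H : InnerProductSpace.Core ℂ F) :
    ∃ A : F →ₗ[ℂ] F, (∀ y y', inner ℂ (A y) (A y') = coreForm H y y') ∧
      ∀ S : F →ₗ[ℂ] F, (∀ y y', inner ℂ (S y) y' = -inner ℂ y (S y')) →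
        (∀ y y', coreForm H (S y) y' = -coreForm H y (S y')) → ∀ y, A (S y) = S (A y) := by
  let e := stdOrthonormalBasis ℂ F
  let P : F →ₗ[ℂ] F := ∑ i, (coreForm H (e i)).smulRight (e i)
  have hP : ∀ x y, inner ℂ x (P y) = coreForm H x y := by
    intro x y
    conv_rhs => rw [← e.sum_repr' x]
    simp only [P, LinearMap.sum_apply, LinearMap.smulRight_apply, inner_sum, inner_smul_right,
      map_sum, LinearMap.map_smulₛₗ, LinearMap.smul_apply, smul_eq_mul, inner_conj_symm]
    exact Finset.sum_congr rfl fun i _ => mul_comm _ _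
  have hsym : P.IsSymmetric := by
    intro x y
    rw [hP, ← inner_conj_symm, hP, coreForm_conj]
  let b := hsym.eigenvectorBasis rfl
  let μ := hsym.eigenvalues rfl
  have hPb : ∀ i, P (b i) = (μ i : ℂ) • b i := hsym.apply_eigenvectorBasis rfl
  have hμ : ∀ i, 0 ≤ μ i := by
    intro i
    have h1 : coreForm H (b i) (b i) = μ i := by
      rw [← hP, hPb, inner_smul_right, inner_self_eq_norm_sq_to_K, b.norm_eq_one]
      simp
    have h2 : 0 ≤ (coreForm H (b i) (b i)).re := H.re_inner_nonneg _
    rwa [h1, Complex.ofReal_re] at h2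
  let A : F →ₗ[ℂ] F := b.toBasis.constr ℂ fun i => (Real.sqrt (μ i) : ℂ) • b i
  have hAb : ∀ i, A (b i) = (Real.sqrt (μ i) : ℂ) • b i := by
    intro i
    have := b.toBasis.constr_basis ℂ (fun i => (Real.sqrt (μ i) : ℂ) • b i) i
    rwa [OrthonormalBasis.coe_toBasis] at this
  have hsq : ∀ i, (Real.sqrt (μ i) : ℂ) * Real.sqrt (μ i) = μ i := fun i => by
    rw [← Complex.ofReal_mul, Real.mul_self_sqrt (hμ i)]
  have hAA : ∀ y, A (A y) = P y := by
    intro y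
    have : A ∘ₗ A = P := b.toBasis.ext fun i => by
      rw [OrthonormalBasis.coe_toBasis, LinearMap.comp_apply, hAb, map_smul, hAb, hPb, smul_smul,
        hsq]
    exact LinearMap.congr_fun this y
  have hA : ∀ y y', inner ℂ (A y) y' = inner ℂ y (A y') := by
    intro y y'
    rw [← b.sum_repr y, ← b.sum_repr y']
    simp only [map_sum, map_smul, hAb, sum_inner, inner_sum, inner_smul_left, inner_smul_right,
      Complex.conj_ofReal, OrthonormalBasis.inner_eq_ite]
    refine Finset.sum_congr rfl fun i _ => ?_
    simp only [mul_ite, mul_one, mul_zero, Finset.sum_ite_eq', Finset.mem_univ, if_true]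
    ring
  refine ⟨A, fun y y' => by rw [hA, hAA, hP], fun S hS1 hS2 => ?_⟩
  have hSP : ∀ y, P (S y) = S (P y) := by
    intro y
    refine ext_inner_left ℂ fun x => ?_
    rw [hP, ← neg_neg (inner ℂ x (S (P y))), ← hS1, hP, hS2, neg_neg]
  have : A ∘ₗ S = S ∘ₗ A := b.toBasis.ext fun i => by
    rw [OrthonormalBasis.coe_toBasis, LinearMap.comp_apply, LinearMap.comp_apply, hAb, map_smul]
    refine b.toBasis.ext_elem fun k => ?_
    rw [OrthonormalBasis.coe_toBasis_repr_apply, OrthonormalBasis.coe_toBasis_repr_apply,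
      OrthonormalBasis.repr_apply_apply, OrthonormalBasis.repr_apply_apply, ← hA, hAb,
      inner_smul_left, inner_smul_right, Complex.conj_ofReal]
    by_cases h : inner ℂ (b k) (S (b i)) = 0
    · rw [h, mul_zero, mul_zero]
    -- Because S commutes with P, a nonzero matrix entry of S joins eigenvectors with equal
    -- eigenvalues, so the square roots of these agree as well.
    · have h1 : (μ k : ℂ) * inner ℂ (b k) (S (b i)) = μ i * inner ℂ (b k) (S (b i)) := by
        have h2 : inner ℂ (P (b k)) (S (b i)) = inner ℂ (b k) (P (S (b i))) := hsym _ _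
        rwa [hSP, hPb, hPb, map_smul, inner_smul_left, inner_smul_right, Complex.conj_ofReal] at h2
      have h3 : μ k = μ i := by exact_mod_cast mul_right_cancel₀ h h1
      rw [h3]
  exact fun y => LinearMap.congr_fun this y

/-- Two inner products on a finite-dimensional representation are related by an equivariant
automorphism. -/
theorem exists_equivariant_isometry {𝔤 F : Type*} [LieRing 𝔤] [LieAlgebra ℝ 𝔤] [AddCommGroup F]
    [Module ℂ F] [FiniteDimensional ℂ F] (ρ : 𝔤 →ₗ⁅ℝ⁆ Module.End ℂ F)
    {G H : InnerProductSpace.Core ℂ F} (hG : IsInvariantInner ρ G) (hH : IsInvariantInner ρ H) :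
    ∃ A : F →ₗ[ℂ] F, Function.Surjective A ∧
      (∀ y y', coreForm G (A y) (A y') = coreForm H y y') ∧ ∀ X y, A (ρ X y) = ρ X (A y) := by
  let : NormedAddCommGroup F := G.toNormedAddCommGroup
  let : InnerProductSpace ℂ F := InnerProductSpace.ofCore G.toCore
  obtain ⟨A, h1, h2⟩ := exists_sqrt_of_inner H
  refine ⟨A, ?_, h1, fun X => h2 (ρ X) (hG X) (hH X)⟩
  refine LinearMap.injective_iff_surjective.1 ((injective_iff_map_eq_zero A).2 fun y hy => ?_)
  refine coreForm_definite H ?_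
  rw [← h1, hy, inner_zero_left]

/-- The pulled back form is the tensor product form, whose nondegeneracy is proved by hand in a
basis of F. -/
theorem injective_of_inner_tmul {N F M : Type*} [AddCommGroup N] [Module ℂ N] [AddCommGroup F]
    [Module ℂ F] [FiniteDimensional ℂ F] [AddCommGroup M] [Module ℂ M]
    (C : InnerProductSpace.Core ℂ N) (H : InnerProductSpace.Core ℂ F)
    (D : M →ₗ⋆[ℂ] M →ₗ[ℂ] ℂ) (Φ : N ⊗[ℂ] F →ₗ[ℂ] M)
    (hΦ : ∀ x x' y y', D (Φ (x ⊗ₜ y)) (Φ (x' ⊗ₜ y')) = coreForm C x x' * coreForm H y y') :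
    Function.Injective Φ := by
  refine (injective_iff_map_eq_zero Φ).2 fun w hw => ?_
  let b := Module.finBasis ℂ F
  obtain ⟨f, rfl⟩ := (TensorProduct.equivFinsuppOfBasisRight b).symm.surjective w
  suffices f = 0 by rw [this, map_zero]
  rw [TensorProduct.equivFinsuppOfBasisRight_symm_apply] at hw
  ext i
  refine coreForm_definite C ?_
  have h1 : ∀ x', ∑ k, coreForm C x' (f k) • b k = 0 := by
    intro x'
    refine coreForm_definite H ?_
    -- For w = ∑ fₖ ⊗ bₖ in the kernel put s = ∑ C(x', fₖ)bₖ. Pairing Φ(x' ⊗ s) with Φ(w) = 0 gives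
    -- H(s, s) = 0, so every C(x', fₖ) vanishes; then x' = fᵢ is taken.
    have h2 := congrArg (D (Φ (x' ⊗ₜ ∑ k, coreForm C x' (f k) • b k))) hw
    rw [map_zero, Finsupp.sum_fintype _ _ (fun i => by rw [TensorProduct.zero_tmul]), map_sum,
      map_sum] at h2
    rw [← h2]
    conv_lhs => rw [map_sum]
    refine Finset.sum_congr rfl fun k _ => ?_
    rw [hΦ, map_smul, smul_eq_mul]
  exact Fintype.linearIndependent_iff.1 b.linearIndependent _ (h1 (f i)) i

/-- Pairing the image of w with the range of the k-th map isolates the k-th component of w. -/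
theorem toModule_injective_of_orthogonal {V : ℕ → Type*} [∀ k, AddCommGroup (V k)]
    [∀ k, Module ℂ (V k)] {M : Type*} [AddCommGroup M] [Module ℂ M]
    (B : InnerProductSpace.Core ℂ M) (Φ : ∀ k, V k →ₗ[ℂ] M)
    (hinj : ∀ k, Function.Injective (Φ k))
    (horth : ∀ k k', k ≠ k' → ∀ x x', coreForm B (Φ k x) (Φ k' x') = 0) :
    Function.Injective (DirectSum.toModule ℂ ℕ M Φ) := by
  have h : ∀ k z (w : ⨁ k, V k), coreForm B (Φ k z) (DirectSum.toModule ℂ ℕ M Φ w) =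
      coreForm B (Φ k z) (Φ k (w k)) := by
    intro k z w
    induction w using DirectSum.induction_on with
    | zero => simp
    | of i x =>
      have h1 : DirectSum.toModule ℂ ℕ M Φ (DirectSum.of V i x) = Φ i x :=
        DirectSum.toModule_lof ℂ i x
      rw [h1]
      by_cases hik : k = i
      · subst hik
        rw [DirectSum.of_eq_same]
      · rw [DirectSum.of_eq_of_ne _ _ _ hik, map_zero, map_zero, horth _ _ hik]
    | add x y hx hy => rw [map_add, map_add, hx, hy, DirectSum.add_apply, map_add, map_add]
  refine (injective_iff_map_eq_zero _).2 fun w hw => ?_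
  ext k
  refine hinj k ?_
  rw [DirectSum.zero_apply, map_zero]
  refine coreForm_definite B ?_
  rw [← h, hw, map_zero]

/-- Orthogonal equivariant embeddings whose ranges generate assemble to an isomorphism. -/
theorem exists_directSum_equiv {𝔤 : Type*} [LieRing 𝔤] [LieAlgebra ℝ 𝔤] {V : ℕ → Type*}
    [∀ k, AddCommGroup (V k)] [∀ k, Module ℂ (V k)] {M : Type*} [AddCommGroup M] [Module ℂ M]
    (ρ : ∀ k, 𝔤 →ₗ⁅ℝ⁆ Module.End ℂ (V k)) (π : 𝔤 →ₗ⁅ℝ⁆ Module.End ℂ M)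
    (B : InnerProductSpace.Core ℂ M) (Φ : ∀ k, V k →ₗ[ℂ] M)
    (hequiv : ∀ k X x, Φ k (ρ k X x) = π X (Φ k x))
    (hinj : ∀ k, Function.Injective (Φ k))
    (horth : ∀ k k', k ≠ k' → ∀ x x', coreForm B (Φ k x) (Φ k' x') = 0)
    (hgen : ∀ W : Submodule ℂ M, IsStable π Set.univ W →
      (∀ k, LinearMap.range (Φ k) ≤ W) → W = ⊤) :
    ∃ e : (⨁ k, V k) ≃ₗ[ℂ] M, (∀ k x, e (DirectSum.lof ℂ ℕ V k x) = Φ k x) ∧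
      ∀ X w, e (directSumRep ρ X w) = π X (e w) := by
  have hlof : ∀ k x, DirectSum.toModule ℂ ℕ M Φ (DirectSum.lof ℂ ℕ V k x) = Φ k x :=
    fun k x => DirectSum.toModule_lof ℂ k x
  have hrep : ∀ X w, DirectSum.toModule ℂ ℕ M Φ (directSumRep ρ X w) =
      π X (DirectSum.toModule ℂ ℕ M Φ w) := by
    intro X w
    have : DirectSum.toModule ℂ ℕ M Φ ∘ₗ directSumRep ρ X =
        π X ∘ₗ DirectSum.toModule ℂ ℕ M Φ := by
      refine DirectSum.linearMap_ext ℂ fun k => LinearMap.ext fun x => ?_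
      have h : directSumRep ρ X (DirectSum.lof ℂ ℕ V k x) =
          DirectSum.lof ℂ ℕ V k (ρ k X x) := DirectSum.lmap_lof _ _ _
      rw [LinearMap.comp_apply, LinearMap.comp_apply, LinearMap.comp_apply,
        LinearMap.comp_apply, h, hlof, hlof, hequiv]
    exact LinearMap.congr_fun this w
  have hsurj : LinearMap.range (DirectSum.toModule ℂ ℕ M Φ) = ⊤ := by
    refine hgen _ ?_ fun k => ?_
    · rintro X - _ ⟨w, rfl⟩
      exact ⟨_, hrep X w⟩
    · rintro _ ⟨x, rfl⟩
      exact ⟨_, hlof k x⟩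
  exact ⟨LinearEquiv.ofBijective _ ⟨toModule_injective_of_orthogonal B Φ hinj horth,
    LinearMap.range_eq_top.1 hsurj⟩, hlof, hrep⟩

end Comparison

/-! ### The branching law -/

section Branching

open MvPolynomial

instance (l k : ℕ) : FiniteDimensional ℂ (SphHarm l k) := by
  have : FiniteDimensional ℂ (homogeneousSubmodule (Fin l) ℂ k) :=
    Module.Finite.iff_fg.2 (homogeneousSubmodule_fg (Fin l) ℂ k)
  exact Submodule.finiteDimensional_of_le
    (S₁ := harmonicSubmodule l k) (S₂ := homogeneousSubmodule (Fin l) ℂ k) inf_le_left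

/-- The lowering operator of the boost with coordinate vector eᵢ is exactly Kᵢ. -/
theorem inversionOp_mem {m l : ℕ} {W : Submodule ℂ (HarmPoly (m + l))}
    (hW : IsStable ((harmRep (m + l)).comp (leftIncl m l)) Set.univ W) (i : Fin m)
    {p : MvPolynomial (Fin (m + l)) ℂ} (hp : p ∈ W.map (harmIncl (m + l))) :
    inversionOp (minWeight (m + l) : ℂ) (Fin.castAdd l i) p ∈ W.map (harmIncl (m + l)) := by
  obtain ⟨u, hu, rfl⟩ := hp
  refine ⟨_, lower_mem (Z := Z0 m) hW (boost (Pi.single i 1)) hu, ?_⟩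
  rw [lower_leftIncl, harmRep_lower (leftIncl_lie_lie (Z0_lie_lie_boost _)), Fin.sum_univ_add]
  simp only [boostCoord_leftIncl_castAdd, boostCoord_leftIncl_natAdd, boostCoord_boost, map_zero,
    zero_smul, Finset.sum_const_zero, add_zero]
  rw [Finset.sum_eq_single i]
  · simp
  · intro k _ hk
    rw [Pi.single_eq_of_ne hk, map_zero, zero_smul]
  · simp

/-- A subspace of the minimal representation that is stable under `𝔰𝔬(2, m)` and contains the
spherical harmonics in the last variables is everything. -/
theorem eq_top_of_sphIncl_mem {m l : ℕ} (hn : 3 ≤ m + l) {W : Submodule ℂ (HarmPoly (m + l))}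
    (hW : IsStable ((harmRep (m + l)).comp (leftIncl m l)) Set.univ W)
    (hι : ∀ k (y : SphHarm l k), sphIncl m l k y ∈ W) : W = ⊤ := by
  refine (Submodule.eq_top_iff').2 fun u => ?_
  have h : harmIncl (m + l) u ∈ W.map (harmIncl (m + l)) := by
    refine harmonic_completeness hn (Set.range (Fin.castAdd l)) _ ?_ ?_ ?_ (laplacian_harmIncl u)
    · rintro _ ⟨v, -, rfl⟩
      exact laplacian_harmIncl v
    · rintro _ ⟨i, rfl⟩ p hp
      exact inversionOp_mem hW i hp
    · intro p hp hp'
      exact mem_of_pderiv_castAdd_eq_zero (W.map (harmIncl (m + l)))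
        (fun k y => ⟨_, hι k y, rfl⟩) hp
        fun i => hp' _ ⟨i, rfl⟩
  obtain ⟨v, hv, hvu⟩ := h
  rwa [← harmIncl_injective hvu]

/-- `harmonic_completeness` with all variables inverted: a polynomial with no nonzero derivative is
constant. -/
theorem eq_top_of_constant_mem {n : ℕ} (hn : 3 ≤ n) {W : Submodule ℂ (HarmPoly n)}
    (hW : IsStable (harmRep n) Set.univ W) {u : HarmPoly n} (hu : harmIncl n u = 1) (huW : u ∈ W) :
    W = ⊤ := by
  refine (Submodule.eq_top_iff').2 fun v => ?_
  have h : harmIncl n v ∈ W.map (harmIncl n) := by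
    refine harmonic_completeness hn Set.univ _ ?_ ?_ ?_ (laplacian_harmIncl v)
    · rintro _ ⟨w, -, rfl⟩
      exact laplacian_harmIncl w
    · rintro i - _ ⟨w, hw, rfl⟩
      refine ⟨_, lower_mem (Z := Z0 n) hW (boost (Pi.single i 1)) hw, ?_⟩
      rw [harmRep_lower (Z0_lie_lie_boost _), boostCoord_boost, Finset.sum_eq_single i]
      · simp
      · intro k _ hk
        rw [Pi.single_eq_of_ne hk, map_zero, zero_smul]
      · simp
    · intro p _ hp'
      have h1 : p.vars = ∅ := Finset.eq_empty_of_forall_notMem fun i =>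
        notMem_vars_of_pderiv_eq_zero (hp' i trivial)
      refine ⟨coeff 0 p • u, W.smul_mem _ huW, ?_⟩
      rw [map_smul, hu, smul_eq_C_mul, mul_one]
      exact (vars_eq_empty_iff_eq_C.1 h1).symm
  obtain ⟨w, hw, hwv⟩ := h
  rwa [← harmIncl_injective hwv]

theorem mem_cyclic_of_isScalarHighestWeight {j : ℕ} {lam : ℝ} {M : Type*} [AddCommGroup M]
    [Module ℂ M] {π : so2 j →ₗ⁅ℝ⁆ Module.End ℂ M} {B : InnerProductSpace.Core ℂ M}
    (h : IsScalarHighestWeight j lam π B) {v : M} (hv : v ≠ 0) (x : M) : x ∈ cyclic π v :=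
  mem_cyclic_of_irreducible h.irreducible hv x

/-- Uniqueness of the minimal representation. -/
theorem exists_equiv_harmRep {n : ℕ} (hn : 3 ≤ n) {M : Type*} [AddCommGroup M] [Module ℂ M]
    {π : so2 n →ₗ⁅ℝ⁆ Module.End ℂ M} {B : InnerProductSpace.Core ℂ M}
    (h : IsScalarHighestWeight n (minWeight n) π B) :
    ∃ (Ψ : M ≃ₗ[ℂ] HarmPoly n) (c : ℝ), 0 < c ∧ (∀ X x, Ψ (π X x) = harmRep n X (Ψ x)) ∧
      ∀ x x', coreForm B x x' = c * coreForm (harmCore n hn) (Ψ x) (Ψ x') := by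
  obtain ⟨v, hv0, hv⟩ := h.exists_vector
  obtain ⟨u, hu, huw⟩ := exists_constant n
  have hu0 : u ≠ 0 := by
    rintro rfl
    rw [map_zero] at hu
    exact zero_ne_one hu
  obtain ⟨T, hTv, hT⟩ := exists_intertwiner Z0_lie_lie_lie h.unitary (harmRep_invariant hn)
    h.irreducible hv0 hv huw
  have hb := coreForm_self_pos B hv0
  have hb0 := coreForm_self_pos (harmCore n hn) hu0
  have hinner : ∀ x x', coreForm B x x' =
      (((coreForm B v v).re / (coreForm (harmCore n hn) u u).re : ℝ) : ℂ) *
        coreForm (harmCore n hn) (T x) (T x') := by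
    intro x x'
    have h1 := inner_intertwiner Z0_lie_lie_lie h.unitary (harmRep_invariant hn) hv
      (mem_cyclic_of_isScalarHighestWeight h hv0) hT hT x x'
    rw [hTv, ← coreForm_self_re B, ← coreForm_self_re (harmCore n hn) u] at h1
    have h2 : (((coreForm (harmCore n hn) u u).re : ℝ) : ℂ) ≠ 0 := by exact_mod_cast hb0.ne'
    rw [Complex.ofReal_div, div_mul_eq_mul_div, h1, mul_comm, mul_div_assoc, div_self h2, mul_one]
  have hinj : Function.Injective T := (injective_iff_map_eq_zero T).2 fun x hx =>
    coreForm_definite B (by rw [hinner, hx, map_zero, mul_zero])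
  have hsurj : LinearMap.range T = ⊤ := by
    refine eq_top_of_constant_mem hn ?_ hu ⟨v, hTv⟩
    rintro X - _ ⟨x, rfl⟩
    exact ⟨_, hT X x⟩
  exact ⟨LinearEquiv.ofBijective T ⟨hinj, LinearMap.range_eq_top.1 hsurj⟩, _, div_pos hb hb0, hT,
    hinner⟩

theorem leftIncl_lie_blockIncl {m l : ℕ} (X : so2 m) (Y : so l) :
    ⁅leftIncl m l X, blockIncl m l (0, Y)⁆ = 0 := by
  rw [leftIncl_apply, ← LieHom.map_lie]
  have : ⁅((X, 0) : so2 m × so l), ((0, Y) : so2 m × so l)⁆ = 0 := by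
    ext1 <;> simp
  rw [this, map_zero]

/-- The summand of the minimal representation attached to the spherical harmonics of degree `k`. -/
theorem exists_summand {m l : ℕ} (hn : 3 ≤ m + l) (k : ℕ) {N : Type*} [AddCommGroup N] [Module ℂ N]
    {σ : so2 m →ₗ⁅ℝ⁆ Module.End ℂ N} {C : InnerProductSpace.Core ℂ N}
    (h : IsScalarHighestWeight m (minWeight (m + l) + k) σ C)
    {H : InnerProductSpace.Core ℂ (SphHarm l k)} (hH : IsInvariantInner (sphHarmRep l k) H)
    {c : ℝ} (hc : 0 < c) :
    ∃ Φ : N ⊗[ℂ] SphHarm l k →ₗ[ℂ] HarmPoly (m + l),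
      (∀ Z w, Φ (boxTensor σ (sphHarmRep l k) Z w) =
        harmRep (m + l) (blockIncl m l Z) (Φ w)) ∧
      (∀ x x' y y', (c : ℂ) * coreForm (harmCore (m + l) hn) (Φ (x ⊗ₜ y)) (Φ (x' ⊗ₜ y')) =
        coreForm C x x' * coreForm H y y') ∧
      (∀ y, sphIncl m l k y ∈ LinearMap.range Φ) ∧
      ∃ v, v ≠ 0 ∧ IsHighestWeightVector (Z0 m) (scalarWeight m (minWeight (m + l) + k)) σ v ∧
        ∀ y, ∃ T : N →ₗ[ℂ] HarmPoly (m + l),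
          (∀ X x, T (σ X x) = (harmRep (m + l)).comp (leftIncl m l) X (T x)) ∧
          (∃ y', T v = sphIncl m l k y') ∧ ∀ x, Φ (x ⊗ₜ y) = T x := by
  have hB := harmRep_invariant hn
  obtain ⟨v, hv0, hv⟩ := h.exists_vector
  obtain ⟨T, hTv, hT⟩ := exists_intertwiner_family Z0_lie_lie_lie h.unitary
    (hB.restrict (m := m)) h.irreducible hv0 hv (sphIncl m l k) sphIncl_isHighestWeightVector
  have hvv := coreForm_self_pos C hv0
  have hinner := fun y y' => inner_intertwiner Z0_lie_lie_lie h.unitary (hB.restrict (m := m)) hv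
    (mem_cyclic_of_isScalarHighestWeight h hv0) (hT y) (hT y')
  have hTrot : ∀ (Y : so l) y x, T (sphHarmRep l k Y y) x =
      harmRep (m + l) (blockIncl m l (0, Y)) (T y x) := by
    intro Y y
    -- 𝔰𝔬(l) commutes with 𝔰𝔬(2,m), so both sides are 𝔰𝔬(2,m)-intertwiners; they agree at v.
    have : T (sphHarmRep l k Y y) = harmRep (m + l) (blockIncl m l (0, Y)) ∘ₗ T y := by
      refine intertwiner_unique h.irreducible hv0 (hT _) (fun X x => ?_) ?_
      · rw [LinearMap.comp_apply, LinearMap.comp_apply, hT, ← sub_eq_zero, ← neg_eq_zero, neg_sub,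
          LieHom.comp_apply, ← map_lie_apply, leftIncl_lie_blockIncl, map_zero,
          LinearMap.zero_apply]
      · rw [LinearMap.comp_apply, hTv, hTv, harmRep_blockIncl_sphIncl]
    exact LinearMap.congr_fun this
  -- The factor c/‖v‖² normalizes the inner product so that x ⊗ y ↦ T(y)x scales by c to the tensor
  -- product of C and G. The map A then replaces G by the prescribed H.
  let G := scaleCore (pullbackCore (harmCore (m + l) hn) (sphIncl m l k) (sphIncl_injective k))
    (c / (coreForm C v v).re) (div_pos hc hvv)
  have hG : IsInvariantInner (sphHarmRep l k) G := by
    intro Y y y'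
    change (_ : ℂ) * coreForm (harmCore (m + l) hn) (sphIncl m l k _) (sphIncl m l k _) =
      -((_ : ℂ) * coreForm (harmCore (m + l) hn) (sphIncl m l k _) (sphIncl m l k _))
    have h1 := hB (blockIncl m l (0, Y)) (sphIncl m l k y) (sphIncl m l k y')
    rw [← coreForm_apply, ← coreForm_apply] at h1
    rw [← harmRep_blockIncl_sphIncl, ← harmRep_blockIncl_sphIncl, h1]
    exact mul_neg _ _
  obtain ⟨A, hAs, hAG, hA⟩ := exists_equivariant_isometry (sphHarmRep l k) hG hH
  let Φ : N ⊗[ℂ] SphHarm l k →ₗ[ℂ] HarmPoly (m + l) := TensorProduct.lift (T ∘ₗ A).flip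
  have hΦ : ∀ x y, Φ (x ⊗ₜ y) = T (A y) x := fun x y => rfl
  refine ⟨Φ, fun Z w => ?_, fun x x' y y' => ?_, fun y => ?_, v, hv0, hv, fun y =>
    ⟨T (A y), hT _, ⟨_, hTv _⟩, fun x => rfl⟩⟩
  · have hZ : blockIncl m l Z = leftIncl m l Z.1 + blockIncl m l (0, Z.2) := by
      rw [leftIncl_apply, ← map_add]
      congr 1
      ext1 <;> simp
    rw [hZ, map_add]
    induction w using TensorProduct.induction_on with
    | zero => simp
    | tmul x y =>
      have h1 : boxTensor σ (sphHarmRep l k) Z (x ⊗ₜ y) =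
          σ Z.1 x ⊗ₜ y + x ⊗ₜ sphHarmRep l k Z.2 y := rfl
      rw [h1, map_add, hΦ, hΦ, hΦ, hT, hA, hTrot]
      rfl
    | add w w' hw hw' => rw [map_add, map_add, hw, hw', map_add, map_add]
  · have h1 := hinner (A y) (A y') x x'
    have h2 : (((c / (coreForm C v v).re : ℝ)) : ℂ) *
      coreForm (harmCore (m + l) hn) (sphIncl m l k (A y)) (sphIncl m l k (A y')) =
        coreForm H y y' := hAG y y'
    rw [hTv, hTv, ← coreForm_self_re] at h1
    have h3 : (((coreForm C v v).re : ℝ) : ℂ) ≠ 0 := by exact_mod_cast hvv.ne'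
    rw [hΦ, hΦ, ← h2]
    push_cast
    field_simp
    linear_combination (c : ℂ) * h1
  · obtain ⟨z, rfl⟩ := hAs y
    exact ⟨v ⊗ₜ z, by rw [hΦ, hTv]⟩

/-- The skew-Hermitian operator of Z₀ has the distinct eigenvalues -i(λ + k) and -i(λ + k') on the
two vectors. -/
theorem inner_sphIncl_eq_zero {m l : ℕ} (hn : 3 ≤ m + l) {k k' : ℕ} (hk : k ≠ k')
    (y : SphHarm l k) (y' : SphHarm l k') :
    coreForm (harmCore (m + l) hn) (sphIncl m l k y) (sphIncl m l k' y') = 0 := by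
  have hZ : ∀ (k : ℕ) (y : SphHarm l k), harmRep (m + l) (Z0 (m + l)) (sphIncl m l k y) =
      (-(Complex.I * ((minWeight (m + l) + k : ℝ) : ℂ))) • sphIncl m l k y := by
    intro k y
    have := (sphIncl_isHighestWeightVector (m := m) y).weight_eq (Z0 m) (lie_self _)
    rw [scalarWeight, so2Coord_Z0, Complex.ofReal_one, mul_one, LieHom.comp_apply,
      leftIncl_Z0] at this
    exact this
  have h : coreForm (harmCore (m + l) hn) (harmRep (m + l) (Z0 (m + l)) (sphIncl m l k y))
      (sphIncl m l k' y') = -coreForm (harmCore (m + l) hn) (sphIncl m l k y)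
        (harmRep (m + l) (Z0 (m + l)) (sphIncl m l k' y')) := harmRep_invariant hn _ _ _
  rw [hZ, hZ, LinearMap.map_smulₛₗ, LinearMap.smul_apply, map_smul, smul_eq_mul, smul_eq_mul,
    map_neg, map_mul, Complex.conj_I, Complex.conj_ofReal] at h
  have h1 : Complex.I * ((k : ℂ) - k') *
      coreForm (harmCore (m + l) hn) (sphIncl m l k y) (sphIncl m l k' y') = 0 := by
    push_cast at h
    linear_combination h
  refine (mul_eq_zero.1 h1).resolve_left (mul_ne_zero Complex.I_ne_zero (sub_ne_zero.2 ?_))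
  exact_mod_cast hk

end Branching

end Branching

end

/-! ### Existence and branching for arbitrary realizations -/

open Branching in
theorem theoremE (m l : ℕ) (hm : 1 ≤ m) (hn : 3 ≤ m + l) :
    -- the representations in question exist
    (∃ (M : Type) (_ : AddCommGroup M) (_ : Module ℂ M)
      (π : so2 (m + l) →ₗ⁅ℝ⁆ Module.End ℂ M) (B : InnerProductSpace.Core ℂ M),
      IsScalarHighestWeight (m + l) ((((m + l : ℕ) : ℝ) - 2) / 2) π B) ∧
    (∀ k : ℕ, ∃ (N : Type) (_ : AddCommGroup N) (_ : Module ℂ N)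
      (σ : so2 m →ₗ⁅ℝ⁆ Module.End ℂ N) (C : InnerProductSpace.Core ℂ N),
      IsScalarHighestWeight m ((((m + l : ℕ) : ℝ) - 2) / 2 + k) σ C) ∧
    -- and, for all realizations of them, the branching law holds
    (∀ {M : Type*} [AddCommGroup M] [Module ℂ M]
      (π : so2 (m + l) →ₗ⁅ℝ⁆ Module.End ℂ M) (B : InnerProductSpace.Core ℂ M)
      (_ : IsScalarHighestWeight (m + l) ((((m + l : ℕ) : ℝ) - 2) / 2) π B)
      {N : ℕ → Type*} [∀ k, AddCommGroup (N k)] [∀ k, Module ℂ (N k)]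
      (σ : ∀ k, so2 m →ₗ⁅ℝ⁆ Module.End ℂ (N k)) (C : ∀ k, InnerProductSpace.Core ℂ (N k))
      (_ : ∀ k : ℕ, IsScalarHighestWeight m ((((m + l : ℕ) : ℝ) - 2) / 2 + k) (σ k) (C k))
      (H : ∀ k, InnerProductSpace.Core ℂ (SphHarm l k))
      (_ : ∀ k, IsInvariantInner (sphHarmRep l k) (H k)),
      ∃ Φ : (⨁ k, N k ⊗[ℂ] SphHarm l k) ≃ₗ[ℂ] M,
        -- equivariance under `𝔰𝔬(2, m) ⊕ 𝔰𝔬(l)`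
        (∀ (Z : so2 m × so l) (w : ⨁ k, N k ⊗[ℂ] SphHarm l k),
          Φ (directSumRep (fun k => boxTensor (σ k) (sphHarmRep l k)) Z w)
            = π (blockIncl m l Z) (Φ w)) ∧
        -- the summands are mutually orthogonal, and `Φ` is isometric on each of them
        (∀ (k k' : ℕ), k ≠ k' → ∀ (x : N k ⊗[ℂ] SphHarm l k) (x' : N k' ⊗[ℂ] SphHarm l k'),
          B.inner (Φ (DirectSum.lof ℂ ℕ (fun k => N k ⊗[ℂ] SphHarm l k) k x))
            (Φ (DirectSum.lof ℂ ℕ (fun k => N k ⊗[ℂ] SphHarm l k) k' x')) = 0) ∧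
        (∀ (k : ℕ) (x x' : N k) (y y' : SphHarm l k),
          B.inner (Φ (DirectSum.lof ℂ ℕ (fun k => N k ⊗[ℂ] SphHarm l k) k (x ⊗ₜ[ℂ] y)))
            (Φ (DirectSum.lof ℂ ℕ (fun k => N k ⊗[ℂ] SphHarm l k) k (x' ⊗ₜ[ℂ] y')))
            = (C k).inner x x' * (H k).inner y y')) := by
  refine ⟨exists_isScalarHighestWeight (m + l) 0 hn, fun k => ?_, ?_⟩
  · have h : ((((m + l : ℕ) : ℝ) - 2) / 2 + k) = minWeight (m + (l + 2 * k)) := by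
      rw [minWeight]
      push_cast
      ring
    rw [h]
    exact exists_isScalarHighestWeight m (l + 2 * k) (by omega)
  · intro M _ _ π B hM N _ _ σ C hN H hH
    -- Transport to the polynomial model. It is isometric only up to c, which the summands absorb in
    -- their normalization.
    obtain ⟨Ψ, c, hc, hΨ, hΨB⟩ := exists_equiv_harmRep hn hM
    choose Φ h1 h2 h3 v hv0 hv T hT hTv hΦT using
      fun k => exists_summand hn k (hN k) (hH k) hc
    have horth : ∀ k k', k ≠ k' →
        ∀ (w : N k ⊗[ℂ] SphHarm l k) (w' : N k' ⊗[ℂ] SphHarm l k'), coreForm (harmCore (m + l) hn) (Φ k w) (Φ k' w') = 0 := by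
      intro k k' hk w w'
      induction w using TensorProduct.induction_on with
      | zero => simp
      | add w₁ w₂ hw₁ hw₂ => rw [map_add, map_add, LinearMap.add_apply, hw₁, hw₂, add_zero]
      | tmul x y =>
        induction w' using TensorProduct.induction_on with
        | zero => simp
        | add w₁ w₂ hw₁ hw₂ => rw [map_add, map_add, hw₁, hw₂, add_zero]
        | tmul x' y' =>
          rw [hΦT, hΦT]
          -- Orthogonality of the summands reduces to that of the images of the highest weight
          -- vectors, which are spherical harmonics of different degrees.
          refine inner_intertwiner_eq_zero Z0_lie_lie_lie (harmRep_invariant hn).restrict (hv k)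
            (mem_cyclic_of_isScalarHighestWeight (hN k) (hv0 k)) (hv k')
            (mem_cyclic_of_isScalarHighestWeight (hN k') (hv0 k')) (hT k y) (hT k' y') ?_ x x'
          obtain ⟨z, hz⟩ := hTv k y
          obtain ⟨z', hz'⟩ := hTv k' y'
          rw [hz, hz', inner_sphIncl_eq_zero hn hk]
    obtain ⟨e, hlof, hequiv⟩ := exists_directSum_equiv (V := fun k => N k ⊗[ℂ] SphHarm l k)
      (fun k => boxTensor (σ k) (sphHarmRep l k)) ((harmRep (m + l)).comp (blockIncl m l))
      (harmCore (m + l) hn) Φ h1 (fun k => injective_of_inner_tmul (C k) (H k)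
        ((c : ℂ) • coreForm (harmCore (m + l) hn)) (Φ k) (h2 k)) horth
      fun W hW hΦW => eq_top_of_sphIncl_mem hn (fun X _ w hw => hW (X, 0) trivial w hw)
        fun k y => hΦW k (h3 k y)
    have he : ∀ w, Ψ ((e.trans Ψ.symm) w) = e w := fun w => Ψ.apply_symm_apply _
    refine ⟨e.trans Ψ.symm, fun Z w => Ψ.injective ?_, fun k k' hk x x' => ?_,
      fun k x x' y y' => ?_⟩
    · rw [hΨ, he, he, hequiv]
      rfl
    · rw [← coreForm_apply, hΨB, he, he, hlof, hlof, horth k k' hk, mul_zero]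
    · rw [← coreForm_apply, hΨB, he, he, hlof, hlof, h2]
      rfl
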